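/- Model. Let $e^0,\dots,e^7$ be the coordinate $1$-forms of $\mathbb R^8$ and identify $\mathbb R^8=\mathbb O$. Let $\Gamma(q)=\begin{pmatrix}0&L_{\bar q}\\ L_q&0\end{pmatrix}$ be the octonionic Clifford matrices on $S=S^+\oplus S^-$, $S^\pm=\mathbb C\otimes\mathbb O=\mathbb C^8$ (so $\Gamma(q)^2=|q|^2$), where $L_q$ is left multiplication by $q$. Let $\langle\cdot,\cdot\rangle$ be the complex bilinear invariant pairing on spinors and $\hat\psi$ the complex conjugate spinor. For $\psi\in S^+$ let $\langle\psi,\Gamma\Gamma\Gamma\Gamma\psi\rangle$ be the complex $4$-form on $\mathbb R^8$ obtained by antisymmetrising $\langle\psi,\Gamma(v_1)\Gamma(v_2)\Gamma(v_3)\Gamma(v_4)\psi\rangle$. Put $$\Omega_0=(e^4+ie^0)\wedge(e^1+ie^5)\wedge(e^2+ie^6)\wedge(e^3+ie^7),\qquad \omega_0=e^1\wedge e^5+e^2\wedge e^6+e^3\wedge e^7+e^4\wedge e^0 .$$ Let $M$ be a smooth $8$-manifold and $\tau\neq0$ a real constant. A complex Cayley form of parameter $\tau$ on $M$ is a smooth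 complex $4$-form $\Phi_\tau$ for which there is a smooth Riemannian metric on $M$ such that at every point, in some orthonormal frame, $\Phi_\tau=\langle\psi,\Gamma\Gamma\Gamma\Gamma\psi\rangle$ for a complex unit Weyl spinor $\psi\in S^+$, i.e. $\langle\psi,\psi\rangle=1$, with $\langle\hat\psi,\psi\rangle=\cosh 2\tau$. An $\mathrm{SU}(4)$ structure on $M$ is a triple $(g,\omega,\Omega)$ of a smooth Riemannian metric, a smooth real $2$-form and a smooth complex $4$-form which at every point are, in a suitable frame, the standard inner product, $\omega_0$ and $\Omega_0$. It is integrable (torsion-free) if there is a torsion-free connection $\nabla$ on $TM$ (necessarily the Levi-Civita connection of $g$) with $\nabla g=0$, $\nabla\omega=0$, $\nabla\Omega=0$. Proposition. Let $\Phi_\tau$ be a complex Cayley form of parameter $\tau\ne0$ on $M$. Then there is exactly one $\mathrm{SU}(4)$ structure $(g,\omega,\Omega)$ on $M$ with $$\Phi_\tau=\cosh(2\tau)\,\mathrm{Re}\,\Omega-\tfrac12\,\omega\wedge\omega+i\sinh(2\tau)\,\mathrm{Im}\,\Omega ,$$ the $\mathrm{SU}(4)$ structure defined by $\Phi_\tau$,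 and it is integrable if and only if $d\Phi_\tau=0$. -/

import Mathlib

open scoped Manifold ContDiff

noncomputable section

/-! ## The octonionic model of the Clifford algebra of `ℝ⁸` -/

/-- The Euclidean space `ℝ⁸` with orthonormal coordinates `x⁰, …, x⁷`. -/
abbrev E8 : Type := EuclideanSpace ℝ (Fin 8)

/-- The elementary generator `E_{ij}` of `𝔰𝔬(8)`. -/
def so8Gen (i j : Fin 8) : Matrix (Fin 8) (Fin 8) ℂ :=
  Matrix.single i j 1 - Matrix.single j i 1

/-- Left multiplication on `ℂ ⊗ 𝕆` by the octonion units `𝕀, 𝐞¹, …, 𝐞⁷`. -/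
def octonionLeft : Fin 8 → Matrix (Fin 8) (Fin 8) ℂ :=
  ![1,
    -so8Gen 0 1 + so8Gen 2 7 - so8Gen 3 6 + so8Gen 4 5,
    -so8Gen 0 2 - so8Gen 1 7 + so8Gen 3 5 + so8Gen 4 6,
    -so8Gen 0 3 + so8Gen 1 6 - so8Gen 2 5 + so8Gen 4 7,
    -so8Gen 0 4 - so8Gen 1 5 - so8Gen 2 6 - so8Gen 3 7,
    -so8Gen 0 5 + so8Gen 1 4 + so8Gen 2 3 - so8Gen 6 7,
    -so8Gen 0 6 - so8Gen 1 3 + so8Gen 2 4 + so8Gen 5 7,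
    -so8Gen 0 7 + so8Gen 1 2 + so8Gen 3 4 - so8Gen 5 6]

/-- `L_q`, left multiplication by the octonion `q = q₀ 𝕀 + ∑ qₐ 𝐞ᵃ`. -/
def octonionL (q : E8) : Matrix (Fin 8) (Fin 8) ℂ :=
  ∑ a, (q a : ℂ) • octonionLeft a

/-- The octonion conjugate `q̄`. -/
def octonionConj (q : E8) : E8 :=
  WithLp.toLp 2 (fun a => if a = 0 then q a else -q a)

/-- The Clifford matrix `Γ(q) = (0, L_{q̄}; L_q, 0)` on `S = S⁺ ⊕ S⁻ = (ℂ ⊗ 𝕆) ⊕ (ℂ ⊗ 𝕆)`;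
it satisfies `Γ(q) Γ(q) = |q|²`. -/
def cliffordGamma (q : E8) : Matrix (Fin 8 ⊕ Fin 8) (Fin 8 ⊕ Fin 8) ℂ :=
  Matrix.fromBlocks 0 (octonionL (octonionConj q)) (octonionL q) 0

/-- The inclusion of the complex Weyl spinors `S⁺ = ℂ ⊗ 𝕆` into `S`. -/
def weylSpinor (α : Fin 8 → ℂ) : Fin 8 ⊕ Fin 8 → ℂ := Sum.elim α 0

/-- The complex bilinear, `Spin(8)`-invariant pairing `⟨φ, ψ⟩` on spinors. -/
def spinorPairing (φ ψ : Fin 8 ⊕ Fin 8 → ℂ) : ℂ := φ ⬝ᵥ ψ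

/-- The `4`-form `⟨ψ, Γ Γ Γ Γ ψ⟩` on `ℝ⁸`: the totally antisymmetric part of
`⟨ψ, Γ(v₀) Γ(v₁) Γ(v₂) Γ(v₃) ψ⟩`. On distinct vectors of an orthonormal basis it equals
`⟨ψ, Γ(v₀) Γ(v₁) Γ(v₂) Γ(v₃) ψ⟩`. -/
def spinorFourForm (ψ : Fin 8 ⊕ Fin 8 → ℂ) (v : Fin 4 → E8) : ℂ :=
  (1 / 24 : ℂ) * ∑ σ : Equiv.Perm (Fin 4), ((Equiv.Perm.sign σ : ℤ) : ℂ) *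
    spinorPairing ψ
      ((cliffordGamma (v (σ 0)) * cliffordGamma (v (σ 1)) *
        cliffordGamma (v (σ 2)) * cliffordGamma (v (σ 3))).mulVec ψ)

/-- `α ∈ S⁺` is a complex unit Weyl spinor of parameter `τ`: `⟨α, α⟩ = 1` and
`⟨α̂, α⟩ = cosh (2τ)`, where `α̂` is the complex conjugate spinor. -/
def IsUnitSpinor (τ : ℝ) (α : Fin 8 → ℂ) : Prop :=
  spinorPairing (weylSpinor α) (weylSpinor α) = 1 ∧
    spinorPairing (weylSpinor (star α)) (weylSpinor α) = (Real.cosh (2 * τ) : ℂ)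

/-! ## The standard `SU(4)`-invariant forms on `ℝ⁸` -/

/-- The complex coordinates
`(x⁴ + i x⁰, x¹ + i x⁵, x² + i x⁶, x³ + i x⁷)` on `ℝ⁸ = ℂ⁴`. -/
def stdComplexCoord (x : E8) : Fin 4 → ℂ :=
  ![x 4 + Complex.I * x 0, x 1 + Complex.I * x 5, x 2 + Complex.I * x 6, x 3 + Complex.I * x 7]

/-- The standard `(4,0)`-form
`Ω₀ = (e⁴ + i e⁰) ∧ (e¹ + i e⁵) ∧ (e² + i e⁶) ∧ (e³ + i e⁷)`. -/
def stdOmega (v : Fin 4 → E8) : ℂ :=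
  Matrix.det (Matrix.of fun a b => stdComplexCoord (v b) a)

/-- The standard Kähler form `ω₀ = e¹⁵ + e²⁶ + e³⁷ + e⁴⁰`. -/
def stdKahler (v w : E8) : ℝ :=
  (v 1 * w 5 - v 5 * w 1) + (v 2 * w 6 - v 6 * w 2) +
    (v 3 * w 7 - v 7 * w 3) + (v 4 * w 0 - v 0 * w 4)

/-! ## Differential forms and connections on an `8`-manifold -/

section Manifold

variable (M : Type*) [TopologicalSpace M] [ChartedSpace E8 M]

/-- Differential `k`-forms on `M` with values in `F`, with no regularity imposed. -/
abbrev DiffForm (k : ℕ) (F : Type*) [NormedAddCommGroup F] [NormedSpace ℝ F] : Type _ :=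
  ∀ x : M, TangentSpace 𝓘(ℝ, E8) x [⋀^Fin k]→L[ℝ] F

variable {M} {k : ℕ} {F : Type*} [NormedAddCommGroup F] [NormedSpace ℝ F]

/-- The expression of a form in a chart `e`: its pull-back by `e⁻¹`. Only the values on
`e.target` are meaningful. -/
def DiffForm.inChart (α : DiffForm M k F) (e : OpenPartialHomeomorph M E8) :
    E8 → E8 [⋀^Fin k]→L[ℝ] F :=
  fun y => (α (e.symm y)).compContinuousLinearMap (mfderiv 𝓘(ℝ, E8) 𝓘(ℝ, E8) e.symm y)

/-- A form is smooth if its expression in every chart is. -/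
def DiffForm.IsSmooth (α : DiffForm M k F) : Prop :=
  ∀ e ∈ atlas E8 M, ContDiffOn ℝ ∞ (α.inChart e) e.target

/-- `dα = 0`, the exterior derivative being computed in the charts. -/
def DiffForm.IsClosed (α : DiffForm M k F) : Prop :=
  ∀ e ∈ atlas E8 M, ∀ y ∈ e.target, extDeriv (α.inChart e) y = 0

/-- The wedge product `α ∧ β` of two real `2`-forms, evaluated on four tangent vectors. -/
def DiffForm.wedgeTwo (α β : DiffForm M 2 ℝ) (x : M) (v : Fin 4 → TangentSpace 𝓘(ℝ, E8) x) : ℝ :=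
  α x ![v 0, v 1] * β x ![v 2, v 3] - α x ![v 0, v 2] * β x ![v 1, v 3]
    + α x ![v 0, v 3] * β x ![v 1, v 2] + α x ![v 1, v 2] * β x ![v 0, v 3]
    - α x ![v 1, v 3] * β x ![v 0, v 2] + α x ![v 2, v 3] * β x ![v 0, v 1]

variable [IsManifold 𝓘(ℝ, E8) ∞ M]

variable (M) in
/-- Smooth Riemannian metrics on `M`. -/
abbrev SmoothMetric : Type _ :=
  Bundle.ContMDiffRiemannianMetric 𝓘(ℝ, E8) ∞ E8 (fun x : M => TangentSpace 𝓘(ℝ, E8) x)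

variable (M) in
/-- Affine connections (covariant derivatives on the tangent bundle) on `M`;
`cov Y x v` is `(∇_v Y)(x)`. -/
abbrev AffineConnection : Type _ :=
  CovariantDerivative 𝓘(ℝ, E8) E8 (fun x : M => TangentSpace 𝓘(ℝ, E8) x)

/-- The vector field `Y` is differentiable at `x`. -/
def VectorFieldDifferentiableAt (Y : ∀ x : M, TangentSpace 𝓘(ℝ, E8) x) (x : M) : Prop :=
  MDifferentiableAt 𝓘(ℝ, E8) (𝓘(ℝ, E8).prod 𝓘(ℝ, E8))
    (fun y => (⟨y, Y y⟩ : TangentBundle 𝓘(ℝ, E8) M)) x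

/-- `∇g = 0`, that is `v(g(Y, Z)) = g(∇_v Y, Z) + g(Y, ∇_v Z)`. -/
def AffineConnection.PreservesMetric (cov : AffineConnection M) (g : SmoothMetric M) : Prop :=
  ∀ (x : M) (Y Z : ∀ x : M, TangentSpace 𝓘(ℝ, E8) x),
    VectorFieldDifferentiableAt Y x → VectorFieldDifferentiableAt Z x →
    ∀ v : TangentSpace 𝓘(ℝ, E8) x,
      mvfderiv 𝓘(ℝ, E8) (fun y => g.inner y (Y y) (Z y)) x v =
        g.inner x (cov Y x v) (Z x) + g.inner x (Y x) (cov Z x v)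

/-- `∇α = 0`, that is `v(α(Y₁, …, Yₖ)) = ∑ᵢ α(Y₁, …, ∇_v Yᵢ, …, Yₖ)`. -/
def AffineConnection.PreservesForm (cov : AffineConnection M) (α : DiffForm M k F) : Prop :=
  ∀ (x : M) (Y : Fin k → ∀ x : M, TangentSpace 𝓘(ℝ, E8) x),
    (∀ i, VectorFieldDifferentiableAt (Y i) x) →
    ∀ v : TangentSpace 𝓘(ℝ, E8) x,
      mvfderiv 𝓘(ℝ, E8) (fun y => α y (fun i => Y i y)) x v =
        ∑ i, α x (Function.update (fun j => Y j x) i (cov (Y i) x v))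

/-! ## Complex Cayley forms and `SU(4)` structures -/

/-- `Φ` is a complex Cayley form of parameter `τ`: a smooth complex `4`-form for which there is a
Riemannian metric on `M` such that, at every point and in some orthonormal frame there,
`Φ = ⟨ψ, Γ Γ Γ Γ ψ⟩` for a complex unit Weyl spinor `ψ` with `⟨ψ̂, ψ⟩ = cosh (2τ)`. -/
def IsComplexCayleyForm (τ : ℝ) (Φ : DiffForm M 4 ℂ) : Prop :=
  Φ.IsSmooth ∧ ∃ g : SmoothMetric M, ∀ x : M,
    ∃ (u : E8 ≃L[ℝ] TangentSpace 𝓘(ℝ, E8) x) (ψ : Fin 8 → ℂ),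
      (∀ v w : E8, g.inner x (u v) (u w) = inner ℝ v w) ∧
      IsUnitSpinor τ ψ ∧
      ∀ v : Fin 4 → E8, Φ x (fun i => u (v i)) = spinorFourForm (weylSpinor ψ) v

variable (M) in
/-- An `SU(4)` structure on `M`: a Riemannian metric `g`, a real `2`-form `ω` and a complex
`4`-form `Ω`, all smooth, that are at every point given by the standard inner product,
`ω₀` and `Ω₀` in a suitable frame. The almost complex structure `J` is the one with
`g(v, w) = ω(v, J w)`; `ω` has type `(1,1)` and `Ω` has type `(4,0)` for it. The frames in
question form the reduction of the frame bundle to `SU(4)`, the common stabiliser of the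
three standard tensors. -/
@[ext]
structure SU4Structure where
  metric : SmoothMetric M
  kahler : DiffForm M 2 ℝ
  omega : DiffForm M 4 ℂ
  kahler_smooth : kahler.IsSmooth
  omega_smooth : omega.IsSmooth
  adapted : ∀ x : M, ∃ u : E8 ≃L[ℝ] TangentSpace 𝓘(ℝ, E8) x,
    (∀ v w : E8, metric.inner x (u v) (u w) = inner ℝ v w) ∧
    (∀ v w : E8, kahler x ![u v, u w] = stdKahler v w) ∧
    (∀ v : Fin 4 → E8, omega x (fun i => u (v i)) = stdOmega v)

/-- `Φ = cosh(2τ) Re Ω - ½ ω ∧ ω + i sinh(2τ) Im Ω`: the `SU(4)` structure `S = (g, ω, Ω)` is one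
defined by `Φ`. -/
def SU4Structure.IsDefinedBy (S : SU4Structure M) (τ : ℝ) (Φ : DiffForm M 4 ℂ) : Prop :=
  ∀ (x : M) (v : Fin 4 → TangentSpace 𝓘(ℝ, E8) x),
    Φ x v = ((Real.cosh (2 * τ) * (S.omega x v).re
        - (1 / 2) * S.kahler.wedgeTwo S.kahler x v : ℝ) : ℂ)
      + Complex.I * ((Real.sinh (2 * τ) * (S.omega x v).im : ℝ) : ℂ)

/-- The `SU(4)` structure is integrable (torsion-free): some torsion-free connection preserves it.
As the connection is metric, it is the Levi-Civita connection of `g`, so that no regularity of it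
has to be asked for. -/
def SU4Structure.IsTorsionFree (S : SU4Structure M) : Prop :=
  ∃ cov : AffineConnection M, cov.torsion = 0 ∧ AffineConnection.PreservesMetric cov S.metric ∧
    AffineConnection.PreservesForm cov S.kahler ∧ AffineConnection.PreservesForm cov S.omega

end Manifold

end

open scoped Manifold ContDiff Matrix

/-! Algebra at a point. Splitting a spinor with ⟨ψ, ψ⟩ = 1 and ⟨ψ̂, ψ⟩ = cosh 2τ into real and
imaginary parts gives ψ = cosh τ a + i sinh τ b with a, b real and orthonormal. Spin(8) is
transitive on such pairs (`exists_reflections`), so in some orthonormal frame ψ is `stdSpinor τ` and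
Φ is the model `stdCayley τ` (`spinorFourForm_stdSpinor`). The stabiliser of the model in GL(8, ℝ)
is SU(4) (`stdCayley_stabilizer`): Im Ω₀ fixes the complex structure up to sign, scaling by 1 + i
separates Re Ω₀ from ½ ω₀ ∧ ω₀, and ½ ω₀ ∧ ω₀ then fixes the Hermitian product. Hence the frames in
which Φ is the model define (g, ω, Ω), and uniquely. For smoothness, ω is a constant multiple of the
contraction of Re Φ with Im Φ by the inverse metric (`kahler_eq_contraction`), after which the
formula for Φ is solved for Ω.

Integrability. A torsion-free connection that preserves ω and Ω preserves Φ, and its symmetric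
Christoffel symbols drop out of dΦ, so dΦ = 0.

Conversely let ∇ be the Levi-Civita connection and dΦ = 0. Since sinh 2τ ≠ 0, the imaginary part
says that dΩ is real. For every almost complex structure dΩ vanishes on three vectors of type (0,1);
a real five-form with this property is zero, because conjugation gives the same for type (1,0) and
three of five arguments share a type. So dΩ = 0, and the real part of dΦ = 0 becomes ω ∧ dω = 0,
whence dω = 0 because ω ∧ · is injective on three-forms in dimension eight. Now dΩ = 0 makes J
integrable, and with dω = 0 this yields ∇J = 0. Then ∇Ω = θ ⊗ Ω, where θ is imaginary because Ω has
constant length and of type (1,0) because dΩ = 0; hence θ = 0. This core is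
`covariantDerivative_eq_zero_of_closed`.

The argument runs at one point of one chart, where ∇ is a symmetric bilinear map Γ given by the
Koszul formula. Adapted frames are never differentiated, only the identities that they imply between
the tensors. -/

/-! ### Octonion multiplication as signed integer tables. -/

/-- The sign in `𝐞ᵃ 𝐞ʲ = ± 𝐞ⁱ`. -/
def octonionSign : Fin 8 → Fin 8 → ℤ :=
  ![![1, 1, 1, 1, 1, 1, 1, 1],
    ![1, -1, -1, 1, -1, 1, -1, 1],
    ![1, 1, -1, -1, -1, 1, 1, -1],
    ![1, -1, 1, -1, -1, -1, 1, 1],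
    ![1, 1, 1, 1, -1, -1, -1, -1],
    ![1, -1, -1, 1, 1, -1, 1, -1],
    ![1, 1, -1, -1, 1, -1, -1, 1],
    ![1, -1, 1, -1, 1, 1, -1, -1]]

/-- The index `i` in `𝐞ᵃ 𝐞ʲ = ± 𝐞ⁱ`. -/
def octonionIndex : Fin 8 → Fin 8 → Fin 8 :=
  ![![0, 1, 2, 3, 4, 5, 6, 7],
    ![1, 0, 7, 6, 5, 4, 3, 2],
    ![2, 7, 0, 5, 6, 3, 4, 1],
    ![3, 6, 5, 0, 7, 2, 1, 4],
    ![4, 5, 6, 7, 0, 1, 2, 3],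
    ![5, 4, 3, 2, 1, 0, 7, 6],
    ![6, 3, 4, 1, 2, 7, 0, 5],
    ![7, 2, 1, 4, 3, 6, 5, 0]]

/-- The elementary generator `E_{ij}` of `𝔰𝔬(8)` over the integers. -/
def so8GenInt (i j : Fin 8) : Matrix (Fin 8) (Fin 8) ℤ :=
  Matrix.of fun k l => (if i = k ∧ j = l then 1 else 0) - (if j = k ∧ i = l then 1 else 0)

/-- Left multiplication by the octonion units, with integer entries. -/
def octonionLeftInt : Fin 8 → Matrix (Fin 8) (Fin 8) ℤ :=
  ![1,
    -so8GenInt 0 1 + so8GenInt 2 7 - so8GenInt 3 6 + so8GenInt 4 5,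
    -so8GenInt 0 2 - so8GenInt 1 7 + so8GenInt 3 5 + so8GenInt 4 6,
    -so8GenInt 0 3 + so8GenInt 1 6 - so8GenInt 2 5 + so8GenInt 4 7,
    -so8GenInt 0 4 - so8GenInt 1 5 - so8GenInt 2 6 - so8GenInt 3 7,
    -so8GenInt 0 5 + so8GenInt 1 4 + so8GenInt 2 3 - so8GenInt 6 7,
    -so8GenInt 0 6 - so8GenInt 1 3 + so8GenInt 2 4 + so8GenInt 5 7,
    -so8GenInt 0 7 + so8GenInt 1 2 + so8GenInt 3 4 - so8GenInt 5 6]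

theorem so8GenInt_cast (i j k l : Fin 8) : ((so8GenInt i j k l : ℤ) : ℂ) = so8Gen i j k l := by
  simp [so8GenInt, so8Gen, Matrix.single_apply]

theorem octonionLeftInt_cast (a i j : Fin 8) :
    ((octonionLeftInt a i j : ℤ) : ℂ) = octonionLeft a i j := by
  fin_cases a <;>
    simp [octonionLeftInt, octonionLeft, ← so8GenInt_cast, Matrix.one_apply]

theorem octonionLeftInt_eq (a i j : Fin 8) :
    (octonionLeftInt a i j : ℤ) = if i = octonionIndex a j then octonionSign a j else 0 := by
  have h : ∀ i j a : Fin 8, @Eq ℤ (octonionLeftInt a i j)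
      (if i = octonionIndex a j then octonionSign a j else 0) := by decide +kernel
  exact h i j a

theorem octonionLeft_apply (a i j : Fin 8) :
    octonionLeft a i j = if i = octonionIndex a j then (octonionSign a j : ℂ) else 0 := by
  rw [← octonionLeftInt_cast, octonionLeftInt_eq]
  split_ifs <;> simp

/-- The Clifford relation `Lₐᵀ L_b + L_bᵀ Lₐ = 2 δ` for left multiplications, which over the
integers is a finite check. -/
theorem octonion_clifford_int (a b j k : Fin 8) :
    (∑ i, (octonionLeftInt a i j * octonionLeftInt b i k
      + octonionLeftInt a i k * octonionLeftInt b i j)) =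
      2 * ((if a = b then 1 else 0) * (if j = k then 1 else 0)) := by
  simp only [octonionLeftInt_eq]
  revert a b j k
  decide +kernel

/-- The summation now runs over the vector index: this is the Clifford relation `ρ_j ρ_kᵀ + ρ_k ρ_jᵀ
= 2 δ` for the maps v ↦ L_v 𝐞ʲ. -/
theorem octonion_clifford_int' (a b j k : Fin 8) :
    (∑ i, (octonionLeftInt i a j * octonionLeftInt i b k
      + octonionLeftInt i a k * octonionLeftInt i b j)) =
      2 * ((if a = b then 1 else 0) * (if j = k then 1 else 0)) := by
  simp only [octonionLeftInt_eq]
  revert a b j k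
  decide +kernel

/-! ### Right multiplication by a spinor and triality. -/

section Rho
variable {A : Type*} [CommRing A]

/-- The matrix of `v ↦ L_v s`, i.e. right multiplication by the spinor `s`. -/
def octonionRho (s : Fin 8 → A) : Matrix (Fin 8) (Fin 8) A :=
  Matrix.of fun i a => ∑ j, ((octonionLeftInt a i j : ℤ) : A) * s j

/-- Triality: the table identity, read with spinors in the role of vectors, is again a Clifford
relation. -/
theorem octonionRho_clifford (s t : Fin 8 → A) :
    (octonionRho s).transpose * octonionRho t + (octonionRho t).transpose * octonionRho s =
      (2 * s ⬝ᵥ t) • (1 : Matrix (Fin 8) (Fin 8) A) := by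
  ext a b
  have h : ∀ j k, (∑ i, (((octonionLeftInt a i j : ℤ) : A) * ((octonionLeftInt b i k : ℤ) : A)
      + ((octonionLeftInt a i k : ℤ) : A) * ((octonionLeftInt b i j : ℤ) : A))) =
      2 * ((if a = b then 1 else 0) * (if j = k then 1 else 0)) := fun j k => by
    exact_mod_cast congrArg (Int.cast : ℤ → A) (octonion_clifford_int a b j k)
  calc _ = ∑ i, ∑ j, ∑ k, (((octonionLeftInt a i j : ℤ) : A) * ((octonionLeftInt b i k : ℤ) : A)
      + ((octonionLeftInt a i k : ℤ) : A) * ((octonionLeftInt b i j : ℤ) : A)) * (s j * t k) := by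
        simp only [Matrix.add_apply, Matrix.mul_apply, Matrix.transpose_apply, octonionRho,
          Matrix.of_apply, ← Finset.sum_add_distrib]
        refine Finset.sum_congr rfl fun i _ => ?_
        simp only [add_mul, Finset.sum_add_distrib, Finset.sum_mul_sum]
        congr 1
        · exact Finset.sum_congr rfl fun j _ => Finset.sum_congr rfl fun k _ => by ring
        · rw [Finset.sum_comm]
          exact Finset.sum_congr rfl fun j _ => Finset.sum_congr rfl fun k _ => by ring
    _ = ∑ j, ∑ k, (∑ i, (((octonionLeftInt a i j : ℤ) : A) * ((octonionLeftInt b i k : ℤ) : A)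
      + ((octonionLeftInt a i k : ℤ) : A) * ((octonionLeftInt b i j : ℤ) : A))) * (s j * t k) := by
        rw [Finset.sum_comm]
        refine Finset.sum_congr rfl fun j _ => ?_
        rw [Finset.sum_comm]
        simp only [Finset.sum_mul]
    _ = _ := by
        simp only [h, dotProduct, Matrix.smul_apply, Matrix.one_apply, smul_eq_mul, Finset.mul_sum,
          Finset.sum_mul]
        refine Finset.sum_congr rfl fun j _ => ?_
        rw [Finset.sum_eq_single j (fun k _ hk => by simp [hk.symm]) (by simp)]
        simp

theorem octonionRho_clifford' (s t : Fin 8 → A) :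
    octonionRho s * (octonionRho t).transpose + octonionRho t * (octonionRho s).transpose =
      (2 * s ⬝ᵥ t) • (1 : Matrix (Fin 8) (Fin 8) A) := by
  ext a b
  have h : ∀ j k, (∑ i, (((octonionLeftInt i a j : ℤ) : A) * ((octonionLeftInt i b k : ℤ) : A)
      + ((octonionLeftInt i a k : ℤ) : A) * ((octonionLeftInt i b j : ℤ) : A))) =
      2 * ((if a = b then 1 else 0) * (if j = k then 1 else 0)) := fun j k => by
    exact_mod_cast congrArg (Int.cast : ℤ → A) (octonion_clifford_int' a b j k)
  calc _ = ∑ i, ∑ j, ∑ k, (((octonionLeftInt i a j : ℤ) : A) * ((octonionLeftInt i b k : ℤ) : A)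
      + ((octonionLeftInt i a k : ℤ) : A) * ((octonionLeftInt i b j : ℤ) : A)) * (s j * t k) := by
        simp only [Matrix.add_apply, Matrix.mul_apply, Matrix.transpose_apply, octonionRho,
          Matrix.of_apply, ← Finset.sum_add_distrib]
        refine Finset.sum_congr rfl fun i _ => ?_
        simp only [add_mul, Finset.sum_add_distrib, Finset.sum_mul_sum]
        congr 1
        · exact Finset.sum_congr rfl fun j _ => Finset.sum_congr rfl fun k _ => by ring
        · rw [Finset.sum_comm]
          exact Finset.sum_congr rfl fun j _ => Finset.sum_congr rfl fun k _ => by ring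
    _ = ∑ j, ∑ k, (∑ i, (((octonionLeftInt i a j : ℤ) : A) * ((octonionLeftInt i b k : ℤ) : A)
      + ((octonionLeftInt i a k : ℤ) : A) * ((octonionLeftInt i b j : ℤ) : A))) * (s j * t k) := by
        rw [Finset.sum_comm]
        refine Finset.sum_congr rfl fun j _ => ?_
        rw [Finset.sum_comm]
        simp only [Finset.sum_mul]
    _ = _ := by
        simp only [h, dotProduct, Matrix.smul_apply, Matrix.one_apply, smul_eq_mul, Finset.mul_sum,
          Finset.sum_mul]
        refine Finset.sum_congr rfl fun j _ => ?_
        rw [Finset.sum_eq_single j (fun k _ hk => by simp [hk.symm]) (by simp)]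
        simp

theorem octonionRho_smul (c : A) (s : Fin 8 → A) : octonionRho (c • s) = c • octonionRho s := by
  ext i a
  simp only [octonionRho, Matrix.of_apply, Matrix.smul_apply, smul_eq_mul, Pi.smul_apply,
    Finset.mul_sum]
  exact Finset.sum_congr rfl fun j _ => by ring

theorem octonionRho_sub (s t : Fin 8 → A) :
    octonionRho (s - t) = octonionRho s - octonionRho t := by
  ext i a
  simp [octonionRho, mul_sub]

/-- The matrix of `φ ↦ 2 ⟨s, φ⟩ s - φ`. -/
def spinorReflection (s : Fin 8 → A) : Matrix (Fin 8) (Fin 8) A :=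
  (2 : A) • Matrix.vecMulVec s s - 1

theorem spinorReflection_mulVec (s φ : Fin 8 → A) :
    spinorReflection s *ᵥ φ = (2 * s ⬝ᵥ φ) • s - φ := by
  rw [spinorReflection, Matrix.sub_mulVec, Matrix.smul_mulVec, Matrix.vecMulVec_mulVec,
    Matrix.one_mulVec]
  congr 1
  ext i
  simp; ring

theorem octonionRho_orthogonal {K : Type*} [Field K] [CharZero K] {s : Fin 8 → K}
    (hs : s ⬝ᵥ s = 1) :
    (octonionRho s).transpose * octonionRho s = 1 ∧
      octonionRho s * (octonionRho s).transpose = 1 := by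
  have h1 := octonionRho_clifford s s
  have h2 := octonionRho_clifford' s s
  rw [hs, mul_one, ← two_smul K] at h1 h2
  exact ⟨smul_right_injective _ (two_ne_zero' K) h1, smul_right_injective _ (two_ne_zero' K) h2⟩

/-- The Clifford relation moves `ρ(φ)` past `ρ(s)`. The sandwich form is what lifts a reflection of
spinors to the other two eight-dimensional representations. -/
theorem octonionRho_reflection {s : Fin 8 → A} (hs : octonionRho s * (octonionRho s).transpose = 1)
    (hs' : (octonionRho s).transpose * octonionRho s = 1) (φ : Fin 8 → A) :
    octonionRho (spinorReflection s *ᵥ φ) =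
      octonionRho s * (octonionRho φ).transpose * octonionRho s := by
  have h := octonionRho_clifford' s φ
  rw [spinorReflection_mulVec, octonionRho_sub, octonionRho_smul, eq_sub_of_add_eq h, sub_mul,
    Matrix.mul_assoc (octonionRho φ), hs', Matrix.smul_mul, Matrix.one_mul, Matrix.mul_one]

theorem spinorReflection_transpose (s : Fin 8 → A) :
    (spinorReflection s).transpose = spinorReflection s := by
  ext i j
  simp [spinorReflection, Matrix.vecMulVec_apply, Matrix.one_apply, mul_comm, eq_comm]

theorem spinorReflection_mul_self {s : Fin 8 → A} (hs : s ⬝ᵥ s = 1) :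
    spinorReflection s * spinorReflection s = 1 := by
  refine Matrix.ext_of_mulVec_single fun j => ?_
  rw [← Matrix.mulVec_mulVec, spinorReflection_mulVec, spinorReflection_mulVec, dotProduct_sub,
    dotProduct_smul, hs, Matrix.one_mulVec]
  ext i
  simp; ring

theorem octonionRho_mulVec_sum (s : Fin 8 → A) (v : Fin 8 → A) (i : Fin 8) :
    (octonionRho s *ᵥ v) i = ∑ a, ∑ j, ((octonionLeftInt a i j : ℤ) : A) * s j * v a := by
  simp [octonionRho, Matrix.mulVec, dotProduct, Finset.sum_mul]

end Rho

/-! ### Spin(8)-invariance of the four-form. -/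

theorem octonionL_mulVec (v : E8) (α : Fin 8 → ℂ) :
    octonionL v *ᵥ α = octonionRho α *ᵥ (fun a => (v a : ℂ)) := by
  ext i
  rw [octonionRho_mulVec_sum]
  simp only [octonionL, Matrix.mulVec, dotProduct, Matrix.sum_apply, Matrix.smul_apply,
    smul_eq_mul, ← octonionLeftInt_cast, Finset.sum_mul]
  rw [Finset.sum_comm]
  exact Finset.sum_congr rfl fun a _ => Finset.sum_congr rfl fun j _ => by ring

theorem octonionLeftInt_transpose (a i j : Fin 8) :
    (octonionLeftInt a j i : ℤ) = if a = 0 then octonionLeftInt a i j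
      else -octonionLeftInt a i j := by
  simp only [octonionLeftInt_eq]
  revert a i j
  decide +kernel

theorem octonionL_conj (v : E8) : octonionL (octonionConj v) = (octonionL v).transpose := by
  ext i j
  simp only [octonionL, Matrix.sum_apply, Matrix.smul_apply, Matrix.transpose_apply,
    smul_eq_mul, ← octonionLeftInt_cast, octonionConj]
  refine Finset.sum_congr rfl fun a _ => ?_
  rw [octonionLeftInt_transpose a i j]
  split_ifs <;> simp

/-- The quadrilinear form whose antisymmetrisation is `spinorFourForm`. -/
def spinorQuad (α : Fin 8 → ℂ) (v : Fin 4 → E8) : ℂ :=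
  α ⬝ᵥ ((octonionL (v 0)).transpose * octonionL (v 1) *
    (octonionL (v 2)).transpose * octonionL (v 3)) *ᵥ α

theorem spinorPairing_cliffordGamma (α : Fin 8 → ℂ) (v : Fin 4 → E8) :
    spinorPairing (weylSpinor α) ((cliffordGamma (v 0) * cliffordGamma (v 1) *
        cliffordGamma (v 2) * cliffordGamma (v 3)).mulVec (weylSpinor α)) = spinorQuad α v := by
  simp only [spinorPairing, weylSpinor, cliffordGamma, Matrix.fromBlocks_multiply,
    Matrix.fromBlocks_mulVec, spinorQuad, octonionL_conj]
  simp [Matrix.mul_assoc, dotProduct, Matrix.mulVec, Function.comp_def]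

theorem spinorFourForm_eq (α : Fin 8 → ℂ) (v : Fin 4 → E8) :
    spinorFourForm (weylSpinor α) v = (1 / 24 : ℂ) * ∑ σ : Equiv.Perm (Fin 4),
      ((Equiv.Perm.sign σ : ℤ) : ℂ) * spinorQuad α (v ∘ σ) := by
  simp only [spinorFourForm, ← spinorPairing_cliffordGamma, Function.comp_apply]

/-- The rotation of `ℝ⁸` induced by the product of two reflections of the spinor space. -/
def spinorRotation {A : Type*} [CommRing A] (s t : Fin 8 → A) : Matrix (Fin 8) (Fin 8) A :=
  (octonionRho s).transpose * octonionRho t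

/-- Two sandwiches turn `ρ(α)` into `ρ(s) ρ(t)ᵀ ρ(α) ρ(t)ᵀ ρ(s)`, and the rotation cancels the last
two factors. -/
theorem octonionRho_rotation {K : Type*} [Field K] [CharZero K] {s t : Fin 8 → K}
    (hs : s ⬝ᵥ s = 1) (ht : t ⬝ᵥ t = 1) (α : Fin 8 → K) :
    octonionRho (spinorReflection s *ᵥ spinorReflection t *ᵥ α) * spinorRotation s t =
      octonionRho s * (octonionRho t).transpose * octonionRho α := by
  obtain ⟨hs1, hs2⟩ := octonionRho_orthogonal hs
  obtain ⟨ht1, ht2⟩ := octonionRho_orthogonal ht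
  rw [octonionRho_reflection hs2 hs1, octonionRho_reflection ht2 ht1, spinorRotation]
  simp only [Matrix.transpose_mul, Matrix.transpose_transpose, Matrix.mul_assoc]
  rw [← Matrix.mul_assoc (octonionRho s) (octonionRho s).transpose, hs2, Matrix.one_mul, ht1,
    Matrix.mul_one]

theorem spinorRotation_orthogonal {K : Type*} [Field K] [CharZero K] {s t : Fin 8 → K}
    (hs : s ⬝ᵥ s = 1) (ht : t ⬝ᵥ t = 1) :
    (spinorRotation s t).transpose * spinorRotation s t = 1 := by
  obtain ⟨hs1, hs2⟩ := octonionRho_orthogonal hs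
  obtain ⟨ht1, ht2⟩ := octonionRho_orthogonal ht
  rw [spinorRotation, Matrix.transpose_mul, Matrix.transpose_transpose, Matrix.mul_assoc,
    ← Matrix.mul_assoc (octonionRho s), hs2, Matrix.one_mul, ht1]

/-- One element of Spin(8) in its three representations: the rotation of vectors is intertwined with
`ρ(s) ρ(t)ᵀ` on S⁻ and the product of reflections on S⁺. Both sides are compared on basis spinors,
where L_v α is `ρ(α)` applied to v. -/
theorem octonionL_rotation {s t : Fin 8 → ℂ} (hs : s ⬝ᵥ s = 1) (ht : t ⬝ᵥ t = 1) {v w : E8}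
    (hw : (fun i => (w i : ℂ)) = spinorRotation s t *ᵥ (fun i => (v i : ℂ))) :
    octonionL w = octonionRho s * (octonionRho t).transpose * octonionL v *
      (spinorReflection s * spinorReflection t).transpose := by
  have hQ : spinorReflection s * spinorReflection t *
      (spinorReflection s * spinorReflection t).transpose = 1 := by
    rw [Matrix.transpose_mul, spinorReflection_transpose, spinorReflection_transpose,
      Matrix.mul_assoc, ← Matrix.mul_assoc (spinorReflection t), spinorReflection_mul_self ht,
      Matrix.one_mul, spinorReflection_mul_self hs]
  have h : octonionL w * (spinorReflection s * spinorReflection t) =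
      octonionRho s * (octonionRho t).transpose * octonionL v := by
    refine Matrix.ext_of_mulVec_single fun j => ?_
    rw [← Matrix.mulVec_mulVec, octonionL_mulVec, hw, ← Matrix.mulVec_mulVec (Pi.single j 1),
      Matrix.mulVec_mulVec, octonionRho_rotation hs ht, ← Matrix.mulVec_mulVec,
      ← Matrix.mulVec_mulVec (Pi.single j 1), octonionL_mulVec]
  rw [← h, Matrix.mul_assoc, hQ, Matrix.mul_one]

/-- Each `L_w` is `P L_v Qᵀ` with `P`, `Q` orthogonal. In `LᵀL LᵀL` the inner factors cancel,
leaving a conjugation by `Q`, which is absorbed by applying `Q` to the spinor. -/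
theorem spinorQuad_rotation {s t : Fin 8 → ℂ} (hs : s ⬝ᵥ s = 1) (ht : t ⬝ᵥ t = 1)
    {v w : Fin 4 → E8}
    (hw : ∀ k, (fun i => (w k i : ℂ)) = spinorRotation s t *ᵥ (fun i => (v k i : ℂ)))
    (α : Fin 8 → ℂ) :
    spinorQuad (spinorReflection s *ᵥ spinorReflection t *ᵥ α) w = spinorQuad α v := by
  obtain ⟨hs1, hs2⟩ := octonionRho_orthogonal hs
  obtain ⟨ht1, ht2⟩ := octonionRho_orthogonal ht
  set P := octonionRho s * (octonionRho t).transpose with hP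
  set Q := spinorReflection s * spinorReflection t with hQdef
  have hPP : P.transpose * P = 1 := by
    rw [hP, Matrix.transpose_mul, Matrix.transpose_transpose, Matrix.mul_assoc,
      ← Matrix.mul_assoc (octonionRho s).transpose, hs1, Matrix.one_mul, ht2]
  have hQQ : Q.transpose * Q = 1 := by
    rw [hQdef, Matrix.transpose_mul, spinorReflection_transpose, spinorReflection_transpose,
      Matrix.mul_assoc, ← Matrix.mul_assoc (spinorReflection s), spinorReflection_mul_self hs,
      Matrix.one_mul, spinorReflection_mul_self ht]
  have hL := fun k => octonionL_rotation hs ht (hw k)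
  have hc : ∀ A B : Matrix (Fin 8) (Fin 8) ℂ,
      (P * A * Q.transpose).transpose * (P * B * Q.transpose) =
        Q * (A.transpose * B) * Q.transpose := fun A B => by
    calc _ = Q * A.transpose * (P.transpose * P) * B * Q.transpose := by
          simp only [Matrix.transpose_mul, Matrix.transpose_transpose, Matrix.mul_assoc]
      _ = _ := by rw [hPP]; simp only [Matrix.mul_assoc, Matrix.one_mul]
  have hd : ∀ A B : Matrix (Fin 8) (Fin 8) ℂ,
      Q * A * Q.transpose * (Q * B * Q.transpose) = Q * (A * B) * Q.transpose := fun A B => by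
    calc _ = Q * A * (Q.transpose * Q) * B * Q.transpose := by simp only [Matrix.mul_assoc]
      _ = _ := by rw [hQQ]; simp only [Matrix.mul_assoc, Matrix.one_mul]
  have hm : (octonionL (w 0)).transpose * octonionL (w 1) *
      (octonionL (w 2)).transpose * octonionL (w 3) =
      Q * ((octonionL (v 0)).transpose * octonionL (v 1) *
        (octonionL (v 2)).transpose * octonionL (v 3)) * Q.transpose := by
    rw [Matrix.mul_assoc _ _ (octonionL (w 3)), hL, hL, hL, hL, hc, hc, hd]
    simp only [Matrix.mul_assoc]
  have hα : spinorReflection s *ᵥ spinorReflection t *ᵥ α = Q *ᵥ α := Matrix.mulVec_mulVec ..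
  clear_value Q
  rw [spinorQuad, spinorQuad, hm, hα, Matrix.mulVec_mulVec, Matrix.mul_assoc _ Q.transpose Q, hQQ,
    Matrix.mul_one]
  generalize (octonionL (v 0)).transpose * octonionL (v 1) *
        (octonionL (v 2)).transpose * octonionL (v 3) = X
  rw [← Matrix.mulVec_mulVec, Matrix.dotProduct_mulVec, Matrix.vecMul_mulVec, hQQ,
    Matrix.vecMul_one]

/-! ### Normal form of a complex unit spinor. -/

/-- For a ≠ c the vector t is (a − c)/|a − c|; for a = c it is n. The last clause keeps a second
reflection from spoiling what the first one arranged. -/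
theorem exists_reflection {a c n : Fin 8 → ℝ} (ha : a ⬝ᵥ a = 1) (hc : c ⬝ᵥ c = 1)
    (hn : n ⬝ᵥ n = 1) (hnc : n ⬝ᵥ c = 0) :
    ∃ t : Fin 8 → ℝ, t ⬝ᵥ t = 1 ∧ spinorReflection t *ᵥ a = -c ∧
      ∀ x : Fin 8 → ℝ, a ⬝ᵥ x = 0 → c ⬝ᵥ x = 0 → n ⬝ᵥ x = 0 → t ⬝ᵥ x = 0 := by
  by_cases hac : a = c
  · subst hac
    exact ⟨n, hn, by simp [spinorReflection_mulVec, hnc], fun x _ _ h => h⟩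
  · have hd : 0 < (a - c) ⬝ᵥ (a - c) :=
      lt_of_le_of_ne (Finset.sum_nonneg fun i _ => mul_self_nonneg _)
        (Ne.symm (fun h => hac (sub_eq_zero.1 (dotProduct_self_eq_zero.1 h))))
    have hda : (a - c) ⬝ᵥ (a - c) = 2 * ((a - c) ⬝ᵥ a) := by
      simp only [sub_dotProduct, dotProduct_sub, ha, hc, dotProduct_comm c a]
      ring
    set r := Real.sqrt ((a - c) ⬝ᵥ (a - c)) with hr
    have hr2 : r * r = (a - c) ⬝ᵥ (a - c) := Real.mul_self_sqrt hd.le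
    have hr0 : r ≠ 0 := (Real.sqrt_pos.2 hd).ne'
    refine ⟨r⁻¹ • (a - c), ?_, ?_, fun x h1 h2 _ => by simp [h1, h2]⟩
    · rw [smul_dotProduct, dotProduct_smul, ← hr2, smul_eq_mul, smul_eq_mul]
      field_simp
    · rw [spinorReflection_mulVec, smul_dotProduct, smul_smul]
      have : 2 * r⁻¹ • ((a - c) ⬝ᵥ a) * r⁻¹ = 1 := by
        rw [smul_eq_mul]
        field_simp
        rw [sq, hr2, hda]
      rw [this, one_smul]
      abel

theorem spinorReflection_isometry {A : Type*} [CommRing A] {s : Fin 8 → A} (hs : s ⬝ᵥ s = 1)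
    (φ χ : Fin 8 → A) :
    (spinorReflection s *ᵥ φ) ⬝ᵥ (spinorReflection s *ᵥ χ) = φ ⬝ᵥ χ := by
  rw [Matrix.dotProduct_mulVec, Matrix.vecMul_mulVec, spinorReflection_transpose,
    spinorReflection_mul_self hs, Matrix.vecMul_one]

/-- Two reflections carry an orthonormal pair of real spinors to `(𝕀, 𝐞⁴)`. -/
theorem exists_reflections {a b : Fin 8 → ℝ} (ha : a ⬝ᵥ a = 1) (hb : b ⬝ᵥ b = 1)
    (hab : a ⬝ᵥ b = 0) :
    ∃ s t : Fin 8 → ℝ, s ⬝ᵥ s = 1 ∧ t ⬝ᵥ t = 1 ∧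
      spinorReflection s *ᵥ spinorReflection t *ᵥ a = Pi.single 0 1 ∧
      spinorReflection s *ᵥ spinorReflection t *ᵥ b = Pi.single 4 1 := by
  obtain ⟨t, ht, hta, -⟩ := exists_reflection (c := Pi.single 0 1) (n := Pi.single 1 1) ha
    (by simp) (by simp) (by simp)
  have hb' := spinorReflection_isometry ht b b
  have hab' := spinorReflection_isometry ht a b
  rw [hb] at hb'
  rw [hab, hta, neg_dotProduct, neg_eq_zero] at hab'
  -- The target −𝐞⁴ compensates the sign in `exists_reflection`. As s is orthogonal to 𝕀, the
  -- reflection in s sends −𝕀 to 𝕀.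
  obtain ⟨s, hs, hsb, hx⟩ := exists_reflection (c := -Pi.single 4 1) (n := Pi.single 1 1) hb'
    (by simp) (by simp) (by simp)
  refine ⟨s, t, hs, ht, ?_, ?_⟩
  · rw [hta, spinorReflection_mulVec, dotProduct_neg, hx (Pi.single 0 1) ?_ (by simp) (by simp)]
    · simp
    · rw [dotProduct_comm, hab']
  · rw [hsb, neg_neg]

/-- A complex unit spinor of parameter `τ ≠ 0` is `cosh τ a + i sinh τ b` with `a`, `b`
orthonormal. -/
theorem IsUnitSpinor.exists_orthonormal {τ : ℝ} (hτ : τ ≠ 0) {α : Fin 8 → ℂ}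
    (hα : IsUnitSpinor τ α) :
    ∃ a b : Fin 8 → ℝ, a ⬝ᵥ a = 1 ∧ b ⬝ᵥ b = 1 ∧ a ⬝ᵥ b = 0 ∧
      ∀ i, α i = Real.cosh τ * a i + Complex.I * (Real.sinh τ * b i) := by
  obtain ⟨h1, h2⟩ := hα
  set x : Fin 8 → ℝ := fun i => (α i).re with hx
  set y : Fin 8 → ℝ := fun i => (α i).im with hy
  have e1 : x ⬝ᵥ x - y ⬝ᵥ y = 1 := by
    have := congrArg Complex.re h1
    simpa [spinorPairing, weylSpinor, dotProduct, Finset.sum_sub_distrib] using this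
  have e2 : x ⬝ᵥ y = 0 := by
    have := congrArg Complex.im h1
    simp only [spinorPairing, weylSpinor, dotProduct, Fintype.sum_sum_type, Sum.elim_inl,
      Sum.elim_inr, Pi.zero_apply, mul_zero, Finset.sum_const_zero, add_zero, Complex.im_sum,
      Complex.mul_im, Complex.one_im, Finset.sum_add_distrib] at this
    have h : ∑ i, (α i).im * (α i).re = x ⬝ᵥ y := Finset.sum_congr rfl fun i _ => mul_comm _ _
    rw [h] at this
    have h' : ∑ i, (α i).re * (α i).im = x ⬝ᵥ y := rfl
    rw [h'] at this
    linarith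
  have e3 : x ⬝ᵥ x + y ⬝ᵥ y = Real.cosh (2 * τ) := by
    have := congrArg Complex.re h2
    rw [Complex.ofReal_re] at this
    simpa [spinorPairing, weylSpinor, dotProduct, Finset.sum_add_distrib] using this
  have hs : Real.sinh τ ≠ 0 := Real.sinh_ne_zero.2 hτ
  have hc : Real.cosh τ ≠ 0 := (Real.cosh_pos τ).ne'
  have hcs := Real.cosh_sq τ
  rw [Real.cosh_two_mul] at e3
  -- The sum and difference of `e3` and `e1` give |x| = cosh τ and |y| = |sinh τ|; τ ≠ 0 allows y to
  -- be normalised.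
  refine ⟨(Real.cosh τ)⁻¹ • x, (Real.sinh τ)⁻¹ • y, ?_, ?_, by simp [e2], fun i => ?_⟩
  · have : x ⬝ᵥ x = Real.cosh τ ^ 2 := by linarith
    simp only [smul_dotProduct, dotProduct_smul, this, smul_eq_mul]
    field_simp
  · have : y ⬝ᵥ y = Real.sinh τ ^ 2 := by linarith
    simp only [smul_dotProduct, dotProduct_smul, this, smul_eq_mul]
    field_simp
  · have h1 : (Real.cosh τ : ℂ) ≠ 0 := by exact_mod_cast hc
    have h2 : (Real.sinh τ : ℂ) ≠ 0 := by exact_mod_cast hs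
    simp only [Pi.smul_apply, smul_eq_mul, Complex.ofReal_mul, Complex.ofReal_inv,
      mul_inv_cancel_left₀ h1, mul_inv_cancel_left₀ h2, hx, hy]
    rw [mul_comm Complex.I, Complex.re_add_im]

theorem spinorReflection_map (s φ : Fin 8 → ℝ) :
    spinorReflection (fun i => (s i : ℂ)) *ᵥ (fun i => (φ i : ℂ)) =
      fun i => (((spinorReflection s *ᵥ φ) i : ℝ) : ℂ) := by
  ext i
  simp [spinorReflection_mulVec, dotProduct]

/-- The model spinor `cosh τ 𝕀 + i sinh τ 𝐞⁴`. -/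
noncomputable def stdSpinor (τ : ℝ) : Fin 8 → ℂ :=
  (Real.cosh τ : ℂ) • Pi.single 0 1 + (Complex.I * Real.sinh τ) • Pi.single 4 1

/-- The vectors s and t are real, so their rotation acts on ℝ⁸, while their complexified reflections
carry α to the model spinor. -/
theorem IsUnitSpinor.exists_rotation {τ : ℝ} (hτ : τ ≠ 0) {α : Fin 8 → ℂ}
    (hα : IsUnitSpinor τ α) :
    ∃ R : E8 ≃ₗᵢ[ℝ] E8, ∀ v : Fin 4 → E8,
      spinorFourForm (weylSpinor (stdSpinor τ)) (fun i => R (v i)) =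
        spinorFourForm (weylSpinor α) v := by
  obtain ⟨a, b, ha, hb, hab, hα⟩ := hα.exists_orthonormal hτ
  obtain ⟨s, t, hs, ht, hsa, hsb⟩ := exists_reflections ha hb hab
  have hs' : (fun i => (s i : ℂ)) ⬝ᵥ (fun i => (s i : ℂ)) = 1 := by
    have := congrArg (Complex.ofReal) hs
    simpa [dotProduct] using this
  have ht' : (fun i => (t i : ℂ)) ⬝ᵥ (fun i => (t i : ℂ)) = 1 := by
    have := congrArg (Complex.ofReal) ht
    simpa [dotProduct] using this
  have hstd : stdSpinor τ = spinorReflection (fun i => (s i : ℂ)) *ᵥ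
      spinorReflection (fun i => (t i : ℂ)) *ᵥ α := by
    have : α = (Real.cosh τ : ℂ) • (fun i => (a i : ℂ)) +
        (Complex.I * Real.sinh τ) • (fun i => (b i : ℂ)) := by
      ext i
      rw [hα i]
      simp; ring
    rw [this]
    simp only [Matrix.mulVec_add, Matrix.mulVec_smul, spinorReflection_map, hsa, hsb, stdSpinor]
    congr 2 <;> ext i <;> simp [Pi.single_apply, apply_ite]
  have hR := spinorRotation_orthogonal hs ht
  let f : E8 →ₗ[ℝ] E8 := Matrix.toEuclideanLin (spinorRotation s t)
  have hf : ∀ x y : E8, inner ℝ (f x) (f y) = inner ℝ x y := fun x y => by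
    simp only [EuclideanSpace.inner_eq_star_dotProduct, f, Matrix.ofLp_toLpLin, Matrix.toLin'_apply,
      star_trivial]
    rw [Matrix.dotProduct_mulVec, Matrix.vecMul_mulVec, hR, Matrix.vecMul_one]
  refine ⟨(f.isometryOfInner hf).toLinearIsometryEquiv rfl, fun v => ?_⟩
  rw [spinorFourForm_eq, spinorFourForm_eq, hstd]
  congr 1
  refine Finset.sum_congr rfl fun σ _ => ?_
  rw [spinorQuad_rotation hs' ht' (v := v ∘ σ)]
  intro k
  ext i
  simp [f, spinorRotation, Matrix.toLpLin_apply, Matrix.mulVec, dotProduct, Matrix.mul_apply,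
    octonionRho]

/-! ### Integer tables for the standard forms and for the spinor four-form. -/

/-- The complex coordinate of which the basis vector `eₐ` is a multiple. -/
def stdIndex : Fin 8 → Fin 4 := ![0, 1, 2, 3, 0, 1, 2, 3]

/-- The power of `i` that is the nonzero complex coordinate of `eₐ`. -/
def stdPhase : Fin 8 → ℕ := ![1, 0, 0, 0, 0, 1, 1, 1]

/-- The Levi-Civita symbol. -/
def leviCivitaInt (a b c d : Fin 4) : ℤ :=
  Int.sign (b - a : ℤ) * Int.sign (c - a : ℤ) * Int.sign (d - a : ℤ) * Int.sign (c - b : ℤ) *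
    Int.sign (d - b : ℤ) * Int.sign (d - c : ℤ)

/-- `Re (iⁿ)`. -/
def rePowI (n : ℕ) : ℤ := if n % 4 = 0 then 1 else if n % 4 = 2 then -1 else 0

/-- `Im (iⁿ)`. -/
def imPowI (n : ℕ) : ℤ := if n % 4 = 1 then 1 else if n % 4 = 3 then -1 else 0

/-- The components of `Re Ω₀`. -/
def reOmegaInt (a b c d : Fin 8) : ℤ :=
  rePowI (stdPhase a + stdPhase b + stdPhase c + stdPhase d) *
    leviCivitaInt (stdIndex a) (stdIndex b) (stdIndex c) (stdIndex d)

/-- The components of `Im Ω₀`. -/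
def imOmegaInt (a b c d : Fin 8) : ℤ :=
  imPowI (stdPhase a + stdPhase b + stdPhase c + stdPhase d) *
    leviCivitaInt (stdIndex a) (stdIndex b) (stdIndex c) (stdIndex d)

/-- The components of `ω₀`. -/
def kahlerInt (a b : Fin 8) : ℤ :=
  if stdIndex a = stdIndex b then (stdPhase b : ℤ) - stdPhase a else 0

/-- The components of `½ ω₀ ∧ ω₀`. -/
def kahlerSqInt (a b c d : Fin 8) : ℤ :=
  kahlerInt a b * kahlerInt c d - kahlerInt a c * kahlerInt b d + kahlerInt a d * kahlerInt b c

theorem pow_I_eq (n : ℕ) : Complex.I ^ n = rePowI n + imPowI n * Complex.I := by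
  have h : n % 4 < 4 := Nat.mod_lt _ (by norm_num)
  rw [← Nat.div_add_mod n 4, pow_add, pow_mul, Complex.I_pow_four, one_pow, one_mul]
  simp only [rePowI, imPowI, Nat.mul_add_mod_self_left, Nat.mod_mod]
  interval_cases n % 4 <;> simp [Complex.I_pow_three]

theorem det_levi_int : ∀ k : Fin 4 → Fin 4,
    (Matrix.of fun a b : Fin 4 => if k b = a then (1 : ℤ) else 0).det =
      leviCivitaInt (k 0) (k 1) (k 2) (k 3) := by
  decide +kernel

theorem stdComplexCoord_single (a : Fin 8) (i : Fin 4) :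
    stdComplexCoord (EuclideanSpace.single a 1) i =
      Complex.I ^ stdPhase a * if stdIndex a = i then 1 else 0 := by
  fin_cases a <;> fin_cases i <;> simp [stdComplexCoord, stdPhase, stdIndex]

theorem stdOmega_single (k : Fin 4 → Fin 8) :
    stdOmega (fun i => EuclideanSpace.single (k i) 1) =
      reOmegaInt (k 0) (k 1) (k 2) (k 3) + imOmegaInt (k 0) (k 1) (k 2) (k 3) * Complex.I := by
  have h := congrArg (Int.cast : ℤ → ℂ) (det_levi_int (fun i => stdIndex (k i)))
  have e : (Matrix.of fun a b : Fin 4 => stdComplexCoord (EuclideanSpace.single (k b) 1) a) =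
      Matrix.of fun a b => (fun b => Complex.I ^ stdPhase (k b)) b *
        ((Matrix.of fun a b : Fin 4 => if stdIndex (k b) = a then (1 : ℤ) else 0).map
          (Int.castRingHom ℂ)) a b := by
    ext a b
    simp [stdComplexCoord_single]
  rw [stdOmega, e]
  erw [Matrix.det_mul_row, ← RingHom.map_det]
  rw [eq_intCast, h]
  simp only [Fin.prod_univ_four, ← pow_add]
  rw [pow_I_eq, reOmegaInt, imOmegaInt]
  push_cast
  ring

theorem stdKahler_single (a b : Fin 8) :
    stdKahler (EuclideanSpace.single a 1) (EuclideanSpace.single b 1) = kahlerInt a b := by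
  fin_cases a <;> fin_cases b <;> simp [stdKahler, kahlerInt, stdPhase, stdIndex]

/-- The sign in `L_a 𝐞ʲ` transposed. -/
def octonionSignT (a j : Fin 8) : ℤ := if a = 0 then octonionSign a j else -octonionSign a j

/-- The entries of `L_aᵀ L_b L_cᵀ L_d`. -/
def octonionQuadInt (a b c d i j : Fin 8) : ℤ :=
  let j₁ := octonionIndex d j
  let j₂ := octonionIndex c j₁
  let j₃ := octonionIndex b j₂
  if i = octonionIndex a j₃ then
    octonionSign d j * octonionSignT c j₁ * octonionSign b j₂ * octonionSignT a j₃ else 0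

-- On cosh τ 𝕀 + i sinh τ 𝐞⁴ the quadrilinear form is cosh² times the (0,0) entry, minus sinh² times
-- the (4,4) entry, plus i cosh sinh times the two mixed entries. These identities turn that into
-- the coefficients of `stdCayley`; repeated indices do not matter after antisymmetrisation.
set_option synthInstance.maxHeartbeats 400000 in
set_option synthInstance.maxSize 4096 in
theorem octonionQuadInt_eq : ∀ a b c d : Fin 8, a ≠ b → a ≠ c → a ≠ d → b ≠ c → b ≠ d → c ≠ d →
    octonionQuadInt a b c d 0 0 = reOmegaInt a b c d - kahlerSqInt a b c d ∧
    octonionQuadInt a b c d 4 4 = -reOmegaInt a b c d - kahlerSqInt a b c d ∧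
    octonionQuadInt a b c d 0 4 + octonionQuadInt a b c d 4 0 = 2 * imOmegaInt a b c d := by
  decide +kernel

/-- Contracting three slots recovers ω₀ from Ω₀. This is the source of the formula for ω in terms of
Φ and g. -/
theorem sum_reOmegaInt_mul_imOmegaInt : ∀ a b : Fin 8,
    ∑ i, ∑ j, ∑ k, reOmegaInt a i j k * imOmegaInt b i j k = 24 * kahlerInt a b := by
  decide +kernel

/-- Type reason: three slots of a (4,0) or (0,4) form cannot be paired with three slots of a (2,2)
form. -/
theorem sum_kahlerSqInt_mul_imOmegaInt : ∀ a b : Fin 8,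
    ∑ i, ∑ j, ∑ k, kahlerSqInt a i j k * imOmegaInt b i j k = 0 := by
  decide +kernel

section Tables

theorem octonionLeft_mulVec_single (a j : Fin 8) :
    octonionLeft a *ᵥ Pi.single j 1 =
      (octonionSign a j : ℂ) • (Pi.single (octonionIndex a j) 1 : Fin 8 → ℂ) := by
  ext i
  simp [octonionLeft_apply, Pi.single_apply]

theorem octonionLeft_transpose_mulVec_single (a j : Fin 8) :
    (octonionLeft a).transpose *ᵥ Pi.single j 1 =
      (octonionSignT a j : ℂ) • (Pi.single (octonionIndex a j) 1 : Fin 8 → ℂ) := by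
  ext i
  have h := congrArg (Int.cast : ℤ → ℂ) (octonionLeftInt_transpose a i j)
  rw [octonionLeftInt_cast] at h
  simp only [Matrix.mulVec_single_one, Matrix.col_apply, Matrix.transpose_apply, h,
    octonionLeftInt_eq, octonionSignT, Pi.smul_apply, Pi.single_apply, smul_eq_mul]
  split_ifs <;> simp

theorem octonionQuad_apply (a b c d i j : Fin 8) :
    ((octonionLeft a).transpose * octonionLeft b * (octonionLeft c).transpose *
      octonionLeft d) i j = (octonionQuadInt a b c d i j : ℂ) := by
  have h : ((octonionLeft a).transpose * octonionLeft b * (octonionLeft c).transpose *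
      octonionLeft d) *ᵥ Pi.single j 1 = fun i => (octonionQuadInt a b c d i j : ℂ) := by
    simp only [← Matrix.mulVec_mulVec, octonionLeft_mulVec_single,
      octonionLeft_transpose_mulVec_single, Matrix.mulVec_smul]
    ext i
    simp only [octonionQuadInt, Pi.smul_apply, Pi.single_apply, smul_eq_mul]
    split_ifs <;> simp [mul_assoc]
  rw [← congrFun h i, Matrix.mulVec_single_one, Matrix.col_apply]

theorem octonionL_single (a : Fin 8) : octonionL (EuclideanSpace.single a 1) = octonionLeft a := by
  simp [octonionL, apply_ite]

theorem spinorQuad_stdSpinor (τ : ℝ) (k : Fin 4 → Fin 8) :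
    spinorQuad (stdSpinor τ) (fun i => EuclideanSpace.single (k i) 1) =
      (Real.cosh τ : ℂ) ^ 2 * octonionQuadInt (k 0) (k 1) (k 2) (k 3) 0 0 -
      (Real.sinh τ : ℂ) ^ 2 * octonionQuadInt (k 0) (k 1) (k 2) (k 3) 4 4 +
      Complex.I * (Real.cosh τ * Real.sinh τ) *
        (octonionQuadInt (k 0) (k 1) (k 2) (k 3) 0 4 +
          octonionQuadInt (k 0) (k 1) (k 2) (k 3) 4 0) := by
  simp only [spinorQuad, octonionL_single, stdSpinor, Matrix.mulVec_add, Matrix.mulVec_smul,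
    dotProduct_add, dotProduct_smul, add_dotProduct, smul_dotProduct, Matrix.mulVec_single_one,
    single_one_dotProduct, Matrix.col_apply, octonionQuad_apply, smul_eq_mul]
  linear_combination (Real.sinh τ : ℂ) ^ 2 * octonionQuadInt (k 0) (k 1) (k 2) (k 3) 4 4 *
    Complex.I_sq

end Tables

/-! ### The four-form of the model spinor. -/

section StdForms

theorem octonionL_add (v w : E8) : octonionL (v + w) = octonionL v + octonionL w := by
  simp [octonionL, add_smul, Finset.sum_add_distrib]

theorem octonionL_smul (c : ℝ) (v : E8) : octonionL (c • v) = (c : ℂ) • octonionL v := by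
  simp [octonionL, Finset.smul_sum, mul_smul]

/-- `spinorQuad` as a multilinear map. -/
noncomputable def spinorQuadMultilinear (α : Fin 8 → ℂ) : MultilinearMap ℝ (fun _ : Fin 4 => E8) ℂ :=
  MultilinearMap.mk' (spinorQuad α)
    (by
      intro m i x y
      fin_cases i <;>
        simp [spinorQuad, octonionL_add, Function.update, Matrix.mul_add, Matrix.add_mul,
          Matrix.add_mulVec])
    (by
      intro m i c x
      fin_cases i <;>
        simp [spinorQuad, octonionL_smul, Function.update, Matrix.smul_mulVec])

/-- The form `⟨ψ, ΓΓΓΓ ψ⟩` as an alternating map. -/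
noncomputable def spinorFourFormAlt (α : Fin 8 → ℂ) : E8 [⋀^Fin 4]→ₗ[ℝ] ℂ :=
  (1 / 24 : ℝ) • MultilinearMap.alternatization (spinorQuadMultilinear α)

theorem spinorFourFormAlt_apply (α : Fin 8 → ℂ) (v : Fin 4 → E8) :
    spinorFourFormAlt α v = spinorFourForm (weylSpinor α) v := by
  rw [spinorFourForm_eq, spinorFourFormAlt, AlternatingMap.smul_apply,
    MultilinearMap.alternatization_apply, Complex.real_smul]
  push_cast
  congr 1
  refine Finset.sum_congr rfl fun σ _ => ?_
  rw [Units.smul_def, zsmul_eq_mul]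
  rfl

/-- The complex coordinates of `ℝ⁸`, as a linear map. -/
def stdComplexCoordLin : E8 →ₗ[ℝ] (Fin 4 → ℂ) where
  toFun := stdComplexCoord
  map_add' x y := by ext i; fin_cases i <;> simp [stdComplexCoord] <;> ring
  map_smul' c x := by ext i; fin_cases i <;> simp [stdComplexCoord] <;> ring

theorem stdOmega_update (v : Fin 4 → E8) (i : Fin 4) (x : E8) :
    stdOmega (Function.update v i x) = ((Matrix.of fun a b => stdComplexCoord (v b) a).updateCol i
      (stdComplexCoordLin x)).det := by
  rw [stdOmega]
  congr 1
  ext a b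
  by_cases h : b = i
  · subst h; simp [stdComplexCoordLin]
  · simp [h]

/-- `Ω₀` as a continuous alternating map. -/
noncomputable def stdOmegaAlt : E8 [⋀^Fin 4]→L[ℝ] ℂ where
  toFun := stdOmega
  map_update_add' m i x y := by
    have : ‹DecidableEq (Fin 4)› = instDecidableEqFin 4 := Subsingleton.elim _ _
    subst this
    rw [stdOmega_update, stdOmega_update, stdOmega_update, map_add, Matrix.det_updateCol_add]
  map_update_smul' m i c x := by
    have : ‹DecidableEq (Fin 4)› = instDecidableEqFin 4 := Subsingleton.elim _ _
    subst this
    rw [stdOmega_update, stdOmega_update, map_smul, ← Complex.coe_smul (E := Fin 4 → ℂ),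
      Matrix.det_updateCol_smul, Complex.real_smul]
  map_eq_zero_of_eq' v i j hij hne :=
    Matrix.det_zero_of_column_eq hne fun k => by simp [hij]
  cont := by
    have h : Continuous stdComplexCoordLin := LinearMap.continuous_of_finiteDimensional _
    exact Continuous.matrix_det (A := fun v : Fin 4 → E8 => Matrix.of fun a b =>
      stdComplexCoordLin (v b) a) (continuous_matrix fun a b =>
        (continuous_apply a).comp (h.comp (continuous_apply b)))

theorem stdOmegaAlt_apply (v : Fin 4 → E8) : stdOmegaAlt v = stdOmega v := rfl

/-- The square of a bilinear form, evaluated as `½ κ ∧ κ`. -/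
def halfWedge {V : Type*} (κ : V → V → ℝ) (a b c d : V) : ℝ :=
  κ a b * κ c d - κ a c * κ b d + κ a d * κ b c

/-- `½ ω₀ ∧ ω₀` as an alternating map. -/
def stdKahlerSqAlt : E8 [⋀^Fin 4]→ₗ[ℝ] ℝ where
  toFun v := halfWedge stdKahler (v 0) (v 1) (v 2) (v 3)
  map_update_add' m i x y := by
    have : ‹DecidableEq (Fin 4)› = instDecidableEqFin 4 := Subsingleton.elim _ _
    subst this
    fin_cases i <;> simp [halfWedge, stdKahler, Function.update] <;> ring
  map_update_smul' m i c x := by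
    have : ‹DecidableEq (Fin 4)› = instDecidableEqFin 4 := Subsingleton.elim _ _
    subst this
    fin_cases i <;> simp [halfWedge, stdKahler, Function.update] <;> ring
  map_eq_zero_of_eq' v i j hij hne := by
    fin_cases i <;> fin_cases j <;> first
      | exact absurd rfl hne
      | (simp only [Fin.zero_eta, Fin.mk_one, Fin.reduceFinMk] at hij
         simp only [halfWedge, hij, stdKahler]
         ring)

/-- The model `cosh(2τ) Re Ω₀ - ½ ω₀ ∧ ω₀ + i sinh(2τ) Im Ω₀` of a complex Cayley form. -/
noncomputable def stdCayley (τ : ℝ) (v : Fin 4 → E8) : ℂ :=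
  ((Real.cosh (2 * τ) * (stdOmega v).re - halfWedge stdKahler (v 0) (v 1) (v 2) (v 3) : ℝ) : ℂ)
    + Complex.I * ((Real.sinh (2 * τ) * (stdOmega v).im : ℝ) : ℂ)

/-- `stdCayley` as an alternating map. -/
noncomputable def stdCayleyAlt (τ : ℝ) : E8 [⋀^Fin 4]→ₗ[ℝ] ℂ :=
  Complex.ofRealCLM.toLinearMap.compAlternatingMap
    (Real.cosh (2 * τ) • (Complex.reLm.compAlternatingMap stdOmegaAlt.toAlternatingMap)
      - stdKahlerSqAlt) +
    Complex.I • Complex.ofRealCLM.toLinearMap.compAlternatingMap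
      (Real.sinh (2 * τ) • (Complex.imLm.compAlternatingMap stdOmegaAlt.toAlternatingMap))

theorem stdCayleyAlt_apply (τ : ℝ) (v : Fin 4 → E8) : stdCayleyAlt τ v = stdCayley τ v := by
  have h : stdOmegaAlt.toAlternatingMap v = stdOmega v := stdOmegaAlt_apply v
  simp [stdCayleyAlt, stdCayley, h, stdKahlerSqAlt]

theorem spinorFourForm_stdSpinor (τ : ℝ) (v : Fin 4 → E8) :
    spinorFourForm (weylSpinor (stdSpinor τ)) v = stdCayley τ v := by
  rw [← spinorFourFormAlt_apply, ← stdCayleyAlt_apply]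
  congr 1
  refine (EuclideanSpace.basisFun (Fin 8) ℝ).toBasis.ext_alternating fun k hk => ?_
  simp only [OrthonormalBasis.coe_toBasis, EuclideanSpace.basisFun_apply]
  have key : ∀ k : Fin 4 → Fin 8, Function.Injective k →
      spinorQuad (stdSpinor τ) (fun i => EuclideanSpace.single (k i) 1) =
        stdCayleyAlt τ (fun i => EuclideanSpace.single (k i) 1) := by
    intro k hk
    obtain ⟨h1, h2, h3⟩ := octonionQuadInt_eq (k 0) (k 1) (k 2) (k 3) (hk.ne (by decide))
      (hk.ne (by decide)) (hk.ne (by decide)) (hk.ne (by decide)) (hk.ne (by decide))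
      (hk.ne (by decide))
    have h3' := congrArg (Int.cast : ℤ → ℂ) h3
    push_cast at h3'
    have hc := Real.cosh_sq τ
    rw [spinorQuad_stdSpinor, stdCayleyAlt_apply, stdCayley, stdOmega_single, h1, h2, h3']
    simp only [halfWedge, stdKahler_single, kahlerSqInt, Real.cosh_two_mul, Real.sinh_two_mul]
    generalize Real.cosh τ = C at hc ⊢
    generalize Real.sinh τ = S at hc ⊢
    have hc' : (C : ℂ) ^ 2 = (S : ℂ) ^ 2 + 1 := by exact_mod_cast hc
    push_cast
    simp only [Complex.add_re, Complex.add_im, Complex.intCast_re, Complex.intCast_im,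
      Complex.mul_re, Complex.mul_im, Complex.I_re, Complex.I_im]
    push_cast
    -- The coefficient of ½ ω₀ ∧ ω₀ is −(cosh² τ − sinh² τ) = −1.
    linear_combination (-(kahlerInt (k 0) (k 1) * kahlerInt (k 2) (k 3) -
      kahlerInt (k 0) (k 2) * kahlerInt (k 1) (k 3) +
      kahlerInt (k 0) (k 3) * kahlerInt (k 1) (k 2)) : ℂ) * hc'
  -- By `key` the quadrilinear form already agrees with an alternating one on distinct basis
  -- vectors, so the 24 terms of the antisymmetrisation are equal.
  rw [spinorFourFormAlt, AlternatingMap.smul_apply, MultilinearMap.alternatization_apply]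
  have : ∀ σ : Equiv.Perm (Fin 4), Equiv.Perm.sign σ • (spinorQuadMultilinear
      (stdSpinor τ)).domDomCongr σ (fun i => EuclideanSpace.single (k i) 1) =
      stdCayleyAlt τ (fun i => EuclideanSpace.single (k i) 1) := by
    intro σ
    have h := key (k ∘ σ) (hk.comp σ.injective)
    have h' := (stdCayleyAlt τ).map_perm (fun i => EuclideanSpace.single (k i) 1) σ
    have e : (spinorQuadMultilinear (stdSpinor τ)).domDomCongr σ
        (fun i => EuclideanSpace.single (k i) 1) = stdCayleyAlt τ
          (fun i => EuclideanSpace.single ((k ∘ σ) i) 1) := h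
    rw [e]
    have e' : (stdCayleyAlt τ) (fun i => EuclideanSpace.single ((k ∘ σ) i) 1) =
      Equiv.Perm.sign σ • stdCayleyAlt τ (fun i => EuclideanSpace.single (k i) 1) := h'
    rw [e', smul_smul, Int.units_mul_self, one_smul]
  rw [Finset.sum_congr rfl fun σ _ => this σ]
  simp [Fintype.card_perm, Nat.factorial]

theorem IsUnitSpinor.exists_frame {τ : ℝ} (hτ : τ ≠ 0) {α : Fin 8 → ℂ} (hα : IsUnitSpinor τ α) :
    ∃ R : E8 ≃ₗᵢ[ℝ] E8, ∀ v : Fin 4 → E8,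
      spinorFourForm (weylSpinor α) (fun i => R (v i)) = stdCayley τ v := by
  obtain ⟨R, hR⟩ := hα.exists_rotation hτ
  refine ⟨R.symm, fun v => ?_⟩
  rw [← hR, ← spinorFourForm_stdSpinor]
  simp

end StdForms

/-! ### Linear algebra of ℂ⁴: the stabiliser of the model is SU(4). -/

/-- The complex Euclidean space `ℂ⁴`. -/
abbrev C4 : Type := EuclideanSpace ℂ (Fin 4)

/-- The identification `ℝ⁸ = ℂ⁴` given by the complex coordinates. -/
noncomputable def stdComplexEquiv : E8 ≃ₗ[ℝ] C4 where
  toFun x := WithLp.toLp 2 (stdComplexCoord x)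
  map_add' x y := by
    have := stdComplexCoordLin.map_add x y
    exact congrArg (WithLp.toLp 2) this
  map_smul' c x := by
    have := stdComplexCoordLin.map_smul c x
    exact congrArg (WithLp.toLp 2) this
  invFun z := WithLp.toLp 2
    ![(z 0).im, (z 1).re, (z 2).re, (z 3).re, (z 0).re, (z 1).im, (z 2).im, (z 3).im]
  left_inv x := by
    ext i
    fin_cases i <;> simp [stdComplexCoord]
  right_inv z := by
    ext i
    fin_cases i <;> simp [stdComplexCoord, mul_comm Complex.I]

theorem inner_stdComplexEquiv (x y : E8) :
    inner ℂ (stdComplexEquiv x) (stdComplexEquiv y) =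
      (inner ℝ x y : ℝ) + Complex.I * (stdKahler x y : ℝ) := by
  apply Complex.ext
  · simp [stdComplexEquiv, stdComplexCoord, PiLp.inner_apply, Fin.sum_univ_succ, stdKahler]
    ring
  · simp [stdComplexEquiv, stdComplexCoord, PiLp.inner_apply, Fin.sum_univ_succ, stdKahler]
    ring

namespace C4

/-- The determinant of four vectors of `ℂ⁴`. -/
noncomputable def vol (a b c d : C4) : ℂ :=
  Matrix.det (Matrix.of fun i j => (![a, b, c, d] j) i)

theorem vol_smul (r s t u : ℂ) (a b c d : C4) :
    vol (r • a) (s • b) (t • c) (u • d) = r * s * t * u * vol a b c d := by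
  simp only [vol, Matrix.det_succ_row_zero, Fin.sum_univ_succ]
  simp [Fin.succAbove]
  ring

/-- Replacing x by i x turns the hypothesis into one on the real part, so vol(v, w, x, y) vanishes;
basis vectors x, y then yield the 2 × 2 minors of (v, w). -/
theorem minor_eq_zero {v w : C4} (h : ∀ x y, (vol v w x y).im = 0) (i j : Fin 4) :
    v i * w j = v j * w i := by
  have h' : ∀ x y, vol v w x y = 0 := fun x y => by
    refine Complex.ext ?_ (h x y)
    have := h (Complex.I • x) y
    have e := vol_smul 1 1 Complex.I 1 v w x y
    simp only [one_smul, one_mul, mul_one] at e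
    rw [e] at this
    simpa using this
  have e01 := h' (EuclideanSpace.single 0 1) (EuclideanSpace.single 1 1)
  have e02 := h' (EuclideanSpace.single 0 1) (EuclideanSpace.single 2 1)
  have e03 := h' (EuclideanSpace.single 0 1) (EuclideanSpace.single 3 1)
  have e12 := h' (EuclideanSpace.single 1 1) (EuclideanSpace.single 2 1)
  have e13 := h' (EuclideanSpace.single 1 1) (EuclideanSpace.single 3 1)
  have e23 := h' (EuclideanSpace.single 2 1) (EuclideanSpace.single 3 1)
  simp [vol, Matrix.det_succ_row_zero, Fin.sum_univ_succ, Fin.succAbove] at e01 e02 e03 e12 e13 e23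
  fin_cases i <;> fin_cases j <;> simp only [Fin.zero_eta, Fin.mk_one, Fin.reduceFinMk] <;>
    first
      | ring1
      | linear_combination e01
      | linear_combination -e01
      | linear_combination e02
      | linear_combination -e02
      | linear_combination e03
      | linear_combination -e03
      | linear_combination e12
      | linear_combination -e12
      | linear_combination e13
      | linear_combination -e13
      | linear_combination e23
      | linear_combination -e23

theorem exists_smul_of_vol_im {v w : C4} (hv : v ≠ 0) (h : ∀ x y, (vol v w x y).im = 0) :
    ∃ c : ℂ, w = c • v := by
  obtain ⟨k, hk⟩ : ∃ k, v k ≠ 0 := by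
    by_contra! hc
    exact hv (by ext i; simpa using hc i)
  refine ⟨w k / v k, ?_⟩
  ext i
  have := minor_eq_zero h i k
  simp only [PiLp.smul_apply, smul_eq_mul]
  field_simp
  linear_combination -this

/-- For independent x, y the scalars agree, both being the scalar of x + y; standard basis vectors
then link all nonzero vectors. -/
theorem eq_smul_of_forall_exists_smul {K : C4 →ₗ[ℝ] C4} (h : ∀ x, ∃ c : ℂ, K x = c • x) :
    ∃ μ : ℂ, ∀ x, K x = μ • x := by
  choose c hc using h
  have key : ∀ x y : C4, LinearIndependent ℂ ![x, y] → c x = c y := by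
    intro x y hxy
    rw [LinearIndependent.pair_iff] at hxy
    have h1 := map_add K x y
    rw [hc, hc, hc] at h1
    obtain ⟨h2, h3⟩ := hxy (c (x + y) - c x) (c (x + y) - c y) (by
      rw [sub_smul, sub_smul, ← sub_eq_zero.2 h1, smul_add]; abel)
    rw [← sub_eq_zero.1 h2, ← sub_eq_zero.1 h3]
  have hi : ∀ x : C4, ∀ i j : Fin 4, i ≠ j → x i ≠ 0 →
      c x = c (EuclideanSpace.single j 1) := fun x i j hij hx => key _ _ <| by
    rw [LinearIndependent.pair_iff]
    intro s t hst
    have e1 := congrArg (fun z : C4 => z i) hst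
    have e2 := congrArg (fun z : C4 => z j) hst
    simp [hij] at e1 e2
    have hs : s = 0 := e1.resolve_right hx
    simp [hs] at e2
    exact ⟨hs, e2⟩
  have hs : ∀ i j : Fin 4, c (EuclideanSpace.single i 1) = c (EuclideanSpace.single j 1) :=
    fun i j => by
      by_cases hij : i = j
      · rw [hij]
      · exact hi _ i j hij (by simp)
  refine ⟨c (EuclideanSpace.single 0 1), fun x => ?_⟩
  by_cases hx : x = 0
  · simp [hx]
  · obtain ⟨k, hk⟩ : ∃ k, x k ≠ 0 := by
      by_contra! hc
      exact hx (by ext i; simpa using hc i)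
    obtain ⟨j, hj⟩ : ∃ j, k ≠ j := ⟨k + 1, by fin_cases k <;> decide⟩
    rw [hc, hi x k j hj hk, hs j 0]

/-- The imaginary part of the Hermitian product. -/
noncomputable def kahler (x y : C4) : ℝ := (inner ℂ x y).im

theorem kahler_smul (c : ℂ) (x y : C4) :
    kahler (c • x) (c • y) = Complex.normSq c * kahler x y := by
  rw [kahler, inner_smul_left, inner_smul_right, ← mul_assoc, ← Complex.normSq_eq_conj_mul_self,
    Complex.im_ofReal_mul, kahler]

/-- On the span of two complex lines ½ κ ∧ κ is the Gram determinant, through which it controls the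
metric. -/
theorem halfWedge_kahler (x y : C4) :
    halfWedge kahler x (Complex.I • x) y (Complex.I • y) =
      ‖x‖ ^ 2 * ‖y‖ ^ 2 - Complex.normSq (inner ℂ x y) := by
  simp only [halfWedge, kahler, inner_smul_left, inner_smul_right, inner_self_eq_norm_sq_to_K]
  simp [Complex.normSq_apply, ← Complex.ofReal_pow]
  ring

/-- On an eigenbasis of `T* T` the Gram determinants give λᵢ λⱼ = 1 for i ≠ j. With at least three
positive eigenvalues, all of them equal 1. -/
theorem inner_map_of_halfWedge {T : C4 →ₗ[ℂ] C4} (hT : Function.Injective T)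
    (h : ∀ a b c d, halfWedge kahler (T a) (T b) (T c) (T d) = halfWedge kahler a b c d)
    (x y : C4) : inner ℂ (T x) (T y) = inner ℂ x y := by
  let P : C4 →ₗ[ℂ] C4 := LinearMap.adjoint T ∘ₗ T
  have hP : P.IsSymmetric := fun x y => by
    simp [P, LinearMap.adjoint_inner_left, LinearMap.adjoint_inner_right]
  have hn : Module.finrank ℂ C4 = 4 := by simp
  set b := hP.eigenvectorBasis hn with hb
  set l := hP.eigenvalues hn with hl
  have hTP : ∀ x y, inner ℂ (T x) (T y) = inner ℂ (P x) y := fun x y => by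
    simp [P, LinearMap.adjoint_inner_left]
  have hbb : ∀ i j, inner ℂ (T (b i)) (T (b j)) = if i = j then (l i : ℂ) else 0 := by
    intro i j
    rw [hTP, hP.apply_eigenvectorBasis hn i, inner_smul_left, b.inner_eq_ite]
    split_ifs <;> simp [hl]
  have hpos : ∀ i, 0 < l i := fun i => by
    have h1 := hbb i i
    rw [if_pos rfl, inner_self_eq_norm_sq_to_K] at h1
    have h2 : ‖T (b i)‖ ^ 2 = l i := Complex.ofReal_injective (by simpa using h1)
    rw [← h2]
    have : T (b i) ≠ 0 := fun h0 => b.toBasis.ne_zero i (by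
      simpa using hT (h0.trans (map_zero T).symm))
    positivity
  have hll : ∀ i j, i ≠ j → l i * l j = 1 := fun i j hij => by
    have h1 := h (b i) (Complex.I • b i) (b j) (Complex.I • b j)
    rw [map_smul, map_smul, halfWedge_kahler, halfWedge_kahler, hbb, b.inner_eq_ite, if_neg hij,
      if_neg hij] at h1
    have h2 : ∀ i, ‖T (b i)‖ ^ 2 = l i := fun i => by
      have h1 := hbb i i
      rw [if_pos rfl, inner_self_eq_norm_sq_to_K] at h1
      exact Complex.ofReal_injective (by simpa using h1)
    rw [h2, h2] at h1
    simpa using h1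
  have hl1 : ∀ i, l i = 1 := fun i => by
    obtain ⟨j, k, hij, hik, hjk⟩ : ∃ j k : Fin 4, i ≠ j ∧ i ≠ k ∧ j ≠ k :=
      ⟨i + 1, i + 2, by fin_cases i <;> decide⟩
    have e1 := hll i j hij
    have e2 := hll i k hik
    have e3 := hll j k hjk
    have e4 : l j = l k := mul_left_cancel₀ (hpos i).ne' (e1.trans e2.symm)
    rw [← e4] at e3
    have e5 : l j = 1 := by nlinarith [hpos j]
    rw [e5, mul_one] at e1
    exact e1
  have hP1 : P = LinearMap.id := b.toBasis.ext fun i => by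
    have := hP.apply_eigenvectorBasis hn i
    have e : hP.eigenvalues hn i = 1 := hl1 i
    rw [e] at this
    simpa [hb] using this
  rw [hTP, hP1, LinearMap.id_apply]

theorem halfWedge_kahler_smul (r : ℂ) (a b c d : C4) :
    halfWedge kahler (r • a) (r • b) (r • c) (r • d) =
      Complex.normSq r ^ 2 * halfWedge kahler a b c d := by
  simp only [halfWedge, kahler_smul]
  ring

/-- For K = S i S⁻¹, invariance gives Im vol(x, K x, y, z) = Im vol(S⁻¹x, i S⁻¹x, S⁻¹y, S⁻¹z) = 0.
So K x ∈ ℂ x for every x, K is a complex scalar μ, and K² = −1. -/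
theorem map_I_smul {S : C4 ≃ₗ[ℝ] C4}
    (h : ∀ a b c d, (vol (S a) (S b) (S c) (S d)).im = (vol a b c d).im) :
    ∃ μ : ℂ, μ ^ 2 = -1 ∧ ∀ v, S (Complex.I • v) = μ • S v := by
  let mI : C4 →ₗ[ℝ] C4 := (LinearMap.lsmul ℂ C4 Complex.I).restrictScalars ℝ
  let K : C4 →ₗ[ℝ] C4 := S.toLinearMap ∘ₗ mI ∘ₗ S.symm.toLinearMap
  have hK : ∀ x, K x = S (Complex.I • S.symm x) := fun x => rfl
  obtain ⟨μ, hμ⟩ := eq_smul_of_forall_exists_smul (K := K) fun x => by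
    by_cases hx : x = 0
    · exact ⟨0, by simp [hx]⟩
    · refine exists_smul_of_vol_im hx fun y z => ?_
      have h1 := h (S.symm x) (Complex.I • S.symm x) (S.symm y) (S.symm z)
      have h2 : ∀ u v w : C4, vol u (Complex.I • u) v w = 0 := fun u v w => by
        have e := vol_smul 1 Complex.I 1 1 u u v w
        simp only [one_smul] at e
        rw [e, vol, Matrix.det_zero_of_column_eq (i := 0) (j := 1) (by decide) (by simp), mul_zero]
      rw [h2] at h1
      simpa [hK] using h1
  refine ⟨μ, ?_, fun v => by simpa [hK] using hμ (S v)⟩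
  have h1 : K (K (EuclideanSpace.single 0 1)) = -EuclideanSpace.single 0 1 := by
    simp [hK, smul_smul]
  rw [hμ, hμ, smul_smul] at h1
  have := congrArg (fun z : C4 => z 0) h1
  simpa [sq] using this

/-- A real-linear map of `ℂ⁴` preserving `c Re vol - ½ ω ∧ ω` and `Im vol` is in `SU(4)`. -/
theorem inner_vol_map {S : C4 ≃ₗ[ℝ] C4} {r : ℝ} (hr : r ≠ 0)
    (him : ∀ a b c d, (vol (S a) (S b) (S c) (S d)).im = (vol a b c d).im)
    (hre : ∀ a b c d, r * (vol (S a) (S b) (S c) (S d)).re -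
      halfWedge kahler (S a) (S b) (S c) (S d) = r * (vol a b c d).re - halfWedge kahler a b c d) :
    (∀ x y, inner ℂ (S x) (S y) = inner ℂ x y) ∧
      ∀ a b c d, vol (S a) (S b) (S c) (S d) = vol a b c d := by
  obtain ⟨μ, hμ2, hμ⟩ := map_I_smul him
  have hμn : Complex.normSq (1 + μ) = 2 := by
    have h1 : (μ - Complex.I) * (μ + Complex.I) = 0 := by
      linear_combination hμ2 - Complex.I_sq
    rcases mul_eq_zero.1 h1 with h | h
    · rw [sub_eq_zero.1 h]; norm_num [Complex.normSq_apply]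
    · rw [eq_neg_of_add_eq_zero_left h]; norm_num [Complex.normSq_apply]
  have hIn : Complex.normSq (1 + Complex.I) = 2 := by norm_num [Complex.normSq_apply]
  have hμ4 : (1 + μ) * (1 + μ) * (1 + μ) * (1 + μ) = (-4 : ℝ) := by
    push_cast
    linear_combination (μ ^ 2 + 4 * μ + 5) * hμ2
  have hI4 : (1 + Complex.I) * (1 + Complex.I) * (1 + Complex.I) * (1 + Complex.I) =
      (-4 : ℝ) := by
    push_cast
    linear_combination (Complex.I ^ 2 + 4 * Complex.I + 5) * Complex.I_sq
  have hrot : ∀ v, S ((1 + Complex.I) • v) = (1 + μ) • S v := fun v => by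
    rw [add_smul, add_smul, one_smul, one_smul, map_add, hμ]
  -- Scaling all arguments by 1 + i multiplies vol by (1 + i)⁴ = −4 and ½ κ ∧ κ by |1 + i|⁴ = 4, and
  -- 1 + μ does the same on the image. The opposite signs separate the two terms of `hre`.
  have hsplit : ∀ a b c d, (vol (S a) (S b) (S c) (S d)).re = (vol a b c d).re ∧
      halfWedge kahler (S a) (S b) (S c) (S d) = halfWedge kahler a b c d := by
    intro a b c d
    have h1 := hre a b c d
    have h2 := hre ((1 + Complex.I) • a) ((1 + Complex.I) • b) ((1 + Complex.I) • c)
      ((1 + Complex.I) • d)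
    simp only [hrot, vol_smul, halfWedge_kahler_smul, hμ4, hI4, hμn, hIn,
      Complex.re_ofReal_mul] at h2
    have h3 : r * (vol (S a) (S b) (S c) (S d)).re = r * (vol a b c d).re := by linarith
    exact ⟨mul_left_cancel₀ hr h3, by linarith⟩
  have hvol : ∀ a b c d, vol (S a) (S b) (S c) (S d) = vol a b c d := fun a b c d =>
    Complex.ext (hsplit a b c d).1 (him a b c d)
  refine ⟨?_, hvol⟩
  -- The imaginary part of vol leaves μ = ±i; preserving vol itself excludes −i and makes S complex
  -- linear.
  have hμI : μ = Complex.I := by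
    have hv : ∃ a b c d : C4, vol a b c d = 1 :=
      ⟨EuclideanSpace.single 0 1, EuclideanSpace.single 1 1, EuclideanSpace.single 2 1,
        EuclideanSpace.single 3 1, by
          simp [vol, Matrix.det_succ_row_zero, Fin.sum_univ_succ, Fin.succAbove]⟩
    obtain ⟨a, b, c, d, h1⟩ := hv
    have h2 := hvol (Complex.I • a) b c d
    have e1 := vol_smul μ 1 1 1 (S a) (S b) (S c) (S d)
    have e2 := vol_smul Complex.I 1 1 1 a b c d
    simp only [one_smul, mul_one] at e1 e2
    rw [hμ, e1, e2, hvol, h1, mul_one, mul_one] at h2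
    exact h2
  let T : C4 →ₗ[ℂ] C4 :=
    { toFun := S
      map_add' := map_add S
      map_smul' := fun c x => by
        have hx : c • x = c.re • x + c.im • (Complex.I • x) := by
          conv_lhs => rw [← Complex.re_add_im c]
          rw [add_smul, mul_smul, Complex.coe_smul, Complex.coe_smul]
        have hy : c • S x = c.re • S x + c.im • (Complex.I • S x) := by
          conv_lhs => rw [← Complex.re_add_im c]
          rw [add_smul, mul_smul, Complex.coe_smul, Complex.coe_smul]
        rw [RingHom.id_apply, hx, hy, map_add, map_smul, map_smul, hμ, hμI] }
  exact inner_map_of_halfWedge (T := T) S.injective fun a b c d => (hsplit a b c d).2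

end C4

theorem stdOmega_eq_vol (a b c d : E8) :
    stdOmega ![a, b, c, d] = C4.vol (stdComplexEquiv a) (stdComplexEquiv b) (stdComplexEquiv c)
      (stdComplexEquiv d) := by
  rw [stdOmega, C4.vol]
  congr 1
  ext i j
  fin_cases j <;> rfl

theorem stdKahler_eq_kahler (x y : E8) :
    stdKahler x y = C4.kahler (stdComplexEquiv x) (stdComplexEquiv y) := by
  rw [C4.kahler, inner_stdComplexEquiv]
  simp

/-- The stabiliser of `stdCayley τ` in `GL(8, ℝ)` is `SU(4)`. -/
theorem stdCayley_stabilizer {τ : ℝ} (hτ : τ ≠ 0) {T : E8 ≃ₗ[ℝ] E8}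
    (h : ∀ v : Fin 4 → E8, stdCayley τ (fun i => T (v i)) = stdCayley τ v) :
    (∀ x y, inner ℝ (T x) (T y) = inner ℝ x y) ∧
      (∀ x y, stdKahler (T x) (T y) = stdKahler x y) ∧
      ∀ v : Fin 4 → E8, stdOmega (fun i => T (v i)) = stdOmega v := by
  have hs : Real.sinh (2 * τ) ≠ 0 := Real.sinh_ne_zero.2 (by simpa using hτ)
  set Z := stdComplexEquiv with hZ
  let S : C4 ≃ₗ[ℝ] C4 := (Z.symm.trans T).trans Z
  have hS : ∀ x, S (Z x) = Z (T x) := fun x => by simp [S]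
  have hv : ∀ v : Fin 4 → E8, v = ![v 0, v 1, v 2, v 3] := fun v => by
    ext i; fin_cases i <;> rfl
  have hcay : ∀ v : Fin 4 → E8, stdCayley τ v = ((Real.cosh (2 * τ) *
      (C4.vol (Z (v 0)) (Z (v 1)) (Z (v 2)) (Z (v 3))).re -
      halfWedge C4.kahler (Z (v 0)) (Z (v 1)) (Z (v 2)) (Z (v 3)) : ℝ) : ℂ) +
      Complex.I * ((Real.sinh (2 * τ) *
        (C4.vol (Z (v 0)) (Z (v 1)) (Z (v 2)) (Z (v 3))).im : ℝ) : ℂ) := fun v => by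
    rw [hZ, ← stdOmega_eq_vol, ← hv, stdCayley]
    simp only [halfWedge, stdKahler_eq_kahler]
  have hsurj : ∀ z : C4, ∃ x, Z x = z := Z.surjective
  have main := C4.inner_vol_map (S := S) (r := Real.cosh (2 * τ)) (Real.cosh_pos _).ne'
    (fun a b c d => by
      obtain ⟨a, rfl⟩ := hsurj a
      obtain ⟨b, rfl⟩ := hsurj b
      obtain ⟨c, rfl⟩ := hsurj c
      obtain ⟨d, rfl⟩ := hsurj d
      have h1 := congrArg Complex.im (h ![a, b, c, d])
      rw [hcay, hcay] at h1
      simp only [Complex.add_im, Complex.ofReal_im, Complex.I_mul_im, Complex.ofReal_re,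
        zero_add] at h1
      simpa [hS] using mul_left_cancel₀ hs h1)
    (fun a b c d => by
      obtain ⟨a, rfl⟩ := hsurj a
      obtain ⟨b, rfl⟩ := hsurj b
      obtain ⟨c, rfl⟩ := hsurj c
      obtain ⟨d, rfl⟩ := hsurj d
      have h1 := congrArg Complex.re (h ![a, b, c, d])
      rw [hcay, hcay] at h1
      simp only [Complex.add_re, Complex.ofReal_re, Complex.I_mul_re, Complex.ofReal_im, neg_zero,
        add_zero] at h1
      simpa [hS] using h1)
  have hin : ∀ x y, inner ℝ (T x) (T y) = inner ℝ x y ∧ stdKahler (T x) (T y) = stdKahler x y := by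
    intro x y
    have h1 := main.1 (Z x) (Z y)
    rw [hS, hS, hZ, inner_stdComplexEquiv, inner_stdComplexEquiv] at h1
    exact ⟨by simpa using congrArg Complex.re h1, by simpa using congrArg Complex.im h1⟩
  refine ⟨fun x y => (hin x y).1, fun x y => (hin x y).2, fun v => ?_⟩
  have h1 := main.2 (Z (v 0)) (Z (v 1)) (Z (v 2)) (Z (v 3))
  rw [hS, hS, hS, hS, hZ, ← stdOmega_eq_vol, ← stdOmega_eq_vol] at h1
  rw [hv v, ← h1]
  congr 1
  ext i; fin_cases i <;> rfl

/-! ### Forms and vector fields in charts. -/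

section Charts

open VectorField

variable {M : Type*} [TopologicalSpace M] [ChartedSpace E8 M]
  {k : ℕ} {F : Type*} [NormedAddCommGroup F] [NormedSpace ℝ F]

/-- The expression of a vector field in a chart `e`: its push-forward by `e`. -/
noncomputable def fieldInChart (e : OpenPartialHomeomorph M E8)
    (Y : ∀ x : M, TangentSpace 𝓘(ℝ, E8) x) : E8 → E8 :=
  fun y => mfderiv 𝓘(ℝ, E8) 𝓘(ℝ, E8) e (e.symm y) (Y (e.symm y))

/-- The vector field that is constant in the chart `e`. -/
noncomputable def constField (e : OpenPartialHomeomorph M E8) (w : E8) :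
    ∀ x : M, TangentSpace 𝓘(ℝ, E8) x :=
  mpullback 𝓘(ℝ, E8) 𝓘(ℝ, E8) e (fun _ => w)

variable [IsManifold 𝓘(ℝ, E8) ∞ M] {e : OpenPartialHomeomorph M E8}

theorem mdifferentiable_of_mem_atlas' (he : e ∈ atlas E8 M) :
    e.MDifferentiable 𝓘(ℝ, E8) 𝓘(ℝ, E8) :=
  mdifferentiable_of_mem_atlas he

theorem isInvertible_mfderiv_chart (he : e ∈ atlas E8 M) {x : M} (hx : x ∈ e.source) :
    (mfderiv 𝓘(ℝ, E8) 𝓘(ℝ, E8) e x).IsInvertible :=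
  ⟨(mdifferentiable_of_mem_atlas' he).mfderiv hx, rfl⟩

theorem isInvertible_mfderiv_chart_symm (he : e ∈ atlas E8 M) {y : E8} (hy : y ∈ e.target) :
    (mfderiv 𝓘(ℝ, E8) 𝓘(ℝ, E8) e.symm y).IsInvertible :=
  ⟨(mdifferentiable_of_mem_atlas' he).symm.mfderiv hy, rfl⟩

theorem mfderiv_symm_fieldInChart (he : e ∈ atlas E8 M) {y : E8} (hy : y ∈ e.target)
    (Y : ∀ x : M, TangentSpace 𝓘(ℝ, E8) x) :
    mfderiv 𝓘(ℝ, E8) 𝓘(ℝ, E8) e.symm y (fieldInChart e Y y) = Y (e.symm y) := by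
  have hi := (mdifferentiable_of_mem_atlas' he)
  have h1 := hi.symm_comp_deriv (e.map_target hy)
  have h2 := congrArg (fun A => A (Y (e.symm y))) h1
  have h3 : ∀ z : E8, z = y → mfderiv 𝓘(ℝ, E8) 𝓘(ℝ, E8) e.symm z =
    mfderiv 𝓘(ℝ, E8) 𝓘(ℝ, E8) e.symm y := fun z hz => by rw [hz]
  have h4 := h3 _ (e.right_inv hy)
  have h5 : (mfderiv 𝓘(ℝ, E8) 𝓘(ℝ, E8) e.symm (e (e.symm y))) (fieldInChart e Y y) =
    Y (e.symm y) := h2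
  rw [h4] at h5
  exact h5

theorem fieldInChart_eq_mpullback (he : e ∈ atlas E8 M) {y : E8} (hy : y ∈ e.target)
    (Y : ∀ x : M, TangentSpace 𝓘(ℝ, E8) x) :
    mpullback 𝓘(ℝ, E8) 𝓘(ℝ, E8) e.symm Y y = fieldInChart e Y y := by
  rw [mpullback_apply, ← mfderiv_symm_fieldInChart he hy Y]
  exact (isInvertible_mfderiv_chart_symm he hy).inverse_apply_self _

theorem fieldInChart_apply {x : M} (hx : x ∈ e.source) (Y : ∀ x : M, TangentSpace 𝓘(ℝ, E8) x) :
    fieldInChart e Y (e x) = mfderiv 𝓘(ℝ, E8) 𝓘(ℝ, E8) e x (Y x) := by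
  have h : ∀ p : M, p = x → (mfderiv 𝓘(ℝ, E8) 𝓘(ℝ, E8) e p (Y p) : E8) =
    mfderiv 𝓘(ℝ, E8) 𝓘(ℝ, E8) e x (Y x) := fun p hp => by subst hp; rfl
  exact h _ (e.left_inv hx)

theorem DiffForm.inChart_fieldInChart (α : DiffForm M k F) (he : e ∈ atlas E8 M) {y : E8}
    (hy : y ∈ e.target) (Y : Fin k → ∀ x : M, TangentSpace 𝓘(ℝ, E8) x) :
    α.inChart e y (fun i => fieldInChart e (Y i) y) = α (e.symm y) (fun i => Y i (e.symm y)) := by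
  have : ∀ i, mfderiv 𝓘(ℝ, E8) 𝓘(ℝ, E8) e.symm y (fieldInChart e (Y i) y) = Y i (e.symm y) :=
    fun i => mfderiv_symm_fieldInChart he hy (Y i)
  rw [← funext this]
  rfl

theorem DiffForm.inChart_field (α : DiffForm M k F) (he : e ∈ atlas E8 M) {x : M}
    (hx : x ∈ e.source) (Y : Fin k → ∀ x : M, TangentSpace 𝓘(ℝ, E8) x) :
    α.inChart e (e x) (fun i => fieldInChart e (Y i) (e x)) = α x (fun i => Y i x) := by
  rw [α.inChart_fieldInChart he (e.map_source hx)]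
  have h : ∀ p : M, p = x → α p (fun i => Y i p) = α x (fun i => Y i x) :=
    fun p hp => by subst hp; rfl
  exact h _ (e.left_inv hx)

theorem DiffForm.inChart_apply_mfderiv (α : DiffForm M k F) (he : e ∈ atlas E8 M) {x : M}
    (hx : x ∈ e.source) (v : Fin k → TangentSpace 𝓘(ℝ, E8) x) :
    α.inChart e (e x) (fun i => mfderiv 𝓘(ℝ, E8) 𝓘(ℝ, E8) e x (v i)) = α x v := by
  classical
  -- Extending each tangent vector by zero away from x suffices, since `inChart_field` asks for no
  -- regularity.
  have h := α.inChart_field he hx (fun i => Function.update 0 x (v i))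
  simp only [Function.update_self] at h
  rw [← h]
  congr 1
  ext1 i
  rw [fieldInChart_apply hx]
  simp

theorem fieldInChart_differentiableAt (he : e ∈ atlas E8 M) {x : M} (hx : x ∈ e.source)
    {Y : ∀ x : M, TangentSpace 𝓘(ℝ, E8) x} (hY : VectorFieldDifferentiableAt Y x) :
    DifferentiableAt ℝ (fieldInChart e Y) (e x) := by
  have hy := e.map_source hx
  have h1 : VectorFieldDifferentiableAt (M := E8) (mpullback 𝓘(ℝ, E8) 𝓘(ℝ, E8) e.symm Y) (e x) := by
    refine MDifferentiableAt.mpullback_vectorField (n := 2) ?_ ?_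
      (isInvertible_mfderiv_chart_symm he hy) le_rfl
    · rw [e.left_inv hx]; exact hY
    · exact contMDiffAt_symm_of_mem_maximalAtlas
        (IsManifold.subset_maximalAtlas he) hy
  have h2 : DifferentiableAt ℝ (mpullback 𝓘(ℝ, E8) 𝓘(ℝ, E8) e.symm Y : E8 → E8) (e x) := by
    have h3 := (contMDiff_snd_tangentBundle_modelSpace (n := 1) E8 𝓘(ℝ, E8)).contMDiffAt.mdifferentiableAt
      one_ne_zero |>.comp (e x) h1
    exact h3.differentiableAt
  refine h2.congr_of_eventuallyEq ?_
  filter_upwards [e.open_target.mem_nhds hy] with y hy'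
  exact (fieldInChart_eq_mpullback he hy' Y).symm

theorem constField_differentiableAt (he : e ∈ atlas E8 M) {x : M} (hx : x ∈ e.source) (w : E8) :
    VectorFieldDifferentiableAt (constField e w) x := by
  refine MDifferentiableAt.mpullback_vectorField (n := 2) ?_ ?_
      (isInvertible_mfderiv_chart he hx) le_rfl
  · exact (contMDiffAt_vectorSpace_iff_contDiffAt (n := 1).2 contDiffAt_const).mdifferentiableAt
      one_ne_zero
  · exact contMDiffAt_of_mem_maximalAtlas (IsManifold.subset_maximalAtlas he) hx

theorem fieldInChart_constField (he : e ∈ atlas E8 M) {y : E8} (hy : y ∈ e.target) (w : E8) :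
    fieldInChart e (constField e w) y = w :=
  (isInvertible_mfderiv_chart he (e.map_target hy)).self_apply_inverse w

theorem fieldInChart_mlieBracket (he : e ∈ atlas E8 M) {x : M} (hx : x ∈ e.source)
    {X Y : ∀ x : M, TangentSpace 𝓘(ℝ, E8) x} (hX : VectorFieldDifferentiableAt X x)
    (hY : VectorFieldDifferentiableAt Y x) :
    mfderiv 𝓘(ℝ, E8) 𝓘(ℝ, E8) e x (mlieBracket 𝓘(ℝ, E8) X Y x) =
      lieBracket ℝ (fieldInChart e X) (fieldInChart e Y) (e x) := by
  haveI : IsManifold 𝓘(ℝ, E8) (minSmoothness ℝ 3) M := by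
    rw [minSmoothness_of_isRCLikeNormedField]; infer_instance
  have hy := e.map_source hx
  have h := mpullback_mlieBracket (f := e.symm) (V := X) (W := Y) (x₀ := e x) (n := 2)
    (I := 𝓘(ℝ, E8)) (I' := 𝓘(ℝ, E8))
    (by rw [e.left_inv hx]; exact hX) (by rw [e.left_inv hx]; exact hY)
    (contMDiffAt_symm_of_mem_maximalAtlas (IsManifold.subset_maximalAtlas he) hy) (by simp)
  rw [fieldInChart_eq_mpullback he hy, fieldInChart_apply hx] at h
  have hb : ∀ V W : E8 → E8, mlieBracket 𝓘(ℝ, E8) V W (e x) = lieBracket ℝ V W (e x) :=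
    fun V W => (congrFun (mlieBracketWithin_eq_lieBracketWithin (s := Set.univ)) (e x)).trans
      (congrFun lieBracketWithin_univ (e x))
  have hev : ∀ Z : (∀ x : M, TangentSpace 𝓘(ℝ, E8) x),
      mpullback 𝓘(ℝ, E8) 𝓘(ℝ, E8) e.symm Z =ᶠ[nhds (e x)] fieldInChart e Z := fun Z => by
    filter_upwards [e.open_target.mem_nhds hy] with y hy'
    exact fieldInChart_eq_mpullback he hy' Z
  exact h.trans ((hb _ _).trans ((hev X).lieBracket_vectorField_eq (hev Y)))

theorem mvfderiv_eq_fderiv (he : e ∈ atlas E8 M) {x : M} (hx : x ∈ e.source) {f : M → F}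
    {f' : E8 → F} (hf : ∀ y ∈ e.target, f (e.symm y) = f' y) (hf' : DifferentiableAt ℝ f' (e x))
    (v : TangentSpace 𝓘(ℝ, E8) x) :
    mvfderiv 𝓘(ℝ, E8) f x v = fderiv ℝ f' (e x) (mfderiv 𝓘(ℝ, E8) 𝓘(ℝ, E8) e x v) := by
  have h1 : f =ᶠ[nhds x] f' ∘ e := by
    filter_upwards [e.open_source.mem_nhds hx] with p hp
    rw [Function.comp_apply, ← hf _ (e.map_source hp), e.left_inv hp]
  have h2 := (hf'.hasFDerivAt.hasMFDerivAt.comp x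
    ((mdifferentiable_of_mem_atlas' he).mdifferentiableAt hx).hasMFDerivAt).congr_of_eventuallyEq h1
  have h3 : (mfderiv 𝓘(ℝ, E8) 𝓘(ℝ, F) f x v : F) =
      fderiv ℝ f' (e x) (mfderiv 𝓘(ℝ, E8) 𝓘(ℝ, E8) e x v) := by
    rw [h2.mfderiv]
    rfl
  exact h3

theorem DiffForm.inChart_differentiableAt {α : DiffForm M k F} (hα : α.IsSmooth)
    (he : e ∈ atlas E8 M) {y : E8} (hy : y ∈ e.target) : DifferentiableAt ℝ (α.inChart e) y :=
  ((hα e he).contDiffAt (e.open_target.mem_nhds hy)).differentiableAt (by simp)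

theorem DiffForm.mvfderiv_apply {α : DiffForm M k F} (hα : α.IsSmooth) (he : e ∈ atlas E8 M)
    {x : M} (hx : x ∈ e.source) {Y : Fin k → ∀ x : M, TangentSpace 𝓘(ℝ, E8) x}
    (hY : ∀ i, VectorFieldDifferentiableAt (Y i) x) (v : TangentSpace 𝓘(ℝ, E8) x) :
    mvfderiv 𝓘(ℝ, E8) (fun y => α y (fun i => Y i y)) x v =
      fderiv ℝ (α.inChart e) (e x) (mfderiv 𝓘(ℝ, E8) 𝓘(ℝ, E8) e x v)
          (fun i => fieldInChart e (Y i) (e x)) +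
        ∑ i, α.inChart e (e x) (Function.update (fun i => fieldInChart e (Y i) (e x)) i
          (fderiv ℝ (fieldInChart e (Y i)) (e x) (mfderiv 𝓘(ℝ, E8) 𝓘(ℝ, E8) e x v))) := by
  have hd := DiffForm.inChart_differentiableAt hα he (e.map_source hx)
  have hd' := fun i => fieldInChart_differentiableAt he hx (hY i)
  rw [mvfderiv_eq_fderiv he hx (f' := fun y => α.inChart e y (fun i => fieldInChart e (Y i) y))
    (fun y hy => (α.inChart_fieldInChart he hy Y).symm)
    (hd.continuousAlternatingMap_apply hd')]
  exact fderiv_continuousAlternatingMap_apply_apply hd hd' _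

end Charts

/-! ### Type decomposition of the exterior derivative. -/

section TypeArgument

variable {V : Type*} [AddCommGroup V] {J : V → V}

/-- The alternating sum of a family of four-forms. -/
def alternatedDeriv {V W : Type*} [AddCommGroup W] (T : V → V → V → V → V → W) (a b c d e : V) : W :=
  T a b c d e - T b a c d e + T c a b d e - T d a b c e + T e a b c d

/-- The relation is the real part of the statement that B vanishes on three vectors of type (0,1).
Conjugation gives the same for type (1,0), and of five arguments of pure type three share a type. In
real terms: inserting J at two arguments gives a value that does not depend on which two, so three
times this value is B, and doing it twice gives 9 B = B. -/
theorem eq_zero_of_triple_relation {B : V → V → V → V → V → ℝ}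
    (hJ : ∀ x, J (J x) = -x) (hneg : ∀ x y z c d, B (-x) y z c d = -B x y z c d)
    (h12 : ∀ x y z c d, B y x z c d = -B x y z c d) (h23 : ∀ x y z c d, B x z y c d = -B x y z c d)
    (h34 : ∀ x y z c d, B x y c z d = -B x y z c d) (h45 : ∀ x y z c d, B x y z d c = -B x y z c d)
    (h : ∀ x y z c d, B (J x) (J y) z c d + B (J x) y (J z) c d + B x (J y) (J z) c d =
      B x y z c d) (x y z c d : V) : B x y z c d = 0 := by
  have r : ∀ x y z c d, B y z c x d = -B x y z c d := fun x y z c d => by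
    rw [h34 y z x c, h23 y x z c, h12 x y z c]; ring
  have r' : ∀ x y z c d, B x z c y d = B x y z c d := fun x y z c d => by
    rw [h34 x z y c, h23 x y z c]; ring
  -- Half of the relations for the triples (x, y, z) and (x, y, c) minus those for (x, z, c) and (y,
  -- z, c).
  have S : ∀ x y z c d, B (J x) (J y) z c d = B x y (J z) (J c) d := fun x y z c d => by
    linear_combination (h x y z c d - h x y c z d + h34 (J x) (J y) z c d
      + h34 (J x) y z (J c) d + h34 x (J y) z (J c) d - h34 x y z c d
      - h x z c y d + r' (J x) y (J z) c d + r' (J x) y z (J c) d + r' x y (J z) (J c) d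
      - r' x y z c d + h y z c x d - r x (J y) (J z) c d - r x (J y) z (J c) d
      - r x y (J z) (J c) d + r x y z c d) / 2
  have p : ∀ x y z c d, B z c x d y = -B x y z c d := fun x y z c d => by
    rw [h45 z c x y d, h34 z c y x, h23 z y c x, h12 y z c x, r x y z c]; ring
  have s15 : ∀ x y z c d, B (J x) y z c (J d) = B (J x) (J y) z c d := fun x y z c d => by
    linear_combination -S x y z c d + S z c x d y - p x y (J z) (J c) d + p (J x) y z c (J d)
  have w : ∀ x y z c d, B x y d c z = -B x y z c d := fun x y z c d => by
    rw [h45 x y d z c, h34 x y z d c, h45 x y z c d]; ring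
  have s13 : ∀ x y z c d, B (J x) y (J z) c d = B (J x) (J y) z c d := fun x y z c d => by
    linear_combination -s15 x y d c z + w (J x) y (J z) c d - w (J x) (J y) z c d
  have s23 : ∀ x y z c d, B x (J y) (J z) c d = B (J x) (J y) z c d := fun x y z c d => by
    linear_combination -s13 y x z c d + h12 x (J y) (J z) c d - h12 (J x) (J y) z c d
  have s : ∀ x y z c d, 3 * B (J x) (J y) z c d = B x y z c d := fun x y z c d => by
    linear_combination h x y z c d - s13 x y z c d - s23 x y z c d
  have h1 := s x y z c d
  have h2 := s (J x) (J y) z c d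
  rw [hJ, hJ, hneg, h12 (-y), hneg, h12 x] at h2
  linear_combination (3 * h2 + h1) / 8

/-- The left side is the value on x + iJx, y + iJy, z + iJz, vectors of type (0,1). In every term at
least two of them sit in form slots: the first turns the derivative of Ω into −i Ω(N ·, …), and the
second annihilates that. -/
theorem alternatedDeriv_type {Om : V → V → V → V → ℂ} {T : V → V → V → V → V → ℂ} {N : V → V → V}
    (hO1 : ∀ x b c d, Om (J x) b c d = Complex.I * Om x b c d)
    (hO2 : ∀ x b c d, Om b (J x) c d = Complex.I * Om b x c d)
    (hO3 : ∀ x b c d, Om b c (J x) d = Complex.I * Om b c x d)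
    (hO4 : ∀ x b c d, Om b c d (J x) = Complex.I * Om b c d x)
    (hT1 : ∀ v x b c d, T v (J x) b c d = Complex.I * T v x b c d - Om (N v x) b c d)
    (hT2 : ∀ v x b c d, T v b (J x) c d = Complex.I * T v b x c d - Om b (N v x) c d)
    (hT3 : ∀ v x b c d, T v b c (J x) d = Complex.I * T v b c x d - Om b c (N v x) d)
    (x y z c d : V) :
    let B := alternatedDeriv T
    B x y z c d - B (J x) (J y) z c d - B (J x) y (J z) c d - B x (J y) (J z) c d
     + Complex.I * (B (J x) y z c d + B x (J y) z c d + B x y (J z) c d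
       - B (J x) (J y) (J z) c d) = 0 := by
  simp only [alternatedDeriv, hO1, hO2, hO3, hO4, hT1, hT2, hT3]
  ring_nf
  simp only [Complex.I_sq, Complex.I_pow_three, Complex.I_pow_four]
  ring

end TypeArgument

/-! ### The standard complex structure and the type of Ω₀. -/

section StdComplexStructure

/-- The complex structure of `ℝ⁸ = ℂ⁴`. -/
noncomputable def stdJ : E8 →ₗ[ℝ] E8 :=
  stdComplexEquiv.symm.toLinearMap ∘ₗ (Complex.I • LinearMap.id : C4 →ₗ[ℝ] C4) ∘ₗ
    stdComplexEquiv.toLinearMap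

theorem stdComplexEquiv_stdJ (x : E8) :
    stdComplexEquiv (stdJ x) = Complex.I • stdComplexEquiv x := by
  simp [stdJ]

theorem stdJ_stdJ (x : E8) : stdJ (stdJ x) = -x := by
  apply stdComplexEquiv.injective
  rw [stdComplexEquiv_stdJ, stdComplexEquiv_stdJ, smul_smul, Complex.I_mul_I, map_neg, neg_one_smul]

theorem inner_stdJ_left (x y : E8) : inner ℝ (stdJ x) y = stdKahler x y := by
  have h := inner_stdComplexEquiv (stdJ x) y
  rw [stdComplexEquiv_stdJ, inner_smul_left, inner_stdComplexEquiv] at h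
  simpa using (congrArg Complex.re h).symm

theorem stdKahler_swap (x y : E8) : stdKahler x y = -stdKahler y x := by
  simp only [stdKahler]; ring

theorem inner_stdJ_right (x y : E8) : inner ℝ x (stdJ y) = -inner ℝ (stdJ x) y := by
  rw [real_inner_comm, inner_stdJ_left, inner_stdJ_left, stdKahler_swap]

theorem inner_stdJ_stdJ (x y : E8) : inner ℝ (stdJ x) (stdJ y) = inner ℝ x y := by
  rw [inner_stdJ_right, stdJ_stdJ, inner_neg_left, neg_neg]

theorem stdOmega_stdJ_one (x b c d : E8) :
    stdOmega ![stdJ x, b, c, d] = Complex.I * stdOmega ![x, b, c, d] := by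
  simp only [stdOmega_eq_vol, stdComplexEquiv_stdJ]
  simpa using C4.vol_smul Complex.I 1 1 1 (stdComplexEquiv x) (stdComplexEquiv b)
    (stdComplexEquiv c) (stdComplexEquiv d)

theorem stdOmega_stdJ_two (x b c d : E8) :
    stdOmega ![b, stdJ x, c, d] = Complex.I * stdOmega ![b, x, c, d] := by
  simp only [stdOmega_eq_vol, stdComplexEquiv_stdJ]
  simpa using C4.vol_smul 1 Complex.I 1 1 (stdComplexEquiv b) (stdComplexEquiv x)
    (stdComplexEquiv c) (stdComplexEquiv d)

theorem stdOmega_stdJ_three (x b c d : E8) :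
    stdOmega ![b, c, stdJ x, d] = Complex.I * stdOmega ![b, c, x, d] := by
  simp only [stdOmega_eq_vol, stdComplexEquiv_stdJ]
  simpa using C4.vol_smul 1 1 Complex.I 1 (stdComplexEquiv b) (stdComplexEquiv c)
    (stdComplexEquiv x) (stdComplexEquiv d)

theorem stdOmega_stdJ_four (x b c d : E8) :
    stdOmega ![b, c, d, stdJ x] = Complex.I * stdOmega ![b, c, d, x] := by
  simp only [stdOmega_eq_vol, stdComplexEquiv_stdJ]
  simpa using C4.vol_smul 1 1 1 Complex.I (stdComplexEquiv b) (stdComplexEquiv c)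
    (stdComplexEquiv d) (stdComplexEquiv x)

/-- A unitary basis of `ℂ⁴`, in `ℝ⁸`. -/
noncomputable def stdUnitary : Fin 4 → E8 :=
  ![EuclideanSpace.single 4 1, EuclideanSpace.single 1 1, EuclideanSpace.single 2 1,
    EuclideanSpace.single 3 1]

/-- With three vectors of the unitary basis in the other slots, Ω₀ reads off one complex coordinate
of x up to sign. -/
theorem stdOmega_eq_zero {x : E8} (h : ∀ b c d, stdOmega ![x, b, c, d] = 0) : x = 0 := by
  have h0 := h (stdUnitary 1) (stdUnitary 2) (stdUnitary 3)
  have h1 := h (stdUnitary 0) (stdUnitary 2) (stdUnitary 3)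
  have h2 := h (stdUnitary 0) (stdUnitary 1) (stdUnitary 3)
  have h3 := h (stdUnitary 0) (stdUnitary 1) (stdUnitary 2)
  simp [stdOmega, stdComplexCoord, stdUnitary, Matrix.det_succ_row_zero, Fin.sum_univ_succ,
    Fin.succAbove, Complex.ext_iff] at h0 h1 h2 h3
  ext i
  fin_cases i <;> simp [h0, h1, h2, h3]

theorem stdOmega_update_stdUnitary_re (i : Fin 4) (x : E8) :
    (stdOmega (Function.update stdUnitary i x)).re = inner ℝ (stdUnitary i) x := by
  fin_cases i <;> simp [stdOmega, stdComplexCoord, stdUnitary, Matrix.det_succ_row_zero,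
    Fin.sum_univ_succ, Fin.succAbove, PiLp.inner_apply, Function.update]

theorem stdOmega_stdUnitary : stdOmega stdUnitary = 1 := by
  simp [stdOmega, stdComplexCoord, stdUnitary, Matrix.det_succ_row_zero,
    Fin.sum_univ_succ, Fin.succAbove]

end StdComplexStructure

/-! ### Injectivity of ω ∧ · on three-forms. -/

section Lefschetz

/-- The wedge product of a two-form and a three-form. -/
def wedgeTwoThree {V : Type*} (κ : V → V → ℝ) (γ : V → V → V → ℝ) (a b c d e : V) : ℝ :=
  κ a b * γ c d e - κ a c * γ b d e + κ a d * γ b c e - κ a e * γ b c d + κ b c * γ a d e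
    - κ b d * γ a c e + κ b e * γ a c d + κ c d * γ a b e - κ c e * γ a b d + κ d e * γ a b c

theorem sum_stdKahler_mul (f : E8 →ₗ[ℝ] ℝ) (x : E8) :
    ∑ a, stdKahler (EuclideanSpace.single a 1) x * f (stdJ (EuclideanSpace.single a 1)) = f x := by
  have h := congrArg (f ∘ₗ stdJ) ((EuclideanSpace.basisFun (Fin 8) ℝ).sum_repr (stdJ x))
  rw [map_sum] at h
  simp only [EuclideanSpace.basisFun_apply, map_smul, LinearMap.comp_apply, stdJ_stdJ, map_neg,
    smul_eq_mul] at h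
  rw [← neg_inj, ← h, ← Finset.sum_neg_distrib]
  refine Finset.sum_congr rfl fun a _ => ?_
  rw [← inner_stdJ_left, ← neg_inj, ← neg_mul, ← inner_stdJ_right, EuclideanSpace.inner_single_left]
  simp

theorem sum_stdKahler_stdJ_mul (f : E8 →ₗ[ℝ] ℝ) (x : E8) :
    ∑ a, stdKahler (stdJ (EuclideanSpace.single a 1)) x * f (EuclideanSpace.single a 1) =
      -f x := by
  have h := congrArg f ((EuclideanSpace.basisFun (Fin 8) ℝ).sum_repr x)
  rw [map_sum] at h
  rw [← h, ← Finset.sum_neg_distrib]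
  refine Finset.sum_congr rfl fun a _ => ?_
  rw [← inner_stdJ_left, stdJ_stdJ, inner_neg_left, EuclideanSpace.inner_single_left]
  simp

theorem sum_stdKahler_stdJ :
    ∑ a : Fin 8, stdKahler (EuclideanSpace.single a 1) (stdJ (EuclideanSpace.single a 1)) = 8 := by
  simp only [← inner_stdJ_left, inner_stdJ_stdJ]
  simp

/-- Let l be the trace of γ over the pairs (eₐ, Jeₐ). The same trace of ω ∧ γ is 2γ + ω ∧ l, with 2
= 8 − 6. Tracing once more gives 8 l = 0, with 8 = 2 + 8 − 2. So l = 0, and then γ = 0. -/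
theorem eq_zero_of_wedgeTwoThree {γ : E8 →ₗ[ℝ] E8 →ₗ[ℝ] E8 →ₗ[ℝ] ℝ}
    (h12 : ∀ x y z, γ y x z = -γ x y z) (h23 : ∀ x y z, γ x z y = -γ x y z)
    (h : ∀ a b c d e, wedgeTwoThree stdKahler (fun x y z => γ x y z) a b c d e = 0) : γ = 0 := by
  have hc : ∀ x y z, γ y z x = γ x y z := fun x y z => by rw [h23 y x z, h12 x y z, neg_neg]
  let v : Fin 8 → E8 := fun a => EuclideanSpace.single a 1
  let l : E8 →ₗ[ℝ] ℝ := ∑ a, γ (v a) (stdJ (v a))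
  have hl : ∀ x, l x = ∑ a, γ (v a) (stdJ (v a)) x := fun x => by simp [l]
  have A : ∀ x y z, 2 * γ x y z + stdKahler x y * l z - stdKahler x z * l y
      + stdKahler y z * l x = 0 := fun x y z => by
    have h1 : ∑ a, wedgeTwoThree stdKahler (fun x y z => γ x y z) (v a) (stdJ (v a)) x y z = 0 :=
      Finset.sum_eq_zero fun a _ => h _ _ _ _ _
    simp only [wedgeTwoThree, Finset.sum_add_distrib, Finset.sum_sub_distrib, ← Finset.mul_sum,
      ← hl, ← Finset.sum_mul] at h1
    have b1 : ∀ x y z, ∑ a, stdKahler (v a) x * γ (stdJ (v a)) y z = γ x y z := fun x y z =>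
      sum_stdKahler_mul ((γ.flip y).flip z) x
    have b2 : ∀ x y z, ∑ a, stdKahler (stdJ (v a)) x * γ (v a) y z = -γ x y z := fun x y z =>
      sum_stdKahler_stdJ_mul ((γ.flip y).flip z) x
    have b3 : ∑ a, stdKahler (v a) (stdJ (v a)) = 8 := sum_stdKahler_stdJ
    rw [b1, b1, b1, b2, b2, b2, b3] at h1
    linear_combination h1 - 2 * h12 x y z - 2 * hc z x y
  have B : ∀ z, l z = 0 := fun z => by
    have h1 : ∑ a, (2 * γ (v a) (stdJ (v a)) z + stdKahler (v a) (stdJ (v a)) * l z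
      - stdKahler (v a) z * l (stdJ (v a)) + stdKahler (stdJ (v a)) z * l (v a)) = 0 :=
      Finset.sum_eq_zero fun a _ => A _ _ _
    simp only [Finset.sum_add_distrib, Finset.sum_sub_distrib, ← Finset.mul_sum,
      ← hl, ← Finset.sum_mul] at h1
    have b1 : ∑ a, stdKahler (v a) z * l (stdJ (v a)) = l z := sum_stdKahler_mul l z
    have b2 : ∑ a, stdKahler (stdJ (v a)) z * l (v a) = -l z := sum_stdKahler_stdJ_mul l z
    have b3 : ∑ a, stdKahler (v a) (stdJ (v a)) = 8 := sum_stdKahler_stdJ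
    rw [b1, b2, b3] at h1
    linear_combination h1 / 8
  ext x y z
  have := A x y z
  rw [B, B, B] at this
  simp only [LinearMap.zero_apply]
  linear_combination this / 2

end Lefschetz

/-! ### Alternating maps written slot by slot. -/

section Swaps

variable {V W : Type*} [AddCommGroup V] [Module ℝ V] [TopologicalSpace V] [AddCommGroup W]
  [Module ℝ W] [TopologicalSpace W]

theorem ContinuousAlternatingMap.swap_one_two (A : V [⋀^Fin 4]→L[ℝ] W) (a b c d : V) :
    A ![b, a, c, d] = -A ![a, b, c, d] := by
  refine Eq.trans (congrArg A ?_) (A.toAlternatingMap.map_swap ![a, b, c, d] (show (0 : Fin 4) ≠ 1 by decide))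
  ext i; fin_cases i <;> rfl

theorem ContinuousAlternatingMap.swap_two_three (A : V [⋀^Fin 4]→L[ℝ] W) (a b c d : V) :
    A ![a, c, b, d] = -A ![a, b, c, d] := by
  refine Eq.trans (congrArg A ?_) (A.toAlternatingMap.map_swap ![a, b, c, d] (show (1 : Fin 4) ≠ 2 by decide))
  ext i; fin_cases i <;> rfl

theorem ContinuousAlternatingMap.swap_three_four (A : V [⋀^Fin 4]→L[ℝ] W) (a b c d : V) :
    A ![a, b, d, c] = -A ![a, b, c, d] := by
  refine Eq.trans (congrArg A ?_) (A.toAlternatingMap.map_swap ![a, b, c, d] (show (2 : Fin 4) ≠ 3 by decide))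
  ext i; fin_cases i <;> rfl

theorem ContinuousAlternatingMap.swap_two (A : V [⋀^Fin 2]→L[ℝ] W) (a b : V) :
    A ![b, a] = -A ![a, b] := by
  refine Eq.trans (congrArg A ?_) (A.toAlternatingMap.map_swap ![a, b] (show (0 : Fin 2) ≠ 1 by decide))
  ext i; fin_cases i <;> rfl

theorem ContinuousAlternatingMap.vec4_add_one (A : V [⋀^Fin 4]→L[ℝ] W) (x y b c d : V) :
    A ![x + y, b, c, d] = A ![x, b, c, d] + A ![y, b, c, d] := by
  have e : ∀ z, Function.update ![x, b, c, d] 0 z = ![z, b, c, d] := fun z => by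
    ext i; fin_cases i <;> rfl
  have := A.map_update_add ![x, b, c, d] 0 x y
  rwa [e, e, e] at this

theorem ContinuousAlternatingMap.vec4_smul_one (A : V [⋀^Fin 4]→L[ℝ] W) (r : ℝ) (x b c d : V) :
    A ![r • x, b, c, d] = r • A ![x, b, c, d] := by
  have e : ∀ z, Function.update ![x, b, c, d] 0 z = ![z, b, c, d] := fun z => by
    ext i; fin_cases i <;> rfl
  have := A.map_update_smul ![x, b, c, d] 0 r x
  rwa [e, e] at this

end Swaps

/-- The polarisation of `halfWedge`. -/
def halfWedgePolar {V : Type*} (κ κ' : V → V → ℝ) (a b c d : V) : ℝ :=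
  κ' a b * κ c d + κ a b * κ' c d - (κ' a c * κ b d + κ a c * κ' b d) +
    (κ' a d * κ b c + κ a d * κ' b c)

/-! ### First-order analysis at a point, with N in the role of ∇J and Θ in that of ∇Ω. -/

section FirstOrder

variable {N : E8 →ₗ[ℝ] E8 →ₗ[ℝ] E8} {Θ : E8 →ₗ[ℝ] E8 [⋀^Fin 4]→L[ℝ] ℂ}

theorem alternatedDeriv_swap12 (Θ : E8 →ₗ[ℝ] E8 [⋀^Fin 4]→L[ℝ] ℂ) (a b c d e : E8) :
    alternatedDeriv (fun v a b c d => Θ v ![a, b, c, d]) b a c d e =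
      -alternatedDeriv (fun v a b c d => Θ v ![a, b, c, d]) a b c d e := by
  simp only [alternatedDeriv]
  linear_combination (Θ c).swap_one_two a b d e - (Θ d).swap_one_two a b c e +
    (Θ e).swap_one_two a b c d

theorem alternatedDeriv_swap23 (Θ : E8 →ₗ[ℝ] E8 [⋀^Fin 4]→L[ℝ] ℂ) (a b c d e : E8) :
    alternatedDeriv (fun v a b c d => Θ v ![a, b, c, d]) a c b d e =
      -alternatedDeriv (fun v a b c d => Θ v ![a, b, c, d]) a b c d e := by
  simp only [alternatedDeriv]
  linear_combination (Θ a).swap_one_two b c d e - (Θ d).swap_two_three a b c e +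
    (Θ e).swap_two_three a b c d

theorem alternatedDeriv_swap34 (Θ : E8 →ₗ[ℝ] E8 [⋀^Fin 4]→L[ℝ] ℂ) (a b c d e : E8) :
    alternatedDeriv (fun v a b c d => Θ v ![a, b, c, d]) a b d c e =
      -alternatedDeriv (fun v a b c d => Θ v ![a, b, c, d]) a b c d e := by
  simp only [alternatedDeriv]
  linear_combination (Θ a).swap_two_three b c d e - (Θ b).swap_two_three a c d e +
    (Θ e).swap_three_four a b c d

theorem alternatedDeriv_swap45 (Θ : E8 →ₗ[ℝ] E8 [⋀^Fin 4]→L[ℝ] ℂ) (a b c d e : E8) :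
    alternatedDeriv (fun v a b c d => Θ v ![a, b, c, d]) a b c e d =
      -alternatedDeriv (fun v a b c d => Θ v ![a, b, c, d]) a b c d e := by
  simp only [alternatedDeriv]
  linear_combination (Θ a).swap_three_four b c d e - (Θ b).swap_three_four a c d e +
    (Θ c).swap_three_four a b d e

theorem alternatedDeriv_re_im (T : E8 → E8 → E8 → E8 → E8 → ℂ) (K : E8 → E8 → E8 → E8 → E8 → ℝ)
    (C S : ℝ) (a b c d e : E8) :
    alternatedDeriv (fun v a b c d => ((C * (T v a b c d).re - K v a b c d : ℝ) : ℂ) +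
        Complex.I * ((S * (T v a b c d).im : ℝ) : ℂ)) a b c d e =
      ((C * (alternatedDeriv T a b c d e).re - alternatedDeriv K a b c d e : ℝ) : ℂ) +
        Complex.I * ((S * (alternatedDeriv T a b c d e).im : ℝ) : ℂ) := by
  simp only [alternatedDeriv]
  apply Complex.ext <;> simp <;> ring

/-- This is d(½ κ ∧ κ) = κ ∧ dκ. -/
theorem alternatedDeriv_halfWedgePolar {V : Type*} (κ : V → V → ℝ) (κ' : V → V → V → ℝ)
    (a b c d e : V) :
    alternatedDeriv (fun v => halfWedgePolar κ (κ' v)) a b c d e =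
      wedgeTwoThree κ (fun x y z => κ' x y z - κ' y x z + κ' z x y) a b c d e := by
  simp only [alternatedDeriv, halfWedgePolar, wedgeTwoThree]
  ring

/-- The cyclic argument by which a metric connection is determined by its torsion. -/
theorem eq_zero_of_symm_of_skew {P : E8 → E8 → E8} (hs : ∀ x y, P x y = P y x)
    (hk : ∀ x y z, inner ℝ (P x y) z = -inner ℝ y (P x z)) (x y : E8) : P x y = 0 := by
  refine ext_inner_right ℝ fun z => ?_
  have key : ∀ x y z, inner ℝ (P x y) z = -inner ℝ (P z x) y := fun x y z => by
    rw [hk, real_inner_comm, hs]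
  have h1 := key x y z
  have h2 := key z x y
  have h3 := key y z x
  rw [inner_zero_left]
  linarith [h1, h2, h3]

/-- The type decomposition: an infinitesimal `SU(4)` structure whose four-form has a real
exterior derivative has vanishing `dΩ`, and its complex structure is integrable. -/
theorem integrable_of_real_alternatedDeriv
    (hNJ : ∀ v x, N v (stdJ x) = -stdJ (N v x))
    (hN : ∀ v x y, inner ℝ (N v x) y = -inner ℝ x (N v y))
    (hΘ : ∀ v x b c d, Θ v ![stdJ x, b, c, d] + stdOmega ![N v x, b, c, d] =
      Complex.I * Θ v ![x, b, c, d])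
    (him : ∀ a b c d e,
      (alternatedDeriv (fun v a b c d => Θ v ![a, b, c, d]) a b c d e).im = 0) :
    (∀ a b c d e, alternatedDeriv (fun v a b c d => Θ v ![a, b, c, d]) a b c d e = 0) ∧
      ∀ v x, N (stdJ v) x = stdJ (N v x) := by
  have o12 := stdOmegaAlt.swap_one_two
  have o23 := stdOmegaAlt.swap_two_three
  simp only [stdOmegaAlt_apply] at o12 o23
  have t1 : ∀ v x b c d, Θ v ![stdJ x, b, c, d] = Complex.I * Θ v ![x, b, c, d] -
      stdOmega ![N v x, b, c, d] := fun v x b c d => by linear_combination hΘ v x b c d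
  have t2 : ∀ v x b c d, Θ v ![b, stdJ x, c, d] = Complex.I * Θ v ![b, x, c, d] -
      stdOmega ![b, N v x, c, d] := fun v x b c d => by
    rw [(Θ v).swap_one_two, (Θ v).swap_one_two x, o12 (N v x), t1]; ring
  have t3 : ∀ v x b c d, Θ v ![b, c, stdJ x, d] = Complex.I * Θ v ![b, c, x, d] -
      stdOmega ![b, c, N v x, d] := fun v x b c d => by
    rw [(Θ v).swap_two_three, (Θ v).swap_two_three b x, o23 b (N v x), t2]; ring
  have hB : ∀ a b c d e, alternatedDeriv (fun v a b c d => Θ v ![a, b, c, d]) a b c d e = 0 := by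
    intro a b c d e
    refine Complex.ext ?_ (him a b c d e)
    refine eq_zero_of_triple_relation (J := stdJ)
      (B := fun a b c d e => (alternatedDeriv (fun v a b c d => Θ v ![a, b, c, d]) a b c d e).re)
      stdJ_stdJ ?_ ?_ ?_ ?_ ?_ ?_ a b c d e
    · intro x y z c d
      have n1 : ∀ v a b c, Θ v ![-x, a, b, c] = -Θ v ![x, a, b, c] := fun v a b c => by
        have := (Θ v).vec4_smul_one (-1) x a b c
        rwa [neg_one_smul, neg_one_smul] at this
      simp only [alternatedDeriv, map_neg, n1, ContinuousAlternatingMap.neg_apply]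
      rw [← Complex.neg_re]
      congr 1
      ring
    · intro x y z c d; simp [alternatedDeriv_swap12 Θ x y z c d]
    · intro x y z c d; simp [alternatedDeriv_swap23 Θ x y z c d]
    · intro x y z c d; simp [alternatedDeriv_swap34 Θ x y z c d]
    · intro x y z c d; simp [alternatedDeriv_swap45 Θ x y z c d]
    · intro x y z c d
      have h := congrArg Complex.re (alternatedDeriv_type (J := stdJ) (N := fun v x => N v x)
        (Om := fun a b c d => stdOmega ![a, b, c, d]) (T := fun v a b c d => Θ v ![a, b, c, d])
        stdOmega_stdJ_one stdOmega_stdJ_two stdOmega_stdJ_three stdOmega_stdJ_four t1 t2 t3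
        x y z c d)
      simp only [Complex.add_re, Complex.sub_re, Complex.mul_re, Complex.I_re, Complex.I_im,
        Complex.add_im, Complex.sub_im, Complex.zero_re, him] at h
      linear_combination -h
  refine ⟨hB, ?_⟩
  -- Inside Ω₀, where J acts as i, P x y is N in the direction x + iJx applied to y. Evaluating dΩ =
  -- 0 on two vectors of type (0,1) shows that P is symmetric; it is also skew in its last two
  -- arguments, since N v and J N v are skew-adjoint.
  let P : E8 → E8 → E8 := fun x y => N x y + stdJ (N (stdJ x) y)
  have hP : ∀ x y, P x y = 0 := by
    refine eq_zero_of_symm_of_skew (fun x y => ?_) fun x y z => ?_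
    · rw [← sub_eq_zero]
      refine stdOmega_eq_zero fun b c d => ?_
      have lin : ∀ p q r s : E8, stdOmega ![p + stdJ q - (r + stdJ s), b, c, d] =
          stdOmega ![p, b, c, d] + Complex.I * stdOmega ![q, b, c, d] -
            (stdOmega ![r, b, c, d] + Complex.I * stdOmega ![s, b, c, d]) := fun p q r s => by
        have ha : ∀ p q : E8, stdOmega ![p + q, b, c, d] =
            stdOmega ![p, b, c, d] + stdOmega ![q, b, c, d] := fun p q =>
          stdOmegaAlt.vec4_add_one p q b c d
        have hs : ∀ p q : E8, stdOmega ![p - q, b, c, d] =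
            stdOmega ![p, b, c, d] - stdOmega ![q, b, c, d] := fun p q => by
          rw [eq_sub_iff_add_eq, ← ha, sub_add_cancel]
        rw [hs, ha, ha, stdOmega_stdJ_one, stdOmega_stdJ_one]
      have e1 := hB x y b c d
      have e2 := hB (stdJ x) y b c d
      have e3 := hB x (stdJ y) b c d
      have e4 := hB (stdJ x) (stdJ y) b c d
      simp only [alternatedDeriv, t1, t2, stdOmega_stdJ_one, stdOmega_stdJ_two] at e1 e2 e3 e4
      rw [lin]
      have hI := Complex.I_sq
      -- The combination e1 + i e2 + i e3 − e4 is dΩ on (x + iJx, y + iJy, b, c, d).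
      linear_combination Complex.I * (e1 + Complex.I * e2 + Complex.I * e3 - e4) +
        (stdOmega ![N x y, b, c, d] - stdOmega ![N y x, b, c, d] - Complex.I *
          (Θ b ![x, y, c, d] - Θ c ![x, y, b, d] + Θ d ![x, y, b, c] + Θ x ![y, b, c, d]
            - Θ y ![x, b, c, d])) * hI
    · simp only [P, inner_add_left, inner_add_right, hN x y z]
      rw [← neg_eq_iff_eq_neg.2 (inner_stdJ_right (N (stdJ x) y) z), hN, hNJ, inner_neg_right]
      ring
  intro v x
  have h := congrArg stdJ (hP v x)
  simp only [P, map_add, stdJ_stdJ, map_zero] at h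
  rw [← sub_eq_zero, ← neg_eq_zero, ← h]
  abel

/-- The cyclic sum in `hcyc` is dω. Replacing y, z by Jy, Jz reverses its first term and keeps the
other two, so the first term vanishes. -/
theorem eq_zero_of_closed_kahler
    (hNJ : ∀ v x, N v (stdJ x) = -stdJ (N v x))
    (hJN : ∀ v x, N (stdJ v) x = stdJ (N v x))
    (hcyc : ∀ x y z, (inner ℝ (N x y) z - inner ℝ (N y x) z + inner ℝ (N z x) y : ℝ) = 0)
    (hN : ∀ v x y, inner ℝ (N v x) y = -inner ℝ x (N v y)) : N = 0 := by
  ext1 x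
  ext1 y
  refine ext_inner_right ℝ fun z => ?_
  have h1 := hcyc x y z
  have h2 := hcyc x (stdJ y) (stdJ z)
  have a1 : ∀ v p q, (inner ℝ (N v (stdJ p)) (stdJ q) : ℝ) = -inner ℝ (N v p) q := fun v p q => by
    rw [hNJ, inner_neg_left, inner_stdJ_stdJ]
  have a2 : ∀ v p q, (inner ℝ (N (stdJ v) p) (stdJ q) : ℝ) = inner ℝ (N v p) q := fun v p q => by
    rw [hJN, inner_stdJ_stdJ]
  have a3 : (inner ℝ (N (stdJ z) x) (stdJ y) : ℝ) = inner ℝ (N z x) y := a2 _ _ _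
  rw [a1, a2, a3] at h2
  simp only [LinearMap.zero_apply, inner_zero_left]
  linarith

theorem map_update_stdJ {A : E8 [⋀^Fin 4]→L[ℝ] ℂ}
    (hA : ∀ x b c d, A ![stdJ x, b, c, d] = Complex.I * A ![x, b, c, d]) (v : Fin 4 → E8)
    (i : Fin 4) (x : E8) :
    A (Function.update v i (stdJ x)) = Complex.I * A (Function.update v i x) := by
  have h0 : ∀ (u : Fin 4 → E8) y, Function.update u 0 y = ![y, u 1, u 2, u 3] := fun u y => by
    ext j : 1; fin_cases j <;> rfl
  by_cases hi : i = 0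
  · subst hi; rw [h0, h0, hA]
  have hs : ∀ y, A (Function.update v i y) =
      -A (Function.update (v ∘ Equiv.swap 0 i) 0 y) := fun y => by
    refine Eq.trans ?_ (A.toAlternatingMap.map_swap _ (Ne.symm hi))
    refine congrArg A ?_
    ext j : 1
    rcases eq_or_ne j i with rfl | hj
    · simp
    rcases eq_or_ne j 0 with rfl | hj'
    · simp [hj, hi]
    · simp [hj, hj', Equiv.swap_apply_of_ne_of_ne]
  rw [hs, hs, h0, h0, hA]
  ring

/-- A real alternating form that is of type `(4, 0)`, as a complex alternating form. -/
noncomputable def complexAlternating (A : E8 [⋀^Fin 4]→L[ℝ] ℂ)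
    (hA : ∀ x b c d, A ![stdJ x, b, c, d] = Complex.I * A ![x, b, c, d]) :
    C4 [⋀^Fin 4]→ₗ[ℂ] ℂ where
  toFun w := A fun i => stdComplexEquiv.symm (w i)
  map_update_add' w i x y := by
    have h := fun z => Function.comp_update (stdComplexEquiv.symm : C4 → E8) w i z
    simp only [Function.comp_def] at h
    simp only [h, map_add, A.map_update_add]
  map_update_smul' w i c x := by
    have h := fun z => Function.comp_update (stdComplexEquiv.symm : C4 → E8) w i z
    have hc : stdComplexEquiv.symm (c • x) =
        c.re • stdComplexEquiv.symm x + c.im • stdJ (stdComplexEquiv.symm x) := by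
      apply stdComplexEquiv.injective
      simp only [map_add, map_smul, stdComplexEquiv_stdJ, LinearEquiv.apply_symm_apply]
      conv_lhs => rw [← Complex.re_add_im c]
      rw [add_smul, mul_smul]
      rfl
    have : ‹DecidableEq (Fin 4)› = instDecidableEqFin 4 := Subsingleton.elim _ _
    subst this
    simp only [Function.comp_def] at h
    simp only [h, hc, A.map_update_add, A.map_update_smul, map_update_stdJ hA]
    simp only [Complex.real_smul, smul_eq_mul]
    conv_rhs => rw [← Complex.re_add_im c]
    ring
  map_eq_zero_of_eq' w i j hij hne := A.map_eq_zero_of_eq _ (congrArg _ hij) hne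

/-- Being of type (4,0), the form is complex multilinear on ℂ⁴ and thus a multiple of the
determinant. -/
theorem eq_smul_stdOmega {A : E8 [⋀^Fin 4]→L[ℝ] ℂ}
    (hA : ∀ x b c d, A ![stdJ x, b, c, d] = Complex.I * A ![x, b, c, d]) (v : Fin 4 → E8) :
    A v = A stdUnitary * stdOmega v := by
  have hO : ∀ x b c d, stdOmegaAlt ![stdJ x, b, c, d] = Complex.I * stdOmegaAlt ![x, b, c, d] :=
    stdOmega_stdJ_one
  let e := (EuclideanSpace.basisFun (Fin 4) ℂ).toBasis
  have he : (fun i => stdComplexEquiv.symm (e i)) = stdUnitary := by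
    ext i j
    fin_cases i <;> fin_cases j <;> simp [e, stdComplexEquiv, stdUnitary]
  have key : ∀ {A : E8 [⋀^Fin 4]→L[ℝ] ℂ}
      (hA : ∀ x b c d, A ![stdJ x, b, c, d] = Complex.I * A ![x, b, c, d]),
      A v = A stdUnitary * e.det (fun i => stdComplexEquiv (v i)) := fun {A} hA => by
    have h := congrArg (fun f => f (fun i => stdComplexEquiv (v i)))
      ((complexAlternating A hA).eq_smul_basis_det e)
    have h1 : complexAlternating A hA e = A stdUnitary := by rw [← he]; rfl
    have h2 : complexAlternating A hA (fun i => stdComplexEquiv (v i)) = A v :=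
      congrArg A (by ext i : 1; simp)
    simp only [AlternatingMap.smul_apply, h1, h2, smul_eq_mul] at h
    exact h
  have h := key hO
  rw [stdOmegaAlt_apply, stdOmegaAlt_apply, stdOmega_stdUnitary, one_mul] at h
  rw [key hA, h]

/-- The first-order content of the theorem, in a frame adapted at a point. -/
theorem covariantDerivative_eq_zero_of_closed {C S : ℝ} (hC : C ≠ 0) (hS : S ≠ 0)
    (hNJ : ∀ v x, N v (stdJ x) = -stdJ (N v x))
    (hN : ∀ v x y, inner ℝ (N v x) y = -inner ℝ x (N v y))
    (hΘ : ∀ v x b c d, Θ v ![stdJ x, b, c, d] + stdOmega ![N v x, b, c, d] =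
      Complex.I * Θ v ![x, b, c, d])
    (hnorm : ∀ v, (Θ v stdUnitary).re = 0)
    (hcl : ∀ a b c d e, alternatedDeriv (fun v a b c d => ((C * (Θ v ![a, b, c, d]).re -
      halfWedgePolar stdKahler (fun x y => inner ℝ (N v x) y) a b c d : ℝ) : ℂ) +
        Complex.I * ((S * (Θ v ![a, b, c, d]).im : ℝ) : ℂ)) a b c d e = 0) :
    N = 0 ∧ Θ = 0 := by
  -- The two halves of dΦ = 0: C Re dΩ = d(½ ω ∧ ω) and S Im dΩ = 0.
  have hre_im : ∀ a b c d e,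
      C * (alternatedDeriv (fun v a b c d => Θ v ![a, b, c, d]) a b c d e).re =
        alternatedDeriv (fun v => halfWedgePolar stdKahler (fun x y => inner ℝ (N v x) y)) a b c d e ∧
      (alternatedDeriv (fun v a b c d => Θ v ![a, b, c, d]) a b c d e).im = 0 := by
    intro a b c d e
    have h := (alternatedDeriv_re_im (fun v a b c d => Θ v ![a, b, c, d])
      (fun v => halfWedgePolar stdKahler (fun x y => inner ℝ (N v x) y)) C S a b c d e).symm.trans
      (hcl a b c d e)
    have h1 := congrArg Complex.re h
    have h2 := congrArg Complex.im h
    simp only [Complex.add_re, Complex.add_im, Complex.mul_re, Complex.mul_im, Complex.I_re,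
      Complex.I_im, Complex.ofReal_re, Complex.ofReal_im, Complex.zero_re, Complex.zero_im] at h1 h2
    refine ⟨by linarith, ?_⟩
    have : S * (alternatedDeriv (fun v a b c d => Θ v ![a, b, c, d]) a b c d e).im = 0 := by linarith
    exact (mul_eq_zero.1 this).resolve_left hS
  obtain ⟨hB, hJN⟩ := integrable_of_real_alternatedDeriv hNJ hN hΘ fun a b c d e =>
    (hre_im a b c d e).2
  let κ : E8 →ₗ[ℝ] E8 →ₗ[ℝ] E8 →ₗ[ℝ] ℝ :=
    LinearMap.mk₂ ℝ (fun v x => (innerₗ E8) (N v x)) (by intros; simp) (by intros; simp)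
      (by intros; simp) (by intros; simp)
  have hκ : ∀ v x y, κ v x y = inner ℝ (N v x) y := fun v x y => rfl
  have hκ2 : ∀ v x y, κ v x y = -κ v y x := fun v x y => by
    rw [hκ, hκ, hN, real_inner_comm]
  let γ : E8 →ₗ[ℝ] E8 →ₗ[ℝ] E8 →ₗ[ℝ] ℝ :=
    LinearMap.mk₂ ℝ (fun x y => κ x y - κ y x + (κ.flip x).flip y)
      (by intros; ext; simp; ring) (by intros; ext; simp; ring)
      (by intros; ext; simp; ring) (by intros; ext; simp; ring)
  have hγ : ∀ x y z, γ x y z = κ x y z - κ y x z + κ z x y := fun x y z => rfl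
  -- Here γ is dω. Since dΩ = 0, the real half now reads ω ∧ dω = 0.
  have hγ0 : γ = 0 := by
    refine eq_zero_of_wedgeTwoThree ?_ ?_ fun a b c d e => ?_
    · intro x y z
      rw [hγ, hγ, hκ2 z y x]; ring
    · intro x y z
      rw [hγ, hγ, hκ2 x z y]; ring
    · have h := (hre_im a b c d e).1
      rw [hB, alternatedDeriv_halfWedgePolar, Complex.zero_re, mul_zero] at h
      exact h.symm
  have hN0 : N = 0 := by
    refine eq_zero_of_closed_kahler hNJ hJN (fun x y z => ?_) hN
    exact (hγ x y z).symm.trans (by rw [hγ0]; rfl)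
  refine ⟨hN0, ?_⟩
  have hJ : ∀ v x b c d, Θ v ![stdJ x, b, c, d] = Complex.I * Θ v ![x, b, c, d] := by
    intro v x b c d
    have h := hΘ v x b c d
    have h0 : stdOmega ![N v x, b, c, d] = 0 := by
      rw [hN0]
      exact stdOmegaAlt.map_coord_zero 0 rfl
    rwa [h0, add_zero] at h
  have hΘ' := fun v => eq_smul_stdOmega (hJ v)
  -- At this stage Θ v = θ(v) Ω₀. From dΩ = 0 follows θ(v) + i θ(Jv) = 0, and as θ is imaginary by
  -- `hnorm`, it vanishes.
  have hθ : ∀ v, Θ v stdUnitary = 0 := by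
    intro v
    have hc : ∀ v b c d e, Θ v ![b, c, d, e] + Complex.I * Θ (stdJ v) ![b, c, d, e] = 0 := by
      intro v b c d e
      have h1 := hB v b c d e
      have h2 := hB (stdJ v) b c d e
      simp only [alternatedDeriv, hJ] at h1 h2
      linear_combination h1 + Complex.I * h2 + (-Θ b ![v, c, d, e] + Θ c ![v, b, d, e]
        - Θ d ![v, b, c, e] + Θ e ![v, b, c, d]) * (-1) * Complex.I_sq
    have h := hc v (stdUnitary 0) (stdUnitary 1) (stdUnitary 2) (stdUnitary 3)
    have e : ![stdUnitary 0, stdUnitary 1, stdUnitary 2, stdUnitary 3] = stdUnitary := by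
      ext i : 1
      fin_cases i <;> rfl
    rw [e] at h
    have h1 := hnorm v
    have h2 := hnorm (stdJ v)
    have h3 := congrArg Complex.im h
    simp [h2] at h3
    exact Complex.ext h1 h3
  ext v w
  rw [hΘ' v w, hθ, zero_mul]
  rfl

end FirstOrder

/-! ### Smoothness of forms and metrics in charts. -/

section EvaluationSmoothness

variable {k : ℕ} {F : Type*} [NormedAddCommGroup F] [NormedSpace ℝ F] [FiniteDimensional ℝ F]

/-- Evaluation on tuples of basis vectors embeds the space of forms linearly in a finite-dimensional
space; a linear left inverse recovers the form from these values. -/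
theorem contDiffOn_continuousAlternatingMap {f : E8 → E8 [⋀^Fin k]→L[ℝ] F} {s : Set E8}
    {n : WithTop ℕ∞} (h : ∀ v, ContDiffOn ℝ n (fun y => f y v) s) : ContDiffOn ℝ n f s := by
  let b := (EuclideanSpace.basisFun (Fin 8) ℝ).toBasis
  let ev : (E8 [⋀^Fin k]→L[ℝ] F) →ₗ[ℝ] ((Fin k → Fin 8) → F) :=
    { toFun := fun α I => α (fun i => b (I i))
      map_add' := fun _ _ => rfl
      map_smul' := fun _ _ => rfl }
  have hev : LinearMap.ker ev = ⊥ := by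
    rw [LinearMap.ker_eq_bot]
    intro α β hαβ
    apply ContinuousAlternatingMap.toAlternatingMap_injective
    exact b.ext_alternating fun I _ => congrFun hαβ I
  obtain ⟨L, hL⟩ := LinearMap.exists_leftInverse_of_injective ev hev
  have hf : f = fun y => L.toContinuousLinearMap (ev (f y)) := by
    ext1 y
    exact (congrArg (fun T => T (f y)) hL).symm
  rw [hf]
  exact L.toContinuousLinearMap.contDiff.comp_contDiffOn (contDiffOn_pi.2 fun I => h _)

end EvaluationSmoothness

section MetricInChart

variable {M : Type*} [TopologicalSpace M] [ChartedSpace E8 M] [IsManifold 𝓘(ℝ, E8) ∞ M]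
  {e : OpenPartialHomeomorph M E8} (g : SmoothMetric M)

/-- The expression of a Riemannian metric in a chart. -/
noncomputable def metricInChart (e : OpenPartialHomeomorph M E8) (y : E8) : E8 →L[ℝ] E8 →L[ℝ] ℝ :=
  (show E8 →L[ℝ] E8 →L[ℝ] ℝ from g.inner (e.symm y)).bilinearComp
    (mfderiv 𝓘(ℝ, E8) 𝓘(ℝ, E8) e.symm y) (mfderiv 𝓘(ℝ, E8) 𝓘(ℝ, E8) e.symm y)

theorem metricInChart_apply (y v w : E8) :
    metricInChart g e y v w = g.inner (e.symm y)
      (mfderiv 𝓘(ℝ, E8) 𝓘(ℝ, E8) e.symm y v) (mfderiv 𝓘(ℝ, E8) 𝓘(ℝ, E8) e.symm y w) := rfl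

theorem metricInChart_fieldInChart (he : e ∈ atlas E8 M) {y : E8} (hy : y ∈ e.target)
    (Y Z : ∀ x : M, TangentSpace 𝓘(ℝ, E8) x) :
    metricInChart g e y (fieldInChart e Y y) (fieldInChart e Z y) =
      g.inner (e.symm y) (Y (e.symm y)) (Z (e.symm y)) := by
  rw [metricInChart_apply, mfderiv_symm_fieldInChart he hy, mfderiv_symm_fieldInChart he hy]

theorem metricInChart_field (he : e ∈ atlas E8 M) {x : M} (hx : x ∈ e.source)
    (Y Z : ∀ x : M, TangentSpace 𝓘(ℝ, E8) x) :
    metricInChart g e (e x) (fieldInChart e Y (e x)) (fieldInChart e Z (e x)) =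
      g.inner x (Y x) (Z x) := by
  rw [metricInChart_fieldInChart g he (e.map_source hx)]
  have h : ∀ p : M, p = x → g.inner p (Y p) (Z p) = g.inner x (Y x) (Z x) :=
    fun p hp => by subst hp; rfl
  exact h _ (e.left_inv hx)

theorem metricInChart_apply_mfderiv (he : e ∈ atlas E8 M) {x : M} (hx : x ∈ e.source)
    (v w : TangentSpace 𝓘(ℝ, E8) x) :
    metricInChart g e (e x) (mfderiv 𝓘(ℝ, E8) 𝓘(ℝ, E8) e x v)
      (mfderiv 𝓘(ℝ, E8) 𝓘(ℝ, E8) e x w) = g.inner x v w := by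
  classical
  have h := metricInChart_field g he hx (Function.update 0 x v) (Function.update 0 x w)
  rw [fieldInChart_apply hx, fieldInChart_apply hx] at h
  simpa using h

theorem constField_contMDiffAt (he : e ∈ atlas E8 M) {x : M} (hx : x ∈ e.source) (w : E8) :
    ContMDiffAt 𝓘(ℝ, E8) (𝓘(ℝ, E8).prod 𝓘(ℝ, E8)) ∞
      (fun y => (⟨y, constField e w y⟩ : TangentBundle 𝓘(ℝ, E8) M)) x := by
  refine ContMDiffAt.mpullback_vectorField_preimage (n := ∞) ?_ ?_
      (isInvertible_mfderiv_chart he hx) (by simp)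
  · exact contMDiffAt_vectorSpace_iff_contDiffAt.2 contDiffAt_const
  · exact contMDiffAt_of_mem_maximalAtlas (IsManifold.subset_maximalAtlas he) hx

theorem metricInChart_contDiffOn (he : e ∈ atlas E8 M) :
    ContDiffOn ℝ ∞ (metricInChart g e) e.target := by
  refine contDiffOn_clm_apply.2 fun v => contDiffOn_clm_apply.2 fun w => ?_
  have h1 : ContMDiffOn 𝓘(ℝ, E8) 𝓘(ℝ, ℝ) ∞
      (fun x => g.inner x (constField e v x) (constField e w x)) e.source := by
    intro x hx
    have h2 := ContMDiffAt.clm_bundle_apply₂ (F₁ := E8) (F₂ := E8) (F₃ := ℝ)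
      (E₃ := fun _ : M => ℝ) (g.contMDiff.contMDiffAt (x := x))
      (constField_contMDiffAt he hx v) (constField_contMDiffAt he hx w)
    exact ((Bundle.contMDiffAt_totalSpace.1 h2).2).contMDiffWithinAt
  have h3 := h1.comp (contMDiffOn_symm_of_mem_maximalAtlas
    (IsManifold.subset_maximalAtlas he)) (fun y hy => e.map_target hy)
  refine (contMDiffOn_iff_contDiffOn.1 h3).congr fun y hy => ?_
  have h4 := metricInChart_fieldInChart g he hy (constField e v) (constField e w)
  rw [fieldInChart_constField he hy, fieldInChart_constField he hy] at h4
  exact h4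

theorem metricInChart_differentiableAt (he : e ∈ atlas E8 M) {y : E8} (hy : y ∈ e.target) :
    DifferentiableAt ℝ (metricInChart g e) y :=
  ((metricInChart_contDiffOn g he).contDiffAt (e.open_target.mem_nhds hy)).differentiableAt
    (by simp)

theorem metricInChart_symm (y v w : E8) : metricInChart g e y v w = metricInChart g e y w v :=
  g.symm _ _ _

theorem metricInChart_isInvertible (he : e ∈ atlas E8 M) {y : E8} (hy : y ∈ e.target) :
    (metricInChart g e y).IsInvertible := by
  have hinj : Function.Injective (metricInChart g e y) := by
    rw [injective_iff_map_eq_zero]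
    intro v hv
    by_contra hne
    have h1 : mfderiv 𝓘(ℝ, E8) 𝓘(ℝ, E8) e.symm y v ≠ 0 := fun h0 =>
      hne ((isInvertible_mfderiv_chart_symm he hy).injective (h0.trans (map_zero _).symm))
    have h2 := g.pos (e.symm y) _ h1
    rw [← metricInChart_apply, hv] at h2
    exact lt_irrefl _ h2
  have hd : Module.finrank ℝ E8 = Module.finrank ℝ (E8 →L[ℝ] ℝ) :=
    (InnerProductSpace.toDual ℝ E8).toLinearEquiv.finrank_eq
  let L : E8 ≃ₗ[ℝ] (E8 →L[ℝ] ℝ) :=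
    LinearEquiv.ofInjectiveOfFinrankEq (metricInChart g e y).toLinearMap hinj hd
  exact ⟨L.toContinuousLinearEquiv, by ext; rfl⟩

theorem mvfderiv_metric_apply (he : e ∈ atlas E8 M) {x : M} (hx : x ∈ e.source)
    {Y Z : ∀ x : M, TangentSpace 𝓘(ℝ, E8) x} (hY : VectorFieldDifferentiableAt Y x)
    (hZ : VectorFieldDifferentiableAt Z x) (v : TangentSpace 𝓘(ℝ, E8) x) :
    mvfderiv 𝓘(ℝ, E8) (fun y => g.inner y (Y y) (Z y)) x v =
      fderiv ℝ (metricInChart g e) (e x) (mfderiv 𝓘(ℝ, E8) 𝓘(ℝ, E8) e x v)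
          (fieldInChart e Y (e x)) (fieldInChart e Z (e x)) +
        metricInChart g e (e x) (fderiv ℝ (fieldInChart e Y) (e x)
          (mfderiv 𝓘(ℝ, E8) 𝓘(ℝ, E8) e x v)) (fieldInChart e Z (e x)) +
        metricInChart g e (e x) (fieldInChart e Y (e x)) (fderiv ℝ (fieldInChart e Z) (e x)
          (mfderiv 𝓘(ℝ, E8) 𝓘(ℝ, E8) e x v)) := by
  have hd := metricInChart_differentiableAt g he (e.map_source hx)
  have hY' := fieldInChart_differentiableAt he hx hY
  have hZ' := fieldInChart_differentiableAt he hx hZ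
  have key : ∀ a : E8, fderiv ℝ (fun y => metricInChart g e y (fieldInChart e Y y)
      (fieldInChart e Z y)) (e x) a =
      fderiv ℝ (metricInChart g e) (e x) a (fieldInChart e Y (e x)) (fieldInChart e Z (e x)) +
        metricInChart g e (e x) (fderiv ℝ (fieldInChart e Y) (e x) a) (fieldInChart e Z (e x)) +
        metricInChart g e (e x) (fieldInChart e Y (e x)) (fderiv ℝ (fieldInChart e Z) (e x) a) := by
    intro a
    rw [fderiv_clm_apply (hd.clm_apply hY') hZ', fderiv_clm_apply hd hY']
    simp only [ContinuousLinearMap.add_apply, ContinuousLinearMap.comp_apply,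
      ContinuousLinearMap.flip_apply]
    ring
  exact (mvfderiv_eq_fderiv he hx (f' := fun y => metricInChart g e y (fieldInChart e Y y)
    (fieldInChart e Z y)) (fun y hy => (metricInChart_fieldInChart g he hy Y Z).symm)
    ((hd.clm_apply hY').clm_apply hZ') v).trans (key _)

end MetricInChart

/-! ### Recovering ω from Φ and g by contraction. -/

section StandardContraction

/-- `ω₀` as a bilinear map. -/
def stdKahlerLin : E8 →ₗ[ℝ] E8 →ₗ[ℝ] ℝ :=
  LinearMap.mk₂ ℝ stdKahler (by intros; simp [stdKahler]; ring) (by intros; simp [stdKahler]; ring)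
    (by intros; simp [stdKahler]; ring) (by intros; simp [stdKahler]; ring)

theorem stdKahlerLin_apply (v w : E8) : stdKahlerLin v w = stdKahler v w := rfl

/-- `ω₀` as a continuous alternating map. -/
noncomputable def stdKahlerAlt : E8 [⋀^Fin 2]→L[ℝ] ℝ where
  toFun v := stdKahler (v 0) (v 1)
  map_update_add' m i x y := by
    have : ‹DecidableEq (Fin 2)› = instDecidableEqFin 2 := Subsingleton.elim _ _
    subst this
    fin_cases i <;> simp [stdKahler, Function.update] <;> ring
  map_update_smul' m i c x := by
    have : ‹DecidableEq (Fin 2)› = instDecidableEqFin 2 := Subsingleton.elim _ _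
    subst this
    fin_cases i <;> simp [stdKahler, Function.update] <;> ring
  map_eq_zero_of_eq' v i j hij hne := by
    fin_cases i <;> fin_cases j <;> first
      | exact absurd rfl hne
      | (simp only [Fin.zero_eta, Fin.mk_one] at hij
         simp only [hij, stdKahler]
         ring)
  cont := by
    simp only [stdKahler]
    fun_prop

/-- Four-forms on `ℝ⁸` as linear functions of their first argument. -/
def AlternatingMap.firstSlot {W : Type*} [AddCommGroup W] [Module ℝ W]
    (A : E8 [⋀^Fin 4]→ₗ[ℝ] W) (b c d : E8) : E8 →ₗ[ℝ] W :=
  A.toMultilinearMap.toLinearMap ![0, b, c, d] 0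

theorem AlternatingMap.firstSlot_apply {W : Type*} [AddCommGroup W] [Module ℝ W]
    (A : E8 [⋀^Fin 4]→ₗ[ℝ] W) (a b c d : E8) : A.firstSlot b c d a = A ![a, b, c, d] :=
  congrArg A (by ext i : 1; fin_cases i <;> rfl)

theorem stdCayley_single (τ : ℝ) (a b c d : Fin 8) :
    (stdCayley τ ![EuclideanSpace.single a 1, EuclideanSpace.single b 1, EuclideanSpace.single c 1,
      EuclideanSpace.single d 1]).re = Real.cosh (2 * τ) * reOmegaInt a b c d - kahlerSqInt a b c d ∧
    (stdCayley τ ![EuclideanSpace.single a 1, EuclideanSpace.single b 1, EuclideanSpace.single c 1,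
      EuclideanSpace.single d 1]).im = Real.sinh (2 * τ) * imOmegaInt a b c d := by
  have h : ![EuclideanSpace.single a 1, EuclideanSpace.single b 1, EuclideanSpace.single c 1,
      EuclideanSpace.single d 1] = fun i => (EuclideanSpace.single (![a, b, c, d] i) 1 : E8) := by
    ext i : 1; fin_cases i <;> rfl
  have hri : ∀ A B : ℝ, ((A : ℂ) + Complex.I * (B : ℂ)).re = A ∧
      ((A : ℂ) + Complex.I * (B : ℂ)).im = B := fun A B => by simp
  rw [stdCayley, (hri _ _).1, (hri _ _).2, h, stdOmega_single]
  simp [halfWedge, stdKahler_single, kahlerSqInt]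

/-- Bilinearity reduces this to basis vectors. There the imaginary part is sinh 2τ Im Ω₀, and only
the Re Ω₀ term of the real part survives the contraction. -/
theorem stdCayley_contraction (τ : ℝ) (v w : E8) :
    ∑ k : Fin 8, ∑ l : Fin 8, ∑ m : Fin 8,
      (stdCayley τ ![v, EuclideanSpace.single k 1, EuclideanSpace.single l 1,
        EuclideanSpace.single m 1]).re *
      (stdCayley τ ![w, EuclideanSpace.single k 1, EuclideanSpace.single l 1,
        EuclideanSpace.single m 1]).im =
      24 * Real.cosh (2 * τ) * Real.sinh (2 * τ) * stdKahler v w := by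
  let b : Fin 8 → E8 := fun k => EuclideanSpace.single k 1
  let L := fun k l m => (stdCayleyAlt τ).firstSlot (b k) (b l) (b m)
  have hL : ∀ v k l m, L k l m v = stdCayley τ ![v, b k, b l, b m] := fun v k l m =>
    ((stdCayleyAlt τ).firstSlot_apply _ _ _ _).trans (stdCayleyAlt_apply τ _)
  let B : E8 →ₗ[ℝ] E8 →ₗ[ℝ] ℝ := ∑ k, ∑ l, ∑ m,
    LinearMap.smulRight (Complex.reLm ∘ₗ L k l m) (Complex.imLm ∘ₗ L k l m)
  have hB : ∀ v w, B v w = ∑ k : Fin 8, ∑ l : Fin 8, ∑ m : Fin 8,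
      (stdCayley τ ![v, b k, b l, b m]).re * (stdCayley τ ![w, b k, b l, b m]).im := fun v w => by
    simp [B, LinearMap.sum_apply, hL]
  have key : B = (24 * Real.cosh (2 * τ) * Real.sinh (2 * τ)) • stdKahlerLin := by
    refine (EuclideanSpace.basisFun (Fin 8) ℝ).toBasis.ext fun i =>
      (EuclideanSpace.basisFun (Fin 8) ℝ).toBasis.ext fun j => ?_
    rw [hB]
    simp only [OrthonormalBasis.coe_toBasis, EuclideanSpace.basisFun_apply, b,
      (stdCayley_single τ _ _ _ _).1, (stdCayley_single τ _ _ _ _).2, LinearMap.smul_apply,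
      stdKahlerLin_apply, stdKahler_single, smul_eq_mul]
    have h1 := congrArg (Int.cast : ℤ → ℝ) (sum_reOmegaInt_mul_imOmegaInt i j)
    have h2 := congrArg (Int.cast : ℤ → ℝ) (sum_kahlerSqInt_mul_imOmegaInt i j)
    push_cast at h1 h2
    simp only [sub_mul, Finset.sum_sub_distrib]
    have e1 : ∀ k l m, Real.cosh (2 * τ) * reOmegaInt i k l m * (Real.sinh (2 * τ) *
        imOmegaInt j k l m) = Real.cosh (2 * τ) * Real.sinh (2 * τ) *
          ((reOmegaInt i k l m : ℝ) * imOmegaInt j k l m) := fun k l m => by ring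
    have e2 : ∀ k l m, (kahlerSqInt i k l m : ℝ) * (Real.sinh (2 * τ) *
        imOmegaInt j k l m) = Real.sinh (2 * τ) *
          ((kahlerSqInt i k l m : ℝ) * imOmegaInt j k l m) := fun k l m => by ring
    simp only [e1, e2, ← Finset.mul_sum, h1, h2]
    ring
  exact (hB v w).symm.trans (by rw [key]; rfl)

/-- Contraction of two covectors with an inverse metric, in terms of an orthonormal frame. -/
theorem inverse_metric_contraction {G : E8 →L[ℝ] E8 →L[ℝ] ℝ} (hG : G.IsInvertible)
    (U : E8 ≃L[ℝ] E8)
    (hU : ∀ v w, G (U v) (U w) = inner ℝ v w) (f h : E8 →ₗ[ℝ] ℝ) :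
    ∑ a, ∑ i, G.inverse (EuclideanSpace.proj a) i *
      (f (EuclideanSpace.single a 1) * h (EuclideanSpace.single i 1)) =
      ∑ k, f (U (EuclideanSpace.single k 1)) * h (U (EuclideanSpace.single k 1)) := by
  have hb : ∀ (f : E8 →ₗ[ℝ] ℝ) (x : E8), ∑ i, x i * f (EuclideanSpace.single i 1) = f x := by
    intro f x
    conv_rhs => rw [← (EuclideanSpace.basisFun (Fin 8) ℝ).sum_repr x]
    simp
  -- The inverse metric is ∑ U eₖ ⊗ U eₖ for the orthonormal frame U.
  have hinv : ∀ a, G.inverse (EuclideanSpace.proj a) =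
      ∑ k, (U (EuclideanSpace.single k 1)) a • U (EuclideanSpace.single k 1) := by
    intro a
    have h1 : G (∑ k, (U (EuclideanSpace.single k 1)) a • U (EuclideanSpace.single k 1)) =
        EuclideanSpace.proj a := by
      ext1 z
      obtain ⟨z, rfl⟩ := U.surjective z
      have h2 := hb ((EuclideanSpace.proj (𝕜 := ℝ) a).toLinearMap ∘ₗ U.toLinearMap) z
      simp only [map_sum, map_smul, ContinuousLinearMap.sum_apply, ContinuousLinearMap.smul_apply,
        hU, EuclideanSpace.inner_single_left, smul_eq_mul]
      refine Eq.trans (Finset.sum_congr rfl fun k _ => ?_) h2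
      simp [mul_comm]
    rw [← h1, hG.inverse_apply_self]
  have hf : ∀ (f : E8 →ₗ[ℝ] ℝ) k, f (U (EuclideanSpace.single k 1)) =
      ∑ a, U (EuclideanSpace.single k 1) a * f (EuclideanSpace.single a 1) := fun f k =>
    (hb f _).symm
  simp only [hinv, WithLp.ofLp_sum, Finset.sum_apply, WithLp.ofLp_smul, Pi.smul_apply,
    smul_eq_mul, hf, Finset.sum_mul_sum]
  rw [Finset.sum_congr rfl fun a _ => Finset.sum_congr rfl fun i _ => Finset.sum_mul _ _ _,
    Finset.sum_congr rfl fun a _ => Finset.sum_comm, Finset.sum_comm]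
  refine Finset.sum_congr rfl fun k _ => Finset.sum_congr rfl fun a _ =>
    Finset.sum_congr rfl fun i _ => ?_
  ring

end StandardContraction

section ChartFrames

variable {M : Type*} [TopologicalSpace M] [ChartedSpace E8 M] [IsManifold 𝓘(ℝ, E8) ∞ M]
  {e : OpenPartialHomeomorph M E8}

theorem exists_chart_frame (he : e ∈ atlas E8 M) {y : E8} (hy : y ∈ e.target)
    (u : E8 ≃L[ℝ] TangentSpace 𝓘(ℝ, E8) (e.symm y)) :
    ∃ U : E8 ≃L[ℝ] E8, ∀ v, mfderiv 𝓘(ℝ, E8) 𝓘(ℝ, E8) e.symm y (U v) = u v := by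
  obtain ⟨D, hD⟩ := isInvertible_mfderiv_chart_symm he hy
  refine ⟨u.trans D.symm, fun v => ?_⟩
  rw [← hD]
  exact D.apply_symm_apply (u v)

/-- The contraction formula for the Kähler form in terms of a complex Cayley form and a metric. -/
theorem kahler_eq_contraction {τ : ℝ} (hτ : τ ≠ 0) {G : E8 →L[ℝ] E8 →L[ℝ] ℝ} (hG : G.IsInvertible)
    {φ : E8 [⋀^Fin 4]→L[ℝ] ℂ} (U : E8 ≃L[ℝ] E8) (hU : ∀ v w, G (U v) (U w) = inner ℝ v w)
    (hφ : ∀ v : Fin 4 → E8, φ (fun i => U (v i)) = stdCayley τ v) (v w : E8) :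
    stdKahler (U.symm v) (U.symm w) = (24 * Real.cosh (2 * τ) * Real.sinh (2 * τ))⁻¹ *
      ∑ a, ∑ i, G.inverse (EuclideanSpace.proj a) i *
      ∑ b, ∑ j, G.inverse (EuclideanSpace.proj b) j *
      ∑ c, ∑ k, G.inverse (EuclideanSpace.proj c) k *
      ((φ ![v, EuclideanSpace.single a 1, EuclideanSpace.single b 1, EuclideanSpace.single c 1]).re *
      (φ ![w, EuclideanSpace.single i 1, EuclideanSpace.single j 1, EuclideanSpace.single k 1]).im) := by
  have hs : Real.sinh (2 * τ) ≠ 0 := Real.sinh_ne_zero.2 (by simpa using hτ)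
  have hc : Real.cosh (2 * τ) ≠ 0 := (Real.cosh_pos _).ne'
  let s2 := fun (p q r : E8) => φ.toMultilinearMap.toLinearMap ![p, 0, q, r] 1
  let s3 := fun (p q r : E8) => φ.toMultilinearMap.toLinearMap ![p, q, 0, r] 2
  let s4 := fun (p q r : E8) => φ.toMultilinearMap.toLinearMap ![p, q, r, 0] 3
  have h2 : ∀ p q r x, s2 p q r x = φ ![p, x, q, r] := fun p q r x =>
    congrArg φ (by ext i : 1; fin_cases i <;> rfl)
  have h3 : ∀ p q r x, s3 p q r x = φ ![p, q, x, r] := fun p q r x =>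
    congrArg φ (by ext i : 1; fin_cases i <;> rfl)
  have h4 : ∀ p q r x, s4 p q r x = φ ![p, q, r, x] := fun p q r x =>
    congrArg φ (by ext i : 1; fin_cases i <;> rfl)
  -- The three index pairs are contracted from the innermost outwards, each time replacing
  -- coordinate vectors by the frame.
  have c4 := fun p q r p' q' r' => inverse_metric_contraction hG U hU
    (Complex.reLm ∘ₗ s4 p q r) (Complex.imLm ∘ₗ s4 p' q' r')
  have c3 := fun p q r p' q' r' => inverse_metric_contraction hG U hU
    (Complex.reLm ∘ₗ s3 p q r) (Complex.imLm ∘ₗ s3 p' q' r')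
  have c2 := fun p q r p' q' r' => inverse_metric_contraction hG U hU
    (Complex.reLm ∘ₗ s2 p q r) (Complex.imLm ∘ₗ s2 p' q' r')
  simp only [LinearMap.comp_apply, h2, h3, h4, Complex.reLm_coe, Complex.imLm_coe] at c2 c3 c4
  have e3 : ∀ p q p' q', ∑ b, ∑ j, G.inverse (EuclideanSpace.proj b) j *
      ∑ m, ((φ ![p, q, EuclideanSpace.single b 1, U (EuclideanSpace.single m 1)]).re *
        (φ ![p', q', EuclideanSpace.single j 1, U (EuclideanSpace.single m 1)]).im) =
      ∑ l, ∑ m, ((φ ![p, q, U (EuclideanSpace.single l 1), U (EuclideanSpace.single m 1)]).re *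
        (φ ![p', q', U (EuclideanSpace.single l 1), U (EuclideanSpace.single m 1)]).im) := by
    intro p q p' q'
    simp only [Finset.mul_sum]
    rw [Finset.sum_congr rfl fun a _ => Finset.sum_comm, Finset.sum_comm,
      Finset.sum_congr rfl fun m _ => c3 p q _ p' q' _, Finset.sum_comm]
  have e2 : ∀ p p', ∑ b, ∑ j, G.inverse (EuclideanSpace.proj b) j *
      ∑ l, ∑ m, ((φ ![p, EuclideanSpace.single b 1, U (EuclideanSpace.single l 1),
          U (EuclideanSpace.single m 1)]).re *
        (φ ![p', EuclideanSpace.single j 1, U (EuclideanSpace.single l 1),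
          U (EuclideanSpace.single m 1)]).im) =
      ∑ k, ∑ l, ∑ m, ((φ ![p, U (EuclideanSpace.single k 1), U (EuclideanSpace.single l 1),
          U (EuclideanSpace.single m 1)]).re *
        (φ ![p', U (EuclideanSpace.single k 1), U (EuclideanSpace.single l 1),
          U (EuclideanSpace.single m 1)]).im) := by
    intro p p'
    simp only [Finset.mul_sum]
    rw [Finset.sum_congr rfl fun a _ => Finset.sum_comm, Finset.sum_comm,
      Finset.sum_congr rfl fun l _ => Finset.sum_congr rfl fun a _ => Finset.sum_comm,
      Finset.sum_congr rfl fun l _ => Finset.sum_comm,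
      Finset.sum_congr rfl fun l _ => Finset.sum_congr rfl fun m _ => c2 p _ _ p' _ _,
      Finset.sum_congr rfl fun l _ => Finset.sum_comm, Finset.sum_comm]
  simp only [c4, e3, e2]
  have hφ' : ∀ x k l m, φ ![x, U (EuclideanSpace.single k 1), U (EuclideanSpace.single l 1),
      U (EuclideanSpace.single m 1)] = stdCayley τ ![U.symm x, EuclideanSpace.single k 1,
        EuclideanSpace.single l 1, EuclideanSpace.single m 1] := fun x k l m => by
    rw [← hφ]
    congr 1
    ext i : 1
    fin_cases i <;> simp
  simp only [hφ', stdCayley_contraction]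
  field_simp

end ChartFrames

/-! ### Existence and uniqueness of the SU(4) structure. -/

section ChartSmoothness

variable {M : Type*} [TopologicalSpace M] [ChartedSpace E8 M]

theorem DiffForm.wedgeTwo_self (α : DiffForm M 2 ℝ) (x : M)
    (v : Fin 4 → TangentSpace 𝓘(ℝ, E8) x) :
    α.wedgeTwo α x v = 2 * halfWedge (fun a b => α x ![a, b]) (v 0) (v 1) (v 2) (v 3) := by
  simp only [DiffForm.wedgeTwo, halfWedge]
  ring

theorem DiffForm.inChart_vec2 (α : DiffForm M 2 ℝ) (e : OpenPartialHomeomorph M E8) (y v w : E8) :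
    α.inChart e y ![v, w] = α (e.symm y) ![mfderiv 𝓘(ℝ, E8) 𝓘(ℝ, E8) e.symm y v,
      mfderiv 𝓘(ℝ, E8) 𝓘(ℝ, E8) e.symm y w] :=
  congrArg (α (e.symm y)) (by ext i : 1; fin_cases i <;> rfl)

variable [IsManifold 𝓘(ℝ, E8) ∞ M] {τ : ℝ} {Φ : DiffForm M 4 ℂ} {g : SmoothMetric M}

/-- At every point there is a frame in which the metric and the four-form are standard. -/
def HasCayleyFrames (τ : ℝ) (Φ : DiffForm M 4 ℂ) (g : SmoothMetric M) : Prop :=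
  ∀ x : M, ∃ u : E8 ≃L[ℝ] TangentSpace 𝓘(ℝ, E8) x,
    (∀ v w : E8, g.inner x (u v) (u w) = inner ℝ v w) ∧
    ∀ v : Fin 4 → E8, Φ x (fun i => u (v i)) = stdCayley τ v

theorem IsComplexCayleyForm.exists_hasCayleyFrames (hτ : τ ≠ 0) (h : IsComplexCayleyForm τ Φ) :
    ∃ g : SmoothMetric M, HasCayleyFrames τ Φ g := by
  obtain ⟨_, g, hg⟩ := h
  refine ⟨g, fun x => ?_⟩
  obtain ⟨u, ψ, hu, hψ, hΦ⟩ := hg x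
  obtain ⟨R, hR⟩ := hψ.exists_frame hτ
  refine ⟨R.toContinuousLinearEquiv.trans u, fun v w => ?_, fun v => ?_⟩
  · exact (hu _ _).trans (R.inner_map_map v w)
  · exact (hΦ fun i => R (v i)).trans (hR v)

/-- The frames are given point by point without any regularity. They disappear from
`kahler_eq_contraction`, which writes the coefficients of κ as polynomials in those of Φ and of the
inverse metric. -/
theorem kahler_isSmooth_of_frames (hτ : τ ≠ 0) (hΦ : Φ.IsSmooth) {κ : DiffForm M 2 ℝ}
    (h : ∀ x : M, ∃ u : E8 ≃L[ℝ] TangentSpace 𝓘(ℝ, E8) x,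
      (∀ v w : E8, g.inner x (u v) (u w) = inner ℝ v w) ∧
      (∀ v : Fin 4 → E8, Φ x (fun i => u (v i)) = stdCayley τ v) ∧
      (∀ v w : E8, κ x ![u v, u w] = stdKahler v w)) : κ.IsSmooth := by
  intro e he
  refine contDiffOn_continuousAlternatingMap fun v => ?_
  have hG := metricInChart_contDiffOn g he
  have hinv : ∀ a i : Fin 8, ContDiffOn ℝ ∞
      (fun y => (metricInChart g e y).inverse (EuclideanSpace.proj a) i) e.target := by
    intro a i
    have h1 : ContDiffOn ℝ ∞ (fun y => (metricInChart g e y).inverse) e.target := fun y hy =>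
      ((metricInChart_isInvertible g he hy).contDiffAt_map_inverse).comp_contDiffWithinAt y (hG y hy)
    exact (EuclideanSpace.proj (𝕜 := ℝ) i).contDiff.comp_contDiffOn
      (h1.clm_apply contDiffOn_const)
  have hφ : ∀ w : Fin 4 → E8, ContDiffOn ℝ ∞ (fun y => Φ.inChart e y w) e.target := fun w =>
    (ContinuousAlternatingMap.apply ℝ E8 ℂ w).contDiff.comp_contDiffOn (hΦ e he)
  have hre : ∀ w : Fin 4 → E8, ContDiffOn ℝ ∞ (fun y => (Φ.inChart e y w).re) e.target := fun w =>
    Complex.reCLM.contDiff.comp_contDiffOn (hφ w)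
  have him : ∀ w : Fin 4 → E8, ContDiffOn ℝ ∞ (fun y => (Φ.inChart e y w).im) e.target := fun w =>
    Complex.imCLM.contDiff.comp_contDiffOn (hφ w)
  refine ContDiffOn.congr (f := fun y => (24 * Real.cosh (2 * τ) * Real.sinh (2 * τ))⁻¹ *
      ∑ a, ∑ i, (metricInChart g e y).inverse (EuclideanSpace.proj a) i *
      ∑ b, ∑ j, (metricInChart g e y).inverse (EuclideanSpace.proj b) j *
      ∑ c, ∑ k, (metricInChart g e y).inverse (EuclideanSpace.proj c) k *
      ((Φ.inChart e y ![v 0, EuclideanSpace.single a 1, EuclideanSpace.single b 1,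
        EuclideanSpace.single c 1]).re *
      (Φ.inChart e y ![v 1, EuclideanSpace.single i 1, EuclideanSpace.single j 1,
        EuclideanSpace.single k 1]).im)) ?_ ?_
  · refine contDiffOn_const.mul (ContDiffOn.sum fun a _ => ContDiffOn.sum fun i _ =>
      (hinv a i).mul (ContDiffOn.sum fun b _ => ContDiffOn.sum fun j _ =>
      (hinv b j).mul (ContDiffOn.sum fun c _ => ContDiffOn.sum fun k _ =>
      (hinv c k).mul ((hre _).mul (him _)))))
  · intro y hy
    obtain ⟨u, hu, huΦ, huκ⟩ := h (e.symm y)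
    obtain ⟨U, hU⟩ := exists_chart_frame he hy u
    have h1 := kahler_eq_contraction hτ (metricInChart_isInvertible g he hy)
      (φ := Φ.inChart e y) U
      (fun v w => by rw [metricInChart_apply, hU, hU, hu])
      (fun v => by rw [← huΦ]; exact congrArg (Φ (e.symm y)) (funext fun i => hU (v i)))
      (v 0) (v 1)
    rw [← h1, ← huκ, ← hU, ← hU, ← DiffForm.inChart_vec2]
    congr 1
    ext i : 1
    fin_cases i <;> simp

/-- Since cosh 2τ and sinh 2τ are nonzero, the formula can be solved for Re Ω and Im Ω. -/
theorem omega_isSmooth_of_formula (hτ : τ ≠ 0) (hΦ : Φ.IsSmooth) {κ : DiffForm M 2 ℝ}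
    (hκ : κ.IsSmooth) {Ω : DiffForm M 4 ℂ}
    (h : ∀ (x : M) (v : Fin 4 → TangentSpace 𝓘(ℝ, E8) x),
      Φ x v = ((Real.cosh (2 * τ) * (Ω x v).re
        - (1 / 2) * κ.wedgeTwo κ x v : ℝ) : ℂ)
      + Complex.I * ((Real.sinh (2 * τ) * (Ω x v).im : ℝ) : ℂ)) : Ω.IsSmooth := by
  have hs : Real.sinh (2 * τ) ≠ 0 := Real.sinh_ne_zero.2 (by simpa using hτ)
  have hc : Real.cosh (2 * τ) ≠ 0 := (Real.cosh_pos _).ne'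
  intro e he
  refine contDiffOn_continuousAlternatingMap fun v => ?_
  have hφ : ∀ w : Fin 4 → E8, ContDiffOn ℝ ∞ (fun y => Φ.inChart e y w) e.target := fun w =>
    (ContinuousAlternatingMap.apply ℝ E8 ℂ w).contDiff.comp_contDiffOn (hΦ e he)
  have hk : ∀ a b : E8, ContDiffOn ℝ ∞ (fun y => κ.inChart e y ![a, b]) e.target := fun a b =>
    (ContinuousAlternatingMap.apply ℝ E8 ℝ ![a, b]).contDiff.comp_contDiffOn (hκ e he)
  have hre := Complex.reCLM.contDiff.comp_contDiffOn (hφ v)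
  have him := Complex.imCLM.contDiff.comp_contDiffOn (hφ v)
  have hre' : ContDiffOn ℝ ∞ (fun y => (Real.cosh (2 * τ))⁻¹ * ((Φ.inChart e y v).re +
      halfWedge (fun a b => κ.inChart e y ![a, b]) (v 0) (v 1) (v 2) (v 3))) e.target :=
    contDiffOn_const.mul (hre.add ((((hk _ _).mul (hk _ _)).sub ((hk _ _).mul (hk _ _))).add
      ((hk _ _).mul (hk _ _))))
  have him' : ContDiffOn ℝ ∞ (fun y => (Real.sinh (2 * τ))⁻¹ * (Φ.inChart e y v).im) e.target :=
    contDiffOn_const.mul him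
  refine ((Complex.ofRealCLM.contDiff.comp_contDiffOn hre').add
    (contDiffOn_const (c := Complex.I).mul
      (Complex.ofRealCLM.contDiff.comp_contDiffOn him'))).congr fun y hy => ?_
  have h1 := h (e.symm y) (fun i => mfderiv 𝓘(ℝ, E8) 𝓘(ℝ, E8) e.symm y (v i))
  rw [DiffForm.wedgeTwo_self] at h1
  have h2 : Φ.inChart e y v = Φ (e.symm y)
    (fun i => mfderiv 𝓘(ℝ, E8) 𝓘(ℝ, E8) e.symm y (v i)) := rfl
  have h3 : Ω.inChart e y v = Ω (e.symm y)
    (fun i => mfderiv 𝓘(ℝ, E8) 𝓘(ℝ, E8) e.symm y (v i)) := rfl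
  have hri : ∀ A B : ℝ, ((A : ℂ) + Complex.I * (B : ℂ)).re = A ∧
      ((A : ℂ) + Complex.I * (B : ℂ)).im = B := fun A B => by simp
  have h4 : halfWedge (fun a b => κ.inChart e y ![a, b]) (v 0) (v 1) (v 2) (v 3) =
      halfWedge (fun a b => κ (e.symm y) ![a, b]) (mfderiv 𝓘(ℝ, E8) 𝓘(ℝ, E8) e.symm y (v 0))
        (mfderiv 𝓘(ℝ, E8) 𝓘(ℝ, E8) e.symm y (v 1)) (mfderiv 𝓘(ℝ, E8) 𝓘(ℝ, E8) e.symm y (v 2))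
        (mfderiv 𝓘(ℝ, E8) 𝓘(ℝ, E8) e.symm y (v 3)) := by
    simp only [halfWedge, DiffForm.inChart_vec2]
  rw [← h2, ← h3, ← h4] at h1
  have h5 := congrArg Complex.re h1
  have h6 := congrArg Complex.im h1
  rw [(hri _ _).1] at h5
  rw [(hri _ _).2] at h6
  apply Complex.ext
  · refine Eq.trans ?_ (hri _ _).1.symm
    change _ = (Real.cosh (2 * τ))⁻¹ * ((Φ.inChart e y v).re +
      halfWedge (fun a b => κ.inChart e y ![a, b]) (v 0) (v 1) (v 2) (v 3))
    rw [h5]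
    field_simp
    ring
  · refine Eq.trans ?_ (hri _ _).2.symm
    change _ = (Real.sinh (2 * τ))⁻¹ * (Φ.inChart e y v).im
    rw [h6]
    field_simp

theorem stdCayley_eq_of_frame {x : M} {κ : DiffForm M 2 ℝ} {Ω : DiffForm M 4 ℂ}
    {u : E8 ≃L[ℝ] TangentSpace 𝓘(ℝ, E8) x}
    (hκ : ∀ v w : E8, κ x ![u v, u w] = stdKahler v w)
    (hΩ : ∀ v : Fin 4 → E8, Ω x (fun i => u (v i)) = stdOmega v) (v : Fin 4 → E8) :
    ((Real.cosh (2 * τ) * (Ω x (fun i => u (v i))).re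
        - (1 / 2) * κ.wedgeTwo κ x (fun i => u (v i)) : ℝ) : ℂ)
      + Complex.I * ((Real.sinh (2 * τ) * (Ω x (fun i => u (v i))).im : ℝ) : ℂ) =
      stdCayley τ v := by
  rw [DiffForm.wedgeTwo_self, stdCayley, hΩ]
  simp only [halfWedge, hκ]
  congr 3
  ring

theorem SU4Structure.exists_isDefinedBy (hτ : τ ≠ 0) (h : IsComplexCayleyForm τ Φ) :
    ∃ S : SU4Structure M, S.IsDefinedBy τ Φ := by
  obtain ⟨g, hg⟩ := h.exists_hasCayleyFrames hτ
  choose u hu huΦ using hg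
  let κ : DiffForm M 2 ℝ := fun x =>
    stdKahlerAlt.compContinuousLinearMap ((u x).symm : TangentSpace 𝓘(ℝ, E8) x →L[ℝ] E8)
  let Ω : DiffForm M 4 ℂ := fun x =>
    stdOmegaAlt.compContinuousLinearMap ((u x).symm : TangentSpace 𝓘(ℝ, E8) x →L[ℝ] E8)
  have hκ : ∀ x (v w : E8), κ x ![u x v, u x w] = stdKahler v w := fun x v w => by
    change stdKahler ((u x).symm (u x v)) ((u x).symm (u x w)) = _
    simp
  have hΩ : ∀ x (v : Fin 4 → E8), Ω x (fun i => u x (v i)) = stdOmega v := fun x v => by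
    change stdOmega (fun i => (u x).symm (u x (v i))) = _
    simp
  have hdef : ∀ (x : M) (v : Fin 4 → TangentSpace 𝓘(ℝ, E8) x),
      Φ x v = ((Real.cosh (2 * τ) * (Ω x v).re
        - (1 / 2) * κ.wedgeTwo κ x v : ℝ) : ℂ)
      + Complex.I * ((Real.sinh (2 * τ) * (Ω x v).im : ℝ) : ℂ) := by
    intro x v
    have h1 := stdCayley_eq_of_frame (τ := τ) (hκ x) (hΩ x) (fun i => (u x).symm (v i))
    have hv : (fun i => u x ((u x).symm (v i))) = v := by simp
    rw [← huΦ x, hv] at h1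
    exact h1.symm
  have hκs := kahler_isSmooth_of_frames hτ h.1 fun x => ⟨u x, hu x, huΦ x, hκ x⟩
  exact ⟨⟨g, κ, Ω, hκs, omega_isSmooth_of_formula hτ h.1 hκs hdef, fun x => ⟨u x, hu x, hκ x, hΩ x⟩⟩,
    hdef⟩

theorem SmoothMetric.ext_inner {g g' : SmoothMetric M} (h : g.inner = g'.inner) : g = g' := by
  cases g
  cases g'
  congr

/-- Adapted frames of the two structures at a point differ by a T that stabilises `stdCayley τ`. So
T lies in SU(4), and the tensors agree. -/
theorem SU4Structure.eq_of_isDefinedBy (hτ : τ ≠ 0) {S S' : SU4Structure M}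
    (h : S.IsDefinedBy τ Φ) (h' : S'.IsDefinedBy τ Φ) : S = S' := by
  have key : ∀ x : M, S.metric.inner x = S'.metric.inner x ∧ S.kahler x = S'.kahler x ∧
      S.omega x = S'.omega x := by
    intro x
    obtain ⟨u, hg, hκ, hΩ⟩ := S.adapted x
    obtain ⟨u', hg', hκ', hΩ'⟩ := S'.adapted x
    have hu : ∀ v : Fin 4 → E8, Φ x (fun i => u (v i)) = stdCayley τ v := fun v =>
      (h x _).trans (stdCayley_eq_of_frame hκ hΩ v)
    have hu' : ∀ v : Fin 4 → E8, Φ x (fun i => u' (v i)) = stdCayley τ v := fun v =>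
      (h' x _).trans (stdCayley_eq_of_frame hκ' hΩ' v)
    let T : E8 ≃ₗ[ℝ] E8 := (u'.trans u.symm).toLinearEquiv
    have hT : ∀ v, u (T v) = u' v := fun v => u.apply_symm_apply (u' v)
    obtain ⟨t1, t2, t3⟩ := stdCayley_stabilizer hτ (T := T) fun v => by
      rw [← hu, ← hu']
      simp only [hT]
    refine ⟨?_, ?_, ?_⟩
    · ext v w
      obtain ⟨v, rfl⟩ := u'.surjective v
      obtain ⟨w, rfl⟩ := u'.surjective w
      rw [hg', ← hT, ← hT, hg, t1]
    · ext v
      have hv : v = ![u' (u'.symm (v 0)), u' (u'.symm (v 1))] := by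
        ext i : 1
        fin_cases i <;> simp
      rw [hv, hκ', ← hT, ← hT, hκ, t2]
    · ext v
      have hv : v = fun i => u' (u'.symm (v i)) := by simp
      rw [hv, hΩ', ← t3, ← hΩ]
      simp only [hT]
  exact SU4Structure.ext (SmoothMetric.ext_inner (funext fun x => (key x).1))
    (funext fun x => (key x).2.1) (funext fun x => (key x).2.2)

end ChartSmoothness

/-! ### Endomorphisms acting on forms as derivations. -/

section InfinitesimalAction

theorem ContinuousAlternatingMap.vec2_add_one (A : E8 [⋀^Fin 2]→L[ℝ] ℝ) (x y b : E8) :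
    A ![x + y, b] = A ![x, b] + A ![y, b] := by
  have e : ∀ z, Function.update ![x, b] 0 z = ![z, b] := fun z => by
    ext i; fin_cases i <;> rfl
  have := A.map_update_add ![x, b] 0 x y
  rwa [e, e, e] at this

theorem ContinuousAlternatingMap.vec2_smul_one (A : E8 [⋀^Fin 2]→L[ℝ] ℝ) (r : ℝ) (x b : E8) :
    A ![r • x, b] = r • A ![x, b] := by
  have e : ∀ z, Function.update ![x, b] 0 z = ![z, b] := fun z => by
    ext i; fin_cases i <;> rfl
  have := A.map_update_smul ![x, b] 0 r x
  rwa [e, e] at this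

variable {k : ℕ} {F : Type*} [NormedAddCommGroup F] [NormedSpace ℝ F]

/-- The action of the endomorphism `A` as a derivation on alternating forms:
`(v₁, …, vₖ) ↦ ∑ᵢ α (v₁, …, A vᵢ, …, vₖ)`. -/
noncomputable def ContinuousAlternatingMap.derivationAction (α : E8 [⋀^Fin k]→L[ℝ] F) :
    (E8 →L[ℝ] E8) →L[ℝ] E8 [⋀^Fin k]→L[ℝ] F :=
  α.fderivCompContinuousLinearMap (.id ℝ E8)

theorem ContinuousAlternatingMap.derivationAction_apply (α : E8 [⋀^Fin k]→L[ℝ] F)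
    (A : E8 →L[ℝ] E8) (v : Fin k → E8) :
    α.derivationAction A v = ∑ i, α (Function.update v i (A (v i))) := by
  rw [derivationAction, fderivCompContinuousLinearMap_apply]
  refine Finset.sum_congr rfl fun i _ => congrArg α ?_
  ext1 j
  rcases eq_or_ne j i with rfl | h
  · simp
  · simp [h]

theorem ContinuousAlternatingMap.derivationAction_vec2 (α : E8 [⋀^Fin 2]→L[ℝ] F)
    (A : E8 →L[ℝ] E8) (a b : E8) :
    α.derivationAction A ![a, b] = α ![A a, b] + α ![a, A b] := by
  rw [derivationAction_apply, Fin.sum_univ_two]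
  congr 2 <;> (ext i : 1; fin_cases i <;> rfl)

theorem ContinuousAlternatingMap.derivationAction_vec4 (α : E8 [⋀^Fin 4]→L[ℝ] F)
    (A : E8 →L[ℝ] E8) (a b c d : E8) :
    α.derivationAction A ![a, b, c, d] = α ![A a, b, c, d] + α ![a, A b, c, d] +
      α ![a, b, A c, d] + α ![a, b, c, A d] := by
  have h0 : ∀ x, Function.update ![a, b, c, d] 0 x = ![x, b, c, d] := fun x => by
    ext i : 1; fin_cases i <;> rfl
  have h1 : ∀ x, Function.update ![a, b, c, d] 1 x = ![a, x, c, d] := fun x => by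
    ext i : 1; fin_cases i <;> rfl
  have h2 : ∀ x, Function.update ![a, b, c, d] 2 x = ![a, b, x, d] := fun x => by
    ext i : 1; fin_cases i <;> rfl
  have h3 : ∀ x, Function.update ![a, b, c, d] 3 x = ![a, b, c, x] := fun x => by
    ext i : 1; fin_cases i <;> rfl
  rw [derivationAction_apply, Fin.sum_univ_four, h0, h1, h2, h3]
  rfl

/-- The Christoffel terms of a torsion-free connection drop out of the exterior derivative, so dα is
the alternation of ∇α. -/
theorem ContinuousAlternatingMap.alternatize_derivationAction (α : E8 [⋀^Fin k]→L[ℝ] F)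
    {Γ : E8 →L[ℝ] E8 →L[ℝ] E8} (hΓ : ∀ v w, Γ v w = Γ w v) :
    alternatizeUncurryFin (α.derivationAction ∘L Γ) = 0 :=
  alternatizeUncurryFin_fderivCompContinuousLinearMap_eq_zero α _ hΓ

theorem ContinuousAlternatingMap.alternatizeUncurryFin_vec5 (T : E8 →L[ℝ] E8 [⋀^Fin 4]→L[ℝ] F)
    (a b c d e : E8) :
    alternatizeUncurryFin T ![a, b, c, d, e] =
      alternatedDeriv (fun v a b c d => T v ![a, b, c, d]) a b c d e := by
  have h0 : Fin.removeNth 0 ![a, b, c, d, e] = ![b, c, d, e] := by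
    ext i : 1; fin_cases i <;> rfl
  have h1 : Fin.removeNth 1 ![a, b, c, d, e] = ![a, c, d, e] := by
    ext i : 1; fin_cases i <;> rfl
  have h2 : Fin.removeNth 2 ![a, b, c, d, e] = ![a, b, d, e] := by
    ext i : 1; fin_cases i <;> rfl
  have h3 : Fin.removeNth 3 ![a, b, c, d, e] = ![a, b, c, e] := by
    ext i : 1; fin_cases i <;> rfl
  have h4 : Fin.removeNth 4 ![a, b, c, d, e] = ![a, b, c, d] := by
    ext i : 1; fin_cases i <;> rfl
  rw [alternatizeUncurryFin_apply, Fin.sum_univ_five, h0, h1, h2, h3, h4, alternatedDeriv]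
  simp [pow_succ, sub_eq_add_neg]

end InfinitesimalAction

/-! ### From closedness to parallel forms, in a standard frame. -/

section ParallelAtPoint

variable {C S : ℝ}

theorem stdOmegaAlt_derivationAction_stdUnitary_re (A : E8 →L[ℝ] E8) :
    (stdOmegaAlt.derivationAction A stdUnitary).re = ∑ i, inner ℝ (stdUnitary i) (A (stdUnitary i)) := by
  rw [ContinuousAlternatingMap.derivationAction_apply, Complex.re_sum]
  exact Finset.sum_congr rfl fun i _ => stdOmega_update_stdUnitary_re i _

/-- If the first derivatives of an `SU(4)` structure are compatible with a torsion-free metric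
connection `Γ` and the associated complex Cayley form is closed, then all forms are parallel. -/
theorem parallel_of_closed_of_standard (hC : C ≠ 0) (hS : S ≠ 0)
    {φ : E8 [⋀^Fin 4]→L[ℝ] ℂ} {Dφ DΩ : E8 →L[ℝ] E8 [⋀^Fin 4]→L[ℝ] ℂ}
    {Dκ : E8 →L[ℝ] E8 [⋀^Fin 2]→L[ℝ] ℝ} {Γ : E8 →L[ℝ] E8 →L[ℝ] E8} {DG : E8 → E8 → E8 → ℝ}
    {DJ : E8 → E8 → E8} (hΓ : ∀ v w, Γ v w = Γ w v)
    (hDG : ∀ v a b, DG v a b = inner ℝ (Γ v a) b + inner ℝ a (Γ v b))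
    (hJ1 : ∀ v a b, DG v (stdJ a) b + inner ℝ (DJ v a) b = Dκ v ![a, b])
    (hJ2 : ∀ v a b, DG v (stdJ a) (stdJ b) + inner ℝ (DJ v a) (stdJ b) +
      inner ℝ (stdJ a) (DJ v b) = DG v a b)
    (hΩ : ∀ v a b c d, DΩ v ![stdJ a, b, c, d] + stdOmega ![DJ v a, b, c, d] =
      Complex.I * DΩ v ![a, b, c, d])
    (hnorm : ∀ v, 2 * (DΩ v stdUnitary).re = ∑ i, DG v (stdUnitary i) (stdUnitary i))
    (hφ : ∀ a b c d, φ ![a, b, c, d] = ((C * (stdOmega ![a, b, c, d]).re -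
      halfWedge stdKahler a b c d : ℝ) : ℂ) + Complex.I * ((S * (stdOmega ![a, b, c, d]).im : ℝ) : ℂ))
    (hDφ : ∀ v a b c d, Dφ v ![a, b, c, d] = ((C * (DΩ v ![a, b, c, d]).re -
      halfWedgePolar stdKahler (fun x y => Dκ v ![x, y]) a b c d : ℝ) : ℂ) +
        Complex.I * ((S * (DΩ v ![a, b, c, d]).im : ℝ) : ℂ))
    (hcl : ContinuousAlternatingMap.alternatizeUncurryFin Dφ = 0) :
    DΩ = stdOmegaAlt.derivationAction ∘L Γ ∧ Dκ = stdKahlerAlt.derivationAction ∘L Γ := by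
  -- Θ and κ' are ∇Ω and ∇ω: the plain derivative minus the action of the Christoffel symbols.
  let Θ := DΩ - stdOmegaAlt.derivationAction ∘L Γ
  let κ' := Dκ - stdKahlerAlt.derivationAction ∘L Γ
  have hΘ : ∀ v a b c d, Θ v ![a, b, c, d] = DΩ v ![a, b, c, d] - (stdOmega ![Γ v a, b, c, d] +
      stdOmega ![a, Γ v b, c, d] + stdOmega ![a, b, Γ v c, d] + stdOmega ![a, b, c, Γ v d]) :=
    fun v a b c d => congrArg (DΩ v ![a, b, c, d] - ·)
      (stdOmegaAlt.derivationAction_vec4 (Γ v) a b c d)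
  have hκ' : ∀ v a b, κ' v ![a, b] = Dκ v ![a, b] - (stdKahler (Γ v a) b + stdKahler a (Γ v b)) :=
    fun v a b => congrArg (Dκ v ![a, b] - ·) (stdKahlerAlt.derivationAction_vec2 (Γ v) a b)
  have hf : ∀ v a b, inner ℝ (DJ v a + Γ v (stdJ a) - stdJ (Γ v a)) b = κ' v ![a, b] :=
    fun v a b => by
      rw [hκ', ← hJ1, hDG, inner_sub_left, inner_add_left, ← inner_stdJ_left, ← inner_stdJ_left]
      ring
  -- N is ∇J. As `DJ` is only a function, bilinearity is drawn from `hf`, by which N is κ' with an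
  -- index raised.
  let N : E8 →ₗ[ℝ] E8 →ₗ[ℝ] E8 := LinearMap.mk₂ ℝ
    (fun v x => DJ v x + Γ v (stdJ x) - stdJ (Γ v x))
    (fun v w x => ext_inner_right ℝ fun b => by
      rw [inner_add_left, hf, hf, hf, map_add, ContinuousAlternatingMap.add_apply])
    (fun r v x => ext_inner_right ℝ fun b => by
      rw [inner_smul_left, hf, hf, map_smul, ContinuousAlternatingMap.smul_apply]; rfl)
    (fun v x y => ext_inner_right ℝ fun b => by
      rw [inner_add_left, hf, hf, hf, ContinuousAlternatingMap.vec2_add_one])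
    (fun r v x => ext_inner_right ℝ fun b => by
      rw [inner_smul_left, hf, hf, ContinuousAlternatingMap.vec2_smul_one]; rfl)
  have hN : ∀ v x, N v x = DJ v x + Γ v (stdJ x) - stdJ (Γ v x) := fun v x => rfl
  have hNκ : ∀ v a b, inner ℝ (N v a) b = κ' v ![a, b] := hf
  have hskew : ∀ v x y, inner ℝ (N v x) y = -inner ℝ x (N v y) := fun v x y => by
    rw [hNκ, real_inner_comm, hNκ, ContinuousAlternatingMap.swap_two]
  -- The covariant derivative of g(Ja, Jb) = g(a, b) is ⟨N a, Jb⟩ + ⟨Ja, N b⟩ = 0, which together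
  -- with skewness says that N anticommutes with J.
  have hNJ : ∀ v x, N v (stdJ x) = -stdJ (N v x) := by
    intro v x
    refine ext_inner_right ℝ fun b => ?_
    have h := hJ2 v x b
    have hDJ : ∀ x, DJ v x = N v x - Γ v (stdJ x) + stdJ (Γ v x) := fun x => by rw [hN]; abel
    rw [hDG, hDG, hDJ, hDJ] at h
    simp only [inner_add_left, inner_add_right, inner_sub_left, inner_sub_right,
      inner_stdJ_stdJ] at h
    have h1 := inner_stdJ_right (N v x) b
    rw [hskew, inner_neg_left]
    linarith
  obtain ⟨hN0, hΘ0⟩ := covariantDerivative_eq_zero_of_closed (N := N) (Θ := Θ.toLinearMap) hC hS hNJ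
    hskew
    (fun v x b c d => by
      simp only [ContinuousLinearMap.coe_coe, hΘ]
      have h := hΩ v x b c d
      have lin : ∀ p q r : E8, stdOmega ![p + q - r, b, c, d] =
          stdOmega ![p, b, c, d] + stdOmega ![q, b, c, d] - stdOmega ![r, b, c, d] := fun p q r => by
        have h1 := stdOmegaAlt.vec4_add_one (p + q - r) r b c d
        have h2 := stdOmegaAlt.vec4_add_one p q b c d
        rw [sub_add_cancel, h2] at h1
        simp only [stdOmegaAlt_apply] at h1
        linear_combination -h1
      rw [hN, lin]
      simp only [stdOmega_stdJ_one]
      linear_combination h)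
    (fun v => by
      have h1 : Θ v stdUnitary = DΩ v stdUnitary - stdOmegaAlt.derivationAction (Γ v) stdUnitary := rfl
      have h2 := hnorm v
      simp only [hDG] at h2
      rw [ContinuousLinearMap.coe_coe, h1, Complex.sub_re, stdOmegaAlt_derivationAction_stdUnitary_re]
      have h3 : ∀ i, inner ℝ (Γ v (stdUnitary i)) (stdUnitary i) =
        (inner ℝ (stdUnitary i) (Γ v (stdUnitary i)) : ℝ) := fun i => real_inner_comm _ _
      simp only [h3, Finset.sum_add_distrib] at h2
      linarith)
    (by
      intro a b c d e
      -- As Γ is symmetric, closedness may be stated with ∇Φ in place of the plain derivative of Φ.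
      have hΨ : ContinuousAlternatingMap.alternatizeUncurryFin (Dφ - φ.derivationAction ∘L Γ) = 0 := by
        have h1 := map_sub (ContinuousAlternatingMap.alternatizeUncurryFinCLM ℝ E8 ℂ) Dφ
          (φ.derivationAction ∘L Γ)
        simp only [ContinuousAlternatingMap.alternatizeUncurryFinCLM_apply] at h1
        rw [h1, hcl, φ.alternatize_derivationAction hΓ, sub_zero]
      have h := congrArg (fun T => T ![a, b, c, d, e]) hΨ
      simp only [ContinuousAlternatingMap.alternatizeUncurryFin_vec5] at h
      refine Eq.trans ?_ h
      congr 1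
      ext v a b c d
      have h1 : (Dφ - φ.derivationAction ∘L Γ) v ![a, b, c, d] = Dφ v ![a, b, c, d] -
        (φ ![Γ v a, b, c, d] + φ ![a, Γ v b, c, d] + φ ![a, b, Γ v c, d] + φ ![a, b, c, Γ v d]) :=
        congrArg (Dφ v ![a, b, c, d] - ·) (φ.derivationAction_vec4 (Γ v) a b c d)
      rw [h1, hDφ]
      simp only [hφ, hNκ, ContinuousLinearMap.coe_coe, hΘ, halfWedgePolar, halfWedge, hκ']
      simp only [Complex.sub_re, Complex.add_re, Complex.sub_im, Complex.add_im]
      push_cast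
      ring)
  have hκ0 : κ' = 0 := by
    ext v w
    have hw : w = ![w 0, w 1] := by ext i : 1; fin_cases i <;> rfl
    rw [hw, ← hNκ, hN0]
    simp
  refine ⟨?_, sub_eq_zero.1 hκ0⟩
  rw [← sub_eq_zero]
  ext v : 1
  exact congrArg (fun T : E8 →ₗ[ℝ] E8 [⋀^Fin 4]→L[ℝ] ℂ => T v) hΘ0

end ParallelAtPoint

/-! ### Derivative formulas and identities in an adapted frame. -/

section LocalComputation

variable {k : ℕ} {F : Type*} [NormedAddCommGroup F] [NormedSpace ℝ F]

theorem hasFDerivAt_continuousAlternatingMap_const {f : E8 → E8 [⋀^Fin k]→L[ℝ] F} {y : E8}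
    (hf : DifferentiableAt ℝ f y) (w : Fin k → E8) :
    HasFDerivAt (fun y => f y w) (ContinuousAlternatingMap.apply ℝ E8 F w ∘L fderiv ℝ f y) y :=
  (ContinuousAlternatingMap.apply ℝ E8 F w).hasFDerivAt.comp y hf.hasFDerivAt

theorem fderiv_cayley {C S : ℝ} {κ : E8 → E8 [⋀^Fin 2]→L[ℝ] ℝ} {Ω φ : E8 → E8 [⋀^Fin 4]→L[ℝ] ℂ}
    {y : E8} (hκ : DifferentiableAt ℝ κ y) (hΩ : DifferentiableAt ℝ Ω y)
    (hφ : DifferentiableAt ℝ φ y)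
    (h : ∀ᶠ z in nhds y, ∀ a b c d, φ z ![a, b, c, d] = ((C * (Ω z ![a, b, c, d]).re -
      halfWedge (fun a b => κ z ![a, b]) a b c d : ℝ) : ℂ) +
        Complex.I * ((S * (Ω z ![a, b, c, d]).im : ℝ) : ℂ)) (v a b c d : E8) :
    fderiv ℝ φ y v ![a, b, c, d] = ((C * (fderiv ℝ Ω y v ![a, b, c, d]).re -
      halfWedgePolar (fun a b => κ y ![a, b]) (fun a b => fderiv ℝ κ y v ![a, b]) a b c d : ℝ) : ℂ) +
        Complex.I * ((S * (fderiv ℝ Ω y v ![a, b, c, d]).im : ℝ) : ℂ) := by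
  have h1 := hasFDerivAt_continuousAlternatingMap_const hφ ![a, b, c, d]
  have h2 := hasFDerivAt_continuousAlternatingMap_const hΩ ![a, b, c, d]
  have hk := fun a b => hasFDerivAt_continuousAlternatingMap_const hκ ![a, b]
  have hre := (Complex.reCLM.hasFDerivAt.comp y h2).const_mul C
  have him := (Complex.imCLM.hasFDerivAt.comp y h2).const_mul S
  have hw := (((hk a b).mul (hk c d)).sub ((hk a c).mul (hk b d))).add ((hk a d).mul (hk b c))
  have h3 := (Complex.ofRealCLM.hasFDerivAt.comp y (hre.sub hw)).add
    ((Complex.ofRealCLM.hasFDerivAt.comp y him).const_mul Complex.I)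
  have h4 := h1.unique (h3.congr_of_eventuallyEq (h.mono fun z hz => hz a b c d))
  have h5 := congrArg (fun T => T v) h4
  refine Eq.trans h5 ?_
  simp [halfWedgePolar]
  ring

/-- A permutation other than 1 moves at least two indices, so at the identity matrix its product
still has a zero factor after one factor is differentiated. Only the trace survives. -/
theorem hasFDerivAt_det_of_eq_one {A : E8 → Matrix (Fin 4) (Fin 4) ℂ} {y : E8}
    {A' : Fin 4 → Fin 4 → E8 →L[ℝ] ℂ} (h : ∀ i j, HasFDerivAt (fun z => A z i j) (A' i j) y)
    (h1 : A y = 1) : HasFDerivAt (fun z => (A z).det) (∑ i, A' i i) y := by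
  have h2 : ∀ σ : Equiv.Perm (Fin 4), HasFDerivAt (fun z => ∏ i, A z (σ i) i)
      (∑ i, (∏ j ∈ Finset.univ.erase i, A y (σ j) j) • A' (σ i) i) y := fun σ =>
    HasFDerivAt.finsetProd fun i _ => h (σ i) i
  have h3 := HasFDerivAt.fun_sum fun (σ : Equiv.Perm (Fin 4)) (_ : σ ∈ Finset.univ) =>
    (h2 σ).const_mul ((Equiv.Perm.sign σ : ℤ) : ℂ)
  have h4 : ∀ σ : Equiv.Perm (Fin 4), σ ≠ 1 → ∀ i,
      ∏ j ∈ Finset.univ.erase i, A y (σ j) j = 0 := by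
    intro σ hσ i
    by_contra hne
    apply hσ
    have h5 : ∀ j, j ≠ i → σ j = j := fun j hj => by
      by_contra hj'
      refine hne (Finset.prod_eq_zero (Finset.mem_erase.2 ⟨hj, Finset.mem_univ j⟩) ?_)
      rw [h1, Matrix.one_apply_ne hj']
    ext1 j
    rcases eq_or_ne j i with rfl | hj
    · by_contra hj'
      exact hj' (σ.injective (h5 (σ j) hj'))
    · exact h5 j hj
  have h6 : ∑ σ : Equiv.Perm (Fin 4), ((Equiv.Perm.sign σ : ℤ) : ℂ) •
      ∑ i, (∏ j ∈ Finset.univ.erase i, A y (σ j) j) • A' (σ i) i = ∑ i, A' i i := by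
    rw [Finset.sum_eq_single 1]
    · simp [h1]
    · intro σ _ hσ
      rw [Finset.sum_eq_zero, smul_zero]
      intro i _
      rw [h4 σ hσ i]
      ext v
      exact zero_mul _
    · simp
  rw [h6] at h3
  refine h3.congr_of_eventuallyEq (Filter.Eventually.of_forall fun z => ?_)
  simp [Matrix.det_apply']

/-- The right-hand matrix is the Hermitian Gram matrix `Bᴴ B`, where the columns of `B` are the
vectors in complex coordinates. Being free of frames, the identity can be differentiated; it
supplies the normalisation that makes θ imaginary. -/
theorem normSq_stdOmega (v : Fin 4 → E8) :
    ((Complex.normSq (stdOmega v) : ℝ) : ℂ) = Matrix.det (Matrix.of fun i j =>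
      ((inner ℝ (v i) (v j) : ℝ) : ℂ) + Complex.I * (stdKahler (v i) (v j) : ℝ)) := by
  let B : Matrix (Fin 4) (Fin 4) ℂ := Matrix.of fun a b => stdComplexCoord (v b) a
  have h1 : (Matrix.of fun i j => ((inner ℝ (v i) (v j) : ℝ) : ℂ) +
      Complex.I * (stdKahler (v i) (v j) : ℝ)) = Bᴴ * B := by
    ext i j
    rw [Matrix.of_apply, ← inner_stdComplexEquiv, Matrix.mul_apply, PiLp.inner_apply]
    refine Finset.sum_congr rfl fun a _ => ?_
    rw [Matrix.conjTranspose_apply, mul_comm]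
    rfl
  rw [h1, Matrix.det_mul, Matrix.det_conjTranspose, Complex.normSq_eq_conj_mul_self]
  rfl

/-- The tensors `G`, `κ`, `Ω` are standard in the frame `U`. -/
structure IsAdaptedFrame (G : E8 →L[ℝ] E8 →L[ℝ] ℝ) (κ : E8 [⋀^Fin 2]→L[ℝ] ℝ)
    (Ω : E8 [⋀^Fin 4]→L[ℝ] ℂ) (U : E8 ≃L[ℝ] E8) : Prop where
  metric : ∀ v w, G (U v) (U w) = inner ℝ v w
  kahler : ∀ v w, κ ![U v, U w] = stdKahler v w
  omega : ∀ v : Fin 4 → E8, Ω (fun i => U (v i)) = stdOmega v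

/-- The almost complex structure determined by a metric and a two-form. -/
noncomputable def complexStructureOf (G : E8 →L[ℝ] E8 →L[ℝ] ℝ) (κ : E8 [⋀^Fin 2]→L[ℝ] ℝ)
    (x : E8) : E8 :=
  ∑ a, κ ![x, EuclideanSpace.single a 1] • G.inverse (EuclideanSpace.proj a)

section Frame

variable {G : E8 →L[ℝ] E8 →L[ℝ] ℝ} {κ : E8 [⋀^Fin 2]→L[ℝ] ℝ} {Ω : E8 [⋀^Fin 4]→L[ℝ] ℂ}
  {U : E8 ≃L[ℝ] E8}

theorem IsAdaptedFrame.isInvertible (hU : IsAdaptedFrame G κ Ω U) : G.IsInvertible := by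
  have hinj : Function.Injective G := by
    rw [injective_iff_map_eq_zero]
    intro v hv
    obtain ⟨v, rfl⟩ := U.surjective v
    have h := hU.metric v v
    rw [hv, ContinuousLinearMap.zero_apply, eq_comm, inner_self_eq_zero] at h
    rw [h, map_zero]
  have hd : Module.finrank ℝ E8 = Module.finrank ℝ (E8 →L[ℝ] ℝ) :=
    (InnerProductSpace.toDual ℝ E8).toLinearEquiv.finrank_eq
  let L : E8 ≃ₗ[ℝ] (E8 →L[ℝ] ℝ) := LinearEquiv.ofInjectiveOfFinrankEq G.toLinearMap hinj hd
  exact ⟨L.toContinuousLinearEquiv, by ext; rfl⟩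

theorem IsAdaptedFrame.complexStructureOf_apply (hU : IsAdaptedFrame G κ Ω U) (x : E8) :
    complexStructureOf G κ (U x) = U (stdJ x) := by
  have hG := hU.isInvertible
  refine hG.injective ?_
  ext1 z
  have hlin : ∀ x : E8, ∑ a, κ ![x, EuclideanSpace.single a 1] * z a = κ ![x, z] := fun x => by
    have h1 : ∀ w, κ ![x, w] = -κ.toMultilinearMap.toLinearMap ![0, x] 0 w := fun w => by
      rw [ContinuousAlternatingMap.swap_two]
      exact congrArg (fun t => -κ t) (by ext i : 1; fin_cases i <;> rfl)
    have h2 := congrArg (κ.toMultilinearMap.toLinearMap ![0, x] 0)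
      ((EuclideanSpace.basisFun (Fin 8) ℝ).sum_repr z)
    simp only [map_sum, map_smul, EuclideanSpace.basisFun_apply, EuclideanSpace.basisFun_repr,
      smul_eq_mul] at h2
    simp only [h1, ← h2, ← Finset.sum_neg_distrib]
    exact Finset.sum_congr rfl fun a _ => by ring
  have h1 : G (complexStructureOf G κ (U x)) z = κ ![U x, z] := by
    rw [← hlin]
    simp [complexStructureOf, hG.self_apply_inverse]
  obtain ⟨z, rfl⟩ := U.surjective z
  rw [h1, hU.metric, hU.kahler, inner_stdJ_left]

theorem IsAdaptedFrame.metric_complexStructureOf (hU : IsAdaptedFrame G κ Ω U) (x z : E8) :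
    G (complexStructureOf G κ x) z = κ ![x, z] := by
  obtain ⟨x, rfl⟩ := U.surjective x
  obtain ⟨z, rfl⟩ := U.surjective z
  rw [hU.complexStructureOf_apply, hU.metric, hU.kahler, inner_stdJ_left]

theorem IsAdaptedFrame.metric_complexStructureOf_both (hU : IsAdaptedFrame G κ Ω U) (x z : E8) :
    G (complexStructureOf G κ x) (complexStructureOf G κ z) = G x z := by
  obtain ⟨x, rfl⟩ := U.surjective x
  obtain ⟨z, rfl⟩ := U.surjective z
  rw [hU.complexStructureOf_apply, hU.complexStructureOf_apply, hU.metric, hU.metric,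
    inner_stdJ_stdJ]

theorem IsAdaptedFrame.omega_vec4 (hU : IsAdaptedFrame G κ Ω U) (a b c d : E8) :
    Ω ![U a, U b, U c, U d] = stdOmega ![a, b, c, d] := by
  rw [← hU.omega]
  exact congrArg Ω (by ext i : 1; fin_cases i <;> rfl)

theorem IsAdaptedFrame.omega_complexStructureOf (hU : IsAdaptedFrame G κ Ω U) (a b c d : E8) :
    Ω ![complexStructureOf G κ a, b, c, d] = Complex.I * Ω ![a, b, c, d] := by
  obtain ⟨a, rfl⟩ := U.surjective a
  obtain ⟨b, rfl⟩ := U.surjective b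
  obtain ⟨c, rfl⟩ := U.surjective c
  obtain ⟨d, rfl⟩ := U.surjective d
  rw [hU.complexStructureOf_apply, hU.omega_vec4, hU.omega_vec4, stdOmega_stdJ_one]

theorem IsAdaptedFrame.normSq_omega (hU : IsAdaptedFrame G κ Ω U) (v : Fin 4 → E8) :
    ((Complex.normSq (Ω v) : ℝ) : ℂ) = Matrix.det (Matrix.of fun i j =>
      ((G (v i) (v j) : ℝ) : ℂ) + Complex.I * (κ ![v i, v j] : ℝ)) := by
  obtain ⟨w, rfl⟩ : ∃ w : Fin 4 → E8, v = fun i => U (w i) :=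
    ⟨fun i => U.symm (v i), by simp⟩
  simp only [hU.omega, hU.metric, hU.kahler, normSq_stdOmega]

theorem IsAdaptedFrame.omega_eq (hU : IsAdaptedFrame G κ Ω U) : Ω = stdOmegaAlt.compContinuousLinearMap (U.symm : E8 →L[ℝ] E8) := by
  ext v
  have h := hU.omega fun i => U.symm (v i)
  simp only [ContinuousLinearEquiv.apply_symm_apply] at h
  exact h

theorem IsAdaptedFrame.kahler_eq (hU : IsAdaptedFrame G κ Ω U) :
    κ = stdKahlerAlt.compContinuousLinearMap (U.symm : E8 →L[ℝ] E8) := by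
  ext v
  have h := hU.kahler (U.symm (v 0)) (U.symm (v 1))
  simp only [ContinuousLinearEquiv.apply_symm_apply] at h
  refine Eq.trans (congrArg κ ?_) h
  ext i : 1; fin_cases i <;> rfl

end Frame

end LocalComputation

/-! ### First derivatives of the tensors of an SU(4) structure. -/

section LocalParallel

theorem complexStructureOf_differentiableAt {G : E8 → E8 →L[ℝ] E8 →L[ℝ] ℝ}
    {κ : E8 → E8 [⋀^Fin 2]→L[ℝ] ℝ} {y : E8} (hG : DifferentiableAt ℝ G y)
    (hκ : DifferentiableAt ℝ κ y) (hGi : (G y).IsInvertible) (x : E8) :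
    DifferentiableAt ℝ (fun z => complexStructureOf (G z) (κ z) x) y := by
  refine DifferentiableAt.fun_sum fun a _ => DifferentiableAt.fun_smul ?_ ?_
  · exact (hasFDerivAt_continuousAlternatingMap_const hκ _).differentiableAt
  · have h1 : DifferentiableAt ℝ (fun z => (G z).inverse) y :=
      ((hGi.contDiffAt_map_inverse (n := 1)).differentiableAt one_ne_zero).comp y hG
    exact h1.clm_apply (differentiableAt_const _)

/-- Relations between the first derivatives of the tensors of an `SU(4)` structure. -/
theorem firstDerivative_relations {G : E8 → E8 →L[ℝ] E8 →L[ℝ] ℝ}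
    {κ : E8 → E8 [⋀^Fin 2]→L[ℝ] ℝ} {Ω : E8 → E8 [⋀^Fin 4]→L[ℝ] ℂ} {y : E8}
    (hG : DifferentiableAt ℝ G y) (hκ : DifferentiableAt ℝ κ y) (hΩ : DifferentiableAt ℝ Ω y)
    (h : ∀ᶠ z in nhds y, ∃ U, IsAdaptedFrame (G z) (κ z) (Ω z) U) {J : E8 → E8 → E8}
    (hJ : J = fun z => complexStructureOf (G z) (κ z)) (v : E8) :
    (∀ a b, fderiv ℝ G y v (J y a) b + G y (fderiv ℝ (fun z => J z a) y v) b =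
      fderiv ℝ κ y v ![a, b]) ∧
    (∀ a b, fderiv ℝ G y v (J y a) (J y b) + G y (fderiv ℝ (fun z => J z a) y v) (J y b) +
      G y (J y a) (fderiv ℝ (fun z => J z b) y v) = fderiv ℝ G y v a b) ∧
    (∀ a b c d, fderiv ℝ Ω y v ![J y a, b, c, d] +
      Ω y ![fderiv ℝ (fun z => J z a) y v, b, c, d] = Complex.I * fderiv ℝ Ω y v ![a, b, c, d]) ∧
    (∀ U, IsAdaptedFrame (G y) (κ y) (Ω y) U →
      2 * (fderiv ℝ Ω y v (fun i => U (stdUnitary i))).re =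
        ∑ i, fderiv ℝ G y v (U (stdUnitary i)) (U (stdUnitary i))) := by
  obtain ⟨U₀, hU₀⟩ := h.self_of_nhds
  have hJd : ∀ a, HasFDerivAt (fun z => J z a) (fderiv ℝ (fun z => J z a) y) y := fun a => by
    rw [hJ]
    exact (complexStructureOf_differentiableAt hG hκ hU₀.isInvertible a).hasFDerivAt
  have hGd : ∀ {p q : E8 → E8} {p' q' : E8 →L[ℝ] E8}, HasFDerivAt p p' y → HasFDerivAt q q' y →
      ∀ v, fderiv ℝ (fun z => G z (p z) (q z)) y v =
        fderiv ℝ G y v (p y) (q y) + G y (p' v) (q y) + G y (p y) (q' v) := by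
    intro p q p' q' hp hq v
    rw [((hG.hasFDerivAt.clm_apply hp).clm_apply hq).fderiv]
    simp only [ContinuousLinearMap.add_apply, ContinuousLinearMap.comp_apply,
      ContinuousLinearMap.flip_apply]
    ring
  refine ⟨fun a b => ?_, fun a b => ?_, fun a b c d => ?_, fun U hU => ?_⟩
  · have h1 : (fun z => G z (J z a) b) =ᶠ[nhds y] fun z => κ z ![a, b] := by
      filter_upwards [h] with z ⟨U, hU⟩
      rw [hJ]
      exact hU.metric_complexStructureOf a b
    have h2 := congrArg (fun T : E8 →L[ℝ] ℝ => T v) (h1.fderiv_eq (𝕜 := ℝ))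
    simp only [hGd (hJd a) (hasFDerivAt_const b y),
      (hasFDerivAt_continuousAlternatingMap_const hκ ![a, b]).fderiv] at h2
    simpa using h2
  · have h1 : (fun z => G z (J z a) (J z b)) =ᶠ[nhds y] fun z => G z a b := by
      filter_upwards [h] with z ⟨U, hU⟩
      rw [hJ]
      exact hU.metric_complexStructureOf_both a b
    have h2 := congrArg (fun T : E8 →L[ℝ] ℝ => T v) (h1.fderiv_eq (𝕜 := ℝ))
    simp only [hGd (hJd a) (hJd b), hGd (hasFDerivAt_const a y) (hasFDerivAt_const b y)] at h2
    simpa using h2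
  · have h1 : (fun z => Ω z ![J z a, b, c, d]) =ᶠ[nhds y]
        fun z => Complex.I * Ω z ![a, b, c, d] := by
      filter_upwards [h] with z ⟨U, hU⟩
      rw [hJ]
      exact hU.omega_complexStructureOf a b c d
    have h2 := congrArg (fun T : E8 →L[ℝ] ℂ => T v) (h1.fderiv_eq (𝕜 := ℝ))
    let q : Fin 4 → E8 → E8 := ![fun z => J z a, fun _ => b, fun _ => c, fun _ => d]
    have hq : ∀ z, (fun i => q i z) = ![J z a, b, c, d] := fun z => by
      ext i : 1; fin_cases i <;> rfl
    have hqd : ∀ i, DifferentiableAt ℝ (q i) y := fun i => by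
      fin_cases i
      · exact (hJd a).differentiableAt
      · exact differentiableAt_const _
      · exact differentiableAt_const _
      · exact differentiableAt_const _
    have h3 := fderiv_continuousAlternatingMap_apply_apply hΩ hqd v
    have u0 : ∀ x, Function.update ![J y a, b, c, d] 0 x = ![x, b, c, d] := fun x => by
      ext i : 1; fin_cases i <;> rfl
    have hz : ∀ i : Fin 4, Ω y (Function.update ![J y a, b, c, d] i 0) = 0 := fun i =>
      (Ω y).map_coord_zero i (by simp)
    have f1 : fderiv ℝ (q 1) y v = 0 := by simp [q]
    have f2 : fderiv ℝ (q 2) y v = 0 := by simp [q]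
    have f3 : fderiv ℝ (q 3) y v = 0 := by simp [q]
    simp only [hq, Fin.sum_univ_four, f1, f2, f3, hz, u0, add_zero] at h3
    rw [h3, ((hasFDerivAt_continuousAlternatingMap_const hΩ
      ![a, b, c, d]).const_mul Complex.I).fderiv] at h2
    exact h2
  · let w : Fin 4 → E8 := fun i => U (stdUnitary i)
    -- At y the Gram matrix of w is the identity and Ω takes the value 1 on w. Differentiating
    -- |Ω(w)|² = det A thus gives 2 Re DΩ on the left and the trace of DA on the right.
    let A : E8 → Matrix (Fin 4) (Fin 4) ℂ := fun z => Matrix.of fun i j =>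
      ((G z (w i) (w j) : ℝ) : ℂ) + Complex.I * (κ z ![w i, w j] : ℝ)
    have hA : ∀ i j, HasFDerivAt (fun z => A z i j)
        (Complex.ofRealCLM ∘L ((fderiv ℝ G y).flip (w i)).flip (w j) +
          Complex.I • (Complex.ofRealCLM ∘L
            (ContinuousAlternatingMap.apply ℝ E8 ℝ ![w i, w j] ∘L fderiv ℝ κ y))) y := by
      intro i j
      refine HasFDerivAt.add ?_ (HasFDerivAt.const_mul ?_ Complex.I)
      · refine Complex.ofRealCLM.hasFDerivAt.comp y ?_
        have h1 := (hG.hasFDerivAt.clm_apply (hasFDerivAt_const (w i) y)).clm_apply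
          (hasFDerivAt_const (w j) y)
        refine h1.congr_fderiv ?_
        ext v
        simp
      · exact Complex.ofRealCLM.hasFDerivAt.comp y
          (hasFDerivAt_continuousAlternatingMap_const hκ _)
    have hA1 : A y = 1 := by
      ext i j
      simp only [A, Matrix.of_apply, w, hU.metric, hU.kahler]
      fin_cases i <;> fin_cases j <;> simp [stdUnitary, stdKahler,
        EuclideanSpace.inner_single_left]
    have hn := hasFDerivAt_continuousAlternatingMap_const hΩ w
    have hre := Complex.reCLM.hasFDerivAt.comp y hn
    have him := Complex.imCLM.hasFDerivAt.comp y hn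
    have h1 := Complex.ofRealCLM.hasFDerivAt.comp y ((hre.mul hre).add (him.mul him))
    have h2 := h1.unique ((hasFDerivAt_det_of_eq_one hA hA1).congr_of_eventuallyEq (by
      filter_upwards [h] with z ⟨U', hU'⟩
      exact hU'.normSq_omega w))
    have h3 := congrArg (fun T => (T v).re) h2
    have hΩ1 : Ω y w = 1 := (hU.omega stdUnitary).trans stdOmega_stdUnitary
    simp [hΩ1] at h3
    rw [← h3]
    ring

/-- All derivatives at y are pulled back by the frame U at y alone, held constant near y. This is
the situation of `parallel_of_closed_of_standard`, and no frame has to vary differentiably. -/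
theorem parallel_of_closed_local {C S : ℝ} (hC : C ≠ 0) (hS : S ≠ 0)
    {G : E8 → E8 →L[ℝ] E8 →L[ℝ] ℝ}
    {κ : E8 → E8 [⋀^Fin 2]→L[ℝ] ℝ} {Ω φ : E8 → E8 [⋀^Fin 4]→L[ℝ] ℂ} {y : E8}
    (hG : DifferentiableAt ℝ G y) (hκ : DifferentiableAt ℝ κ y) (hΩ : DifferentiableAt ℝ Ω y)
    (hφ : DifferentiableAt ℝ φ y)
    (h : ∀ᶠ z in nhds y, ∃ U, IsAdaptedFrame (G z) (κ z) (Ω z) U)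
    (hdef : ∀ᶠ z in nhds y, ∀ a b c d, φ z ![a, b, c, d] = ((C * (Ω z ![a, b, c, d]).re -
      halfWedge (fun a b => κ z ![a, b]) a b c d : ℝ) : ℂ) +
        Complex.I * ((S * (Ω z ![a, b, c, d]).im : ℝ) : ℂ))
    (hcl : extDeriv φ y = 0) {Γ : E8 →L[ℝ] E8 →L[ℝ] E8} (hΓ : ∀ v w, Γ v w = Γ w v)
    (hDG : ∀ v a b, fderiv ℝ G y v a b = G y (Γ v a) b + G y a (Γ v b)) :
    fderiv ℝ Ω y = (Ω y).derivationAction ∘L Γ ∧ fderiv ℝ κ y = (κ y).derivationAction ∘L Γ := by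
  obtain ⟨U, hU⟩ := h.self_of_nhds
  let J : E8 → E8 → E8 := fun z => complexStructureOf (G z) (κ z)
  have hJU : ∀ a, J y (U a) = U (stdJ a) := hU.complexStructureOf_apply
  have rel := firstDerivative_relations hG hκ hΩ h (J := J) rfl
  let Uc : E8 →L[ℝ] E8 := U
  have hUc : ∀ v, Uc v = U v := fun v => rfl
  let pb2 := ContinuousAlternatingMap.compContinuousLinearMapCLM (𝕜 := ℝ) (ι := Fin 2) (F := ℝ) Uc
  let pb4 := ContinuousAlternatingMap.compContinuousLinearMapCLM (𝕜 := ℝ) (ι := Fin 4) (F := ℂ) Uc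
  have hp4 : ∀ (α : E8 [⋀^Fin 4]→L[ℝ] ℂ) a b c d, pb4 α ![a, b, c, d] = α ![U a, U b, U c, U d] :=
    fun α a b c d => congrArg α (by ext i : 1; fin_cases i <;> rfl)
  have hp2 : ∀ (α : E8 [⋀^Fin 2]→L[ℝ] ℝ) a b, pb2 α ![a, b] = α ![U a, U b] :=
    fun α a b => congrArg α (by ext i : 1; fin_cases i <;> rfl)
  let Γs : E8 →L[ℝ] E8 →L[ℝ] E8 :=
    (ContinuousLinearMap.compL ℝ E8 E8 E8 (U.symm : E8 →L[ℝ] E8)) ∘L (Γ.bilinearComp Uc Uc)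
  have hΓs : ∀ v a, Γs v a = U.symm (Γ (U v) (U a)) := fun v a => rfl
  have hUΓ : ∀ v a, U (Γs v a) = Γ (U v) (U a) := fun v a => by rw [hΓs, U.apply_symm_apply]
  obtain ⟨r1, r2⟩ := parallel_of_closed_of_standard hC hS (φ := pb4 (φ y))
    (Dφ := pb4 ∘L fderiv ℝ φ y ∘L Uc) (DΩ := pb4 ∘L fderiv ℝ Ω y ∘L Uc)
    (Dκ := pb2 ∘L fderiv ℝ κ y ∘L Uc) (Γ := Γs)
    (DG := fun v a b => fderiv ℝ G y (U v) (U a) (U b))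
    (DJ := fun v a => U.symm (fderiv ℝ (fun z => J z (U a)) y (U v)))
    (fun v w => by rw [hΓs, hΓs, hΓ])
    (fun v a b => by rw [hDG, ← hU.metric, ← hU.metric, hUΓ, hUΓ])
    (fun v a b => by
      simp only [ContinuousLinearMap.comp_apply, hp2, hUc]
      rw [← (rel (U v)).1, hJU, ← hU.metric, U.apply_symm_apply])
    (fun v a b => by
      rw [← (rel (U v)).2.1 (U a) (U b), hJU, hJU, ← hU.metric, ← hU.metric, U.apply_symm_apply,
        U.apply_symm_apply])
    (fun v a b c d => by
      simp only [ContinuousLinearMap.comp_apply, hp4, hUc]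
      rw [← (rel (U v)).2.2.1, hJU, ← hU.omega_vec4, U.apply_symm_apply])
    (fun v => (rel (U v)).2.2.2 U hU)
    (fun a b c d => by
      rw [hp4, hdef.self_of_nhds, hU.omega_vec4]
      simp only [halfWedge, hU.kahler])
    (fun v a b c d => by
      simp only [ContinuousLinearMap.comp_apply, hp4, hp2, hUc]
      rw [fderiv_cayley hκ hΩ hφ hdef]
      simp only [halfWedgePolar, hU.kahler])
    (by
      ext w
      have h1 := congrArg (fun T => T fun i => U (w i)) hcl
      rw [ContinuousAlternatingMap.alternatizeUncurryFin_apply]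
      exact (ContinuousAlternatingMap.alternatizeUncurryFin_apply (fderiv ℝ φ y)
        (fun i => U (w i))).symm.trans h1)
  have hw : ∀ {k : ℕ} (w : Fin k → E8), w = fun i => U (U.symm (w i)) := fun w => by simp
  have hupd : ∀ {k : ℕ} (w : Fin k → E8) (v : E8) (i : Fin k),
      (fun j => U.symm (Function.update w i (Γ v (w i)) j)) =
        Function.update (fun j => U.symm (w j)) i (Γs (U.symm v) (U.symm (w i))) := by
    intro k w v i
    ext1 j
    rcases eq_or_ne j i with rfl | hj
    · simp [hΓs]
    · simp [hj]
  constructor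
  · ext v w
    have h1 := congrArg (fun T => T (U.symm v) fun i => U.symm (w i)) r1
    refine Eq.trans ?_ (h1.trans ?_)
    · change _ = fderiv ℝ Ω y (U (U.symm v)) fun i => U (U.symm (w i))
      rw [U.apply_symm_apply, ← hw]
    · change stdOmegaAlt.derivationAction _ _ = (Ω y).derivationAction _ _
      rw [ContinuousAlternatingMap.derivationAction_apply,
        ContinuousAlternatingMap.derivationAction_apply]
      refine Finset.sum_congr rfl fun i _ => ?_
      rw [hU.omega_eq]
      exact congrArg stdOmegaAlt (hupd w v i).symm
  · ext v w
    have h1 := congrArg (fun T => T (U.symm v) fun i => U.symm (w i)) r2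
    refine Eq.trans ?_ (h1.trans ?_)
    · change _ = fderiv ℝ κ y (U (U.symm v)) fun i => U (U.symm (w i))
      rw [U.apply_symm_apply, ← hw]
    · change stdKahlerAlt.derivationAction _ _ = (κ y).derivationAction _ _
      rw [ContinuousAlternatingMap.derivationAction_apply,
        ContinuousAlternatingMap.derivationAction_apply]
      refine Finset.sum_congr rfl fun i _ => ?_
      rw [hU.kahler_eq]
      exact congrArg stdKahlerAlt (hupd w v i).symm

end LocalParallel

/-! ### Christoffel symbols; torsion-free implies closed. -/

section ChartForms

variable {M : Type*} [TopologicalSpace M] [ChartedSpace E8 M] [IsManifold 𝓘(ℝ, E8) ∞ M]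
  {e : OpenPartialHomeomorph M E8} {τ : ℝ} {Φ : DiffForm M 4 ℂ} {S : SU4Structure M}

theorem SU4Structure.exists_isAdaptedFrame (S : SU4Structure M) (he : e ∈ atlas E8 M) {y : E8}
    (hy : y ∈ e.target) : ∃ U, IsAdaptedFrame (metricInChart S.metric e y) (S.kahler.inChart e y)
      (S.omega.inChart e y) U := by
  obtain ⟨u, hg, hκ, hΩ⟩ := S.adapted (e.symm y)
  obtain ⟨U, hU⟩ := exists_chart_frame he hy u
  refine ⟨U, fun v w => ?_, fun v w => ?_, fun v => ?_⟩
  · rw [metricInChart_apply, hU, hU, hg]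
  · rw [DiffForm.inChart_vec2, hU, hU, hκ]
  · rw [← hΩ]
    exact congrArg (S.omega (e.symm y)) (funext fun i => hU (v i))

theorem SU4Structure.IsDefinedBy.inChart (h : S.IsDefinedBy τ Φ)
    (e : OpenPartialHomeomorph M E8) (y a b c d : E8) :
    Φ.inChart e y ![a, b, c, d] = ((Real.cosh (2 * τ) * (S.omega.inChart e y ![a, b, c, d]).re -
      halfWedge (fun a b => S.kahler.inChart e y ![a, b]) a b c d : ℝ) : ℂ) +
        Complex.I * ((Real.sinh (2 * τ) * (S.omega.inChart e y ![a, b, c, d]).im : ℝ) : ℂ) := by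
  refine (h (e.symm y) _).trans ?_
  rw [DiffForm.wedgeTwo_self, ← mul_assoc, show (1 / 2 : ℝ) * 2 = 1 by norm_num, one_mul]
  simp only [halfWedge, DiffForm.inChart_vec2]
  rfl

variable {k : ℕ} {F : Type*} [NormedAddCommGroup F] [NormedSpace ℝ F]

theorem sum_smulRight_single (T : Fin 8 → E8 →L[ℝ] E8) (v : E8) (a : Fin 8) :
    (∑ b, ContinuousLinearMap.smulRightL ℝ E8 E8 (EuclideanSpace.proj b) ∘L T b) v
      (EuclideanSpace.single a 1) = T a v := by
  rw [ContinuousLinearMap.sum_apply, ContinuousLinearMap.sum_apply, Finset.sum_eq_single a]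
  · simp
  · intro b _ hb
    simp [hb]
  · simp

/-- The map `v ↦ ∇_v ∂_a` of a connection in a chart. -/
noncomputable def christoffelColumn (cov : AffineConnection M) (e : OpenPartialHomeomorph M E8)
    (x : M) (a : Fin 8) : E8 →L[ℝ] E8 :=
  mfderiv 𝓘(ℝ, E8) 𝓘(ℝ, E8) e x ∘L cov (constField e (EuclideanSpace.single a 1)) x ∘L
    (mfderiv 𝓘(ℝ, E8) 𝓘(ℝ, E8) e x).inverse

/-- The Christoffel symbols of a connection in a chart. -/
noncomputable def christoffel (cov : AffineConnection M) (e : OpenPartialHomeomorph M E8) (x : M) :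
    E8 →L[ℝ] E8 →L[ℝ] E8 :=
  ∑ a, ContinuousLinearMap.smulRightL ℝ E8 E8 (EuclideanSpace.proj a) ∘L
    christoffelColumn cov e x a

theorem christoffel_single (cov : AffineConnection M) (x : M) (v : TangentSpace 𝓘(ℝ, E8) x)
    (he : e ∈ atlas E8 M) (hx : x ∈ e.source) (a : Fin 8) :
    christoffel cov e x (mfderiv 𝓘(ℝ, E8) 𝓘(ℝ, E8) e x v) (EuclideanSpace.single a 1) =
      mfderiv 𝓘(ℝ, E8) 𝓘(ℝ, E8) e x (cov (constField e (EuclideanSpace.single a 1)) x v) := by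
  have h1 : (mfderiv 𝓘(ℝ, E8) 𝓘(ℝ, E8) e x).inverse (mfderiv 𝓘(ℝ, E8) 𝓘(ℝ, E8) e x v) = v :=
    (isInvertible_mfderiv_chart he hx).inverse_apply_self v
  exact (sum_smulRight_single _ _ a).trans (congrArg (fun u => mfderiv 𝓘(ℝ, E8) 𝓘(ℝ, E8) e x
    (cov (constField e (EuclideanSpace.single a 1)) x u)) h1)

theorem fieldInChart_constField_fderiv (he : e ∈ atlas E8 M) {x : M} (hx : x ∈ e.source) (w : E8) :
    fieldInChart e (constField e w) (e x) = w ∧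
      fderiv ℝ (fieldInChart e (constField e w)) (e x) = 0 := by
  refine ⟨fieldInChart_constField he (e.map_source hx) w, ?_⟩
  have h : fieldInChart e (constField e w) =ᶠ[nhds (e x)] fun _ => w := by
    filter_upwards [e.open_target.mem_nhds (e.map_source hx)] with y hy
    exact fieldInChart_constField he hy w
  rw [h.fderiv_eq]
  exact (hasFDerivAt_const w (e x)).fderiv

/-- Tested on fields that are constant in the chart, ∇α = 0 says that the derivative of the
coefficients is the Christoffel action. -/
theorem AffineConnection.PreservesForm.fderiv_inChart {cov : AffineConnection M}
    {α : DiffForm M k F} (h : AffineConnection.PreservesForm cov α) (hα : α.IsSmooth)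
    (he : e ∈ atlas E8 M) {x : M} (hx : x ∈ e.source) :
    fderiv ℝ (α.inChart e) (e x) = (α.inChart e (e x)).derivationAction ∘L christoffel cov e x := by
  ext1 v
  obtain ⟨v, rfl⟩ : ∃ v' : TangentSpace 𝓘(ℝ, E8) x, mfderiv 𝓘(ℝ, E8) 𝓘(ℝ, E8) e x v' = v :=
    (isInvertible_mfderiv_chart he hx).surjective v
  apply ContinuousAlternatingMap.toAlternatingMap_injective
  refine (EuclideanSpace.basisFun (Fin 8) ℝ).toBasis.ext_alternating fun I _ => ?_
  simp only [OrthonormalBasis.coe_toBasis, EuclideanSpace.basisFun_apply]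
  let Y : Fin k → ∀ x : M, TangentSpace 𝓘(ℝ, E8) x :=
    fun i => constField e (EuclideanSpace.single (I i) 1)
  have hY : ∀ i, VectorFieldDifferentiableAt (Y i) x := fun i =>
    constField_differentiableAt he hx _
  have hYc := fun i => fieldInChart_constField_fderiv he hx (EuclideanSpace.single (I i) 1)
  have hs : ∀ a : E8, ∑ i, α.inChart e (e x) (Function.update (fun i => fieldInChart e (Y i) (e x))
      i (fderiv ℝ (fieldInChart e (Y i)) (e x) a)) = 0 := by
    intro a
    refine Finset.sum_eq_zero fun i _ => ?_
    rw [(hYc i).2]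
    exact (α.inChart e (e x)).map_coord_zero i (by simp)
  have hw : (fun i => fieldInChart e (Y i) (e x)) = fun i => EuclideanSpace.single (I i) 1 :=
    funext fun i => (hYc i).1
  have h1 : fderiv ℝ (α.inChart e) (e x) (mfderiv 𝓘(ℝ, E8) 𝓘(ℝ, E8) e x v)
      (fun i => fieldInChart e (Y i) (e x)) =
      ∑ i, α x (Function.update (fun j => Y j x) i (cov (Y i) x v)) :=
    (add_zero _).symm.trans ((congrArg (_ + ·) (hs _).symm).trans
      ((DiffForm.mvfderiv_apply hα he hx hY v).symm.trans (h x Y hY v)))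
  rw [hw] at h1
  refine h1.trans (Eq.trans ?_ ((α.inChart e (e x)).derivationAction_apply _ _).symm)
  refine Finset.sum_congr rfl fun i _ => ?_
  rw [← α.inChart_apply_mfderiv he hx]
  refine congrArg _ ?_
  ext1 j
  rcases eq_or_ne j i with rfl | hj
  · simp only [Function.update_self]
    exact (christoffel_single cov x v he hx (I j)).symm
  · simp only [Function.update_of_ne hj]
    rw [← fieldInChart_apply hx]
    exact (hYc j).1

/-- Coordinate fields commute, so the torsion on them is the antisymmetric part of the Christoffel
symbols. -/
theorem christoffel_symm {cov : AffineConnection M} (h : cov.torsion = 0)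
    (he : e ∈ atlas E8 M) {x : M} (hx : x ∈ e.source) (v w : E8) :
    christoffel cov e x v w = christoffel cov e x w v := by
  have hA : ∀ w, mfderiv 𝓘(ℝ, E8) 𝓘(ℝ, E8) e x (constField e w x) = w := fun w => by
    rw [← fieldInChart_apply hx]
    exact (fieldInChart_constField_fderiv he hx w).1
  have key : ∀ a b : Fin 8, christoffel cov e x (EuclideanSpace.single b 1)
      (EuclideanSpace.single a 1) = christoffel cov e x (EuclideanSpace.single a 1)
        (EuclideanSpace.single b 1) := by
    intro a b
    have ha := christoffel_single cov x (constField e (EuclideanSpace.single b 1) x) he hx a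
    have hb := christoffel_single cov x (constField e (EuclideanSpace.single a 1) x) he hx b
    rw [hA] at ha hb
    rw [ha, hb]
    refine sub_eq_zero.1 ?_
    have h1 := (CovariantDerivative.torsion_eq_zero_iff cov).1 h
      (constField_differentiableAt he hx (EuclideanSpace.single b 1))
      (constField_differentiableAt he hx (EuclideanSpace.single a 1))
    have h2 := congrArg (mfderiv 𝓘(ℝ, E8) 𝓘(ℝ, E8) e x) h1
    rw [fieldInChart_mlieBracket he hx (constField_differentiableAt he hx _)
      (constField_differentiableAt he hx _)] at h2
    have h3 : VectorField.lieBracket ℝ (fieldInChart e (constField e (EuclideanSpace.single b 1)))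
        (fieldInChart e (constField e (EuclideanSpace.single a 1))) (e x) = 0 := by
      rw [VectorField.lieBracket, (fieldInChart_constField_fderiv he hx _).2,
        (fieldInChart_constField_fderiv he hx _).2]
      simp
    rw [h3] at h2
    exact (map_sub _ _ _).symm.trans h2
  let L : E8 →ₗ[ℝ] E8 →ₗ[ℝ] E8 :=
    LinearMap.mk₂ ℝ (fun v w => christoffel cov e x v w) (by simp) (by simp) (by simp) (by simp)
  have hL : L = L.flip := by
    refine (EuclideanSpace.basisFun (Fin 8) ℝ).toBasis.ext fun b =>
      (EuclideanSpace.basisFun (Fin 8) ℝ).toBasis.ext fun a => ?_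
    simp only [OrthonormalBasis.coe_toBasis, EuclideanSpace.basisFun_apply]
    exact key a b
  exact congrArg (fun T : E8 →ₗ[ℝ] E8 →ₗ[ℝ] E8 => T v w) hL

/-- As Φ is algebraic in ω and Ω, its derivative is the Christoffel action as well, and the
alternation of that vanishes by symmetry. -/
theorem SU4Structure.isClosed_of_isTorsionFree (hΦ : Φ.IsSmooth) (hS : S.IsDefinedBy τ Φ)
    (h : S.IsTorsionFree) : Φ.IsClosed := by
  obtain ⟨cov, ht, -, hκ, hΩ⟩ := h
  intro e he y hy
  obtain ⟨x, hx, rfl⟩ : ∃ x ∈ e.source, e x = y := ⟨e.symm y, e.map_target hy, e.right_inv hy⟩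
  have h1 := hκ.fderiv_inChart S.kahler_smooth he hx
  have h2 := hΩ.fderiv_inChart S.omega_smooth he hx
  have hd := fderiv_cayley (DiffForm.inChart_differentiableAt S.kahler_smooth he hy)
    (DiffForm.inChart_differentiableAt S.omega_smooth he hy)
    (DiffForm.inChart_differentiableAt hΦ he hy)
    (Filter.Eventually.of_forall fun z => hS.inChart e z)
  have h3 : fderiv ℝ (Φ.inChart e) (e x) =
      (Φ.inChart e (e x)).derivationAction ∘L christoffel cov e x := by
    ext v w
    have hw : w = ![w 0, w 1, w 2, w 3] := by ext i : 1; fin_cases i <;> rfl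
    rw [hw, hd, h1, h2]
    simp only [ContinuousLinearMap.comp_apply, ContinuousAlternatingMap.derivationAction_vec4,
      ContinuousAlternatingMap.derivationAction_vec2, hS.inChart, halfWedge, halfWedgePolar,
      Complex.add_re, Complex.add_im]
    push_cast
    ring
  rw [extDeriv, h3]
  exact ContinuousAlternatingMap.alternatize_derivationAction _ (christoffel_symm ht he hx)

end ChartForms

/-! ### The Levi-Civita connection; closed implies torsion-free. -/

section LeviCivita

/-- The Koszul formula 2 G(Γ v w, z) = D v w z + D w v z − D z v w for coordinate fields. -/
theorem exists_symmetric_of_metric_derivative {G : E8 →L[ℝ] E8 →L[ℝ] ℝ} (hG : G.IsInvertible)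
    (hs : ∀ a b, G a b = G b a) (D : E8 →L[ℝ] E8 →L[ℝ] E8 →L[ℝ] ℝ)
    (hD : ∀ v a b, D v a b = D v b a) :
    ∃ Γ : E8 →L[ℝ] E8 →L[ℝ] E8, (∀ v w, Γ v w = Γ w v) ∧
      ∀ v a b, D v a b = G (Γ v a) b + G a (Γ v b) := by
  let R : E8 →L[ℝ] E8 →L[ℝ] E8 →L[ℝ] ℝ :=
    (ContinuousLinearMap.flipₗᵢ ℝ E8 E8 ℝ).toContinuousLinearEquiv.toContinuousLinearMap ∘L D.flip
  have hR : ∀ v w z, R v w z = D z v w := fun v w z => rfl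
  let L : E8 →ₗ[ℝ] E8 →ₗ[ℝ] E8 :=
    LinearMap.mk₂ ℝ (fun v w => G.inverse ((1 / 2 : ℝ) • (D v w + D w v - R v w)))
      (fun v v' w => by
        rw [← map_add]; congr 1; ext z; simp only [map_add, ContinuousLinearMap.add_apply,
          ContinuousLinearMap.sub_apply, ContinuousLinearMap.smul_apply, smul_eq_mul]; ring)
      (fun c v w => by
        rw [← map_smul]; congr 1; ext z; simp only [map_smul, ContinuousLinearMap.add_apply,
          ContinuousLinearMap.sub_apply, ContinuousLinearMap.smul_apply, smul_eq_mul]; ring)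
      (fun v w w' => by
        rw [← map_add]; congr 1; ext z; simp only [map_add, ContinuousLinearMap.add_apply,
          ContinuousLinearMap.sub_apply, ContinuousLinearMap.smul_apply, smul_eq_mul]; ring)
      (fun c v w => by
        rw [← map_smul]; congr 1; ext z; simp only [map_smul, ContinuousLinearMap.add_apply,
          ContinuousLinearMap.sub_apply, ContinuousLinearMap.smul_apply, smul_eq_mul]; ring)
  let Γ : E8 →L[ℝ] E8 →L[ℝ] E8 := L.toContinuousBilinearMap
  have hK : ∀ v w z, G (Γ v w) z = 1 / 2 * (D v w z + D w v z - D z v w) := fun v w z =>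
    congrArg (fun T : E8 →L[ℝ] ℝ => T z) (hG.self_apply_inverse _)
  refine ⟨Γ, fun v w => hG.injective (ContinuousLinearMap.ext fun z => ?_), fun v a b => ?_⟩
  · rw [hK, hK, hD z v w]
    ring
  · rw [hs a, hK, hK, hD v b a, hD b v a, hD a v b]
    ring

variable {M : Type*} [TopologicalSpace M] [ChartedSpace E8 M] [IsManifold 𝓘(ℝ, E8) ∞ M]

theorem fderiv_metricInChart_symm (g : SmoothMetric M) {e : OpenPartialHomeomorph M E8}
    (he : e ∈ atlas E8 M) {y : E8} (hy : y ∈ e.target) (v a b : E8) :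
    fderiv ℝ (metricInChart g e) y v a b = fderiv ℝ (metricInChart g e) y v b a := by
  have hd := metricInChart_differentiableAt g he hy
  have h : ∀ a b : E8, fderiv ℝ (fun z => metricInChart g e z a b) y v =
      fderiv ℝ (metricInChart g e) y v a b := fun a b => by
    rw [fderiv_clm_apply (hd.clm_apply (differentiableAt_const a)) (differentiableAt_const b),
      fderiv_clm_apply hd (differentiableAt_const a)]
    simp
  rw [← h, ← h]
  simp only [metricInChart_symm g _ a b]

/-- The derivative of a vector field for the connection with Christoffel symbols `Γ x` at `x` in
the preferred chart there. -/
noncomputable def chartCovariantDerivative (Γ : M → E8 →L[ℝ] E8 →L[ℝ] E8)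
    (Y : ∀ x : M, TangentSpace 𝓘(ℝ, E8) x) (x : M) : E8 →L[ℝ] E8 :=
  fderiv ℝ (fieldInChart (chartAt E8 x) Y) (chartAt E8 x x) +
    (Γ x).flip (fieldInChart (chartAt E8 x) Y (chartAt E8 x x))

theorem fieldInChart_add (e : OpenPartialHomeomorph M E8)
    (Y Z : ∀ x : M, TangentSpace 𝓘(ℝ, E8) x) :
    fieldInChart e (Y + Z) = fieldInChart e Y + fieldInChart e Z :=
  funext fun y => map_add (mfderiv 𝓘(ℝ, E8) 𝓘(ℝ, E8) e (e.symm y)) _ _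

theorem fieldInChart_smul (e : OpenPartialHomeomorph M E8) (f : M → ℝ)
    (Y : ∀ x : M, TangentSpace 𝓘(ℝ, E8) x) :
    fieldInChart e (f • Y) = fun y => f (e.symm y) • fieldInChart e Y y :=
  funext fun y => map_smul (mfderiv 𝓘(ℝ, E8) 𝓘(ℝ, E8) e (e.symm y)) _ _

theorem chartCovariantDerivative_add (Γ : M → E8 →L[ℝ] E8 →L[ℝ] E8) {x : M}
    {Y Z : ∀ x : M, TangentSpace 𝓘(ℝ, E8) x} (hY : VectorFieldDifferentiableAt Y x)
    (hZ : VectorFieldDifferentiableAt Z x) : chartCovariantDerivative Γ (Y + Z) x =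
      chartCovariantDerivative Γ Y x + chartCovariantDerivative Γ Z x := by
  have hx := mem_chart_source E8 x
  have he := chart_mem_atlas E8 x
  rw [chartCovariantDerivative, fieldInChart_add, fderiv_add (fieldInChart_differentiableAt he hx hY)
    (fieldInChart_differentiableAt he hx hZ), Pi.add_apply, map_add, chartCovariantDerivative,
    chartCovariantDerivative]
  abel

theorem chartCovariantDerivative_smul (Γ : M → E8 →L[ℝ] E8 →L[ℝ] E8) {x : M}
    {Y : ∀ x : M, TangentSpace 𝓘(ℝ, E8) x} (hY : VectorFieldDifferentiableAt Y x) {f : M → ℝ}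
    (hf : MDifferentiableAt 𝓘(ℝ, E8) 𝓘(ℝ, ℝ) f x) (v : TangentSpace 𝓘(ℝ, E8) x) :
    chartCovariantDerivative Γ (f • Y) x (mfderiv 𝓘(ℝ, E8) 𝓘(ℝ, E8) (chartAt E8 x) x v) =
      f x • chartCovariantDerivative Γ Y x (mfderiv 𝓘(ℝ, E8) 𝓘(ℝ, E8) (chartAt E8 x) x v) +
        mvfderiv 𝓘(ℝ, E8) f x v • fieldInChart (chartAt E8 x) Y (chartAt E8 x x) := by
  have hx := mem_chart_source E8 x
  have he := chart_mem_atlas E8 x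
  set e := chartAt E8 x
  have hl := e.left_inv hx
  have hd : DifferentiableAt ℝ (fun y => f (e.symm y)) (e x) := by
    refine MDifferentiableAt.differentiableAt (MDifferentiableAt.comp (g := f) (e x) ?_
      ((mdifferentiable_of_mem_atlas' he).mdifferentiableAt_symm (e.map_source hx)))
    rw [hl]
    exact hf
  have key : ∀ w : E8, chartCovariantDerivative Γ (f • Y) x w =
      f x • chartCovariantDerivative Γ Y x w +
        fderiv ℝ (fun y => f (e.symm y)) (e x) w • fieldInChart e Y (e x) := by
    intro w
    rw [chartCovariantDerivative, chartCovariantDerivative, fieldInChart_smul,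
      fderiv_fun_smul hd (fieldInChart_differentiableAt he hx hY)]
    simp only [ContinuousLinearMap.add_apply, ContinuousLinearMap.smul_apply, map_smul,
      ContinuousLinearMap.smulRight_apply, hl, e]
    module
  rw [mvfderiv_eq_fderiv he hx (fun _ _ => rfl) hd]
  exact key _

/-- The connection with Christoffel symbols `Γ x` at `x` in the preferred chart there. -/
noncomputable def chartConnection (Γ : M → E8 →L[ℝ] E8 →L[ℝ] E8) : AffineConnection M where
  toFun Y x := (mfderiv 𝓘(ℝ, E8) 𝓘(ℝ, E8) (chartAt E8 x) x).inverse ∘L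
    (chartCovariantDerivative Γ Y x) ∘L mfderiv 𝓘(ℝ, E8) 𝓘(ℝ, E8) (chartAt E8 x) x
  -- Additivity and the Leibniz rule are conditions at one point at a time, so neither smoothness of
  -- x ↦ Γ x nor compatibility between charts is needed.
  isCovariantDerivativeOnUniv := by
    refine ⟨fun {Y Z x} hY hZ _ => ?_, fun {Y f x} hY hf _ => ?_⟩
    · ext1 v
      exact (congrArg (fun T : E8 →L[ℝ] E8 => (mfderiv 𝓘(ℝ, E8) 𝓘(ℝ, E8) (chartAt E8 x) x).inverse
        (T (mfderiv 𝓘(ℝ, E8) 𝓘(ℝ, E8) (chartAt E8 x) x v)))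
          (chartCovariantDerivative_add Γ hY hZ)).trans (map_add _ _ _)
    · ext1 v
      have h1 := isInvertible_mfderiv_chart (chart_mem_atlas E8 x) (mem_chart_source E8 x)
      refine (congrArg (mfderiv 𝓘(ℝ, E8) 𝓘(ℝ, E8) (chartAt E8 x) x).inverse
        (chartCovariantDerivative_smul Γ hY hf v)).trans ((map_add _ _ _).trans
          (congrArg₂ (· + ·) (map_smul _ _ _) ((map_smul _ _ _).trans (congrArg _ ?_))))
      refine (congrArg _ (fieldInChart_apply (mem_chart_source E8 x) Y)).trans ?_
      exact h1.inverse_apply_self _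

theorem mfderiv_chartConnection (Γ : M → E8 →L[ℝ] E8 →L[ℝ] E8)
    (Y : ∀ x : M, TangentSpace 𝓘(ℝ, E8) x) (x : M) (v : TangentSpace 𝓘(ℝ, E8) x) :
    mfderiv 𝓘(ℝ, E8) 𝓘(ℝ, E8) (chartAt E8 x) x (chartConnection Γ Y x v) =
      fderiv ℝ (fieldInChart (chartAt E8 x) Y) (chartAt E8 x x)
          (mfderiv 𝓘(ℝ, E8) 𝓘(ℝ, E8) (chartAt E8 x) x v) +
        Γ x (mfderiv 𝓘(ℝ, E8) 𝓘(ℝ, E8) (chartAt E8 x) x v)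
          (fieldInChart (chartAt E8 x) Y (chartAt E8 x x)) :=
  (isInvertible_mfderiv_chart (chart_mem_atlas E8 x) (mem_chart_source E8 x)).self_apply_inverse _

theorem chartConnection_torsion {Γ : M → E8 →L[ℝ] E8 →L[ℝ] E8}
    (h : ∀ x v w, Γ x v w = Γ x w v) : (chartConnection Γ).torsion = 0 := by
  refine (CovariantDerivative.torsion_eq_zero_iff _).2 fun {X Y x} hX hY => ?_
  have hx := mem_chart_source E8 x
  have he := chart_mem_atlas E8 x
  refine (isInvertible_mfderiv_chart he hx).injective ?_
  refine Eq.trans ?_ (fieldInChart_mlieBracket he hx hX hY).symm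
  refine (map_sub _ _ _).trans ?_
  refine (congrArg₂ (fun a b : E8 => a - b) (mfderiv_chartConnection Γ Y x (X x))
    (mfderiv_chartConnection Γ X x (Y x))).trans ?_
  rw [← fieldInChart_apply hx, ← fieldInChart_apply hx, VectorField.lieBracket, h x]
  abel

theorem chartConnection_preservesMetric {Γ : M → E8 →L[ℝ] E8 →L[ℝ] E8} (g : SmoothMetric M)
    (h : ∀ (x : M) (v a b : E8),
      fderiv ℝ (metricInChart g (chartAt E8 x)) (chartAt E8 x x) v a b =
        metricInChart g (chartAt E8 x) (chartAt E8 x x) (Γ x v a) b +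
          metricInChart g (chartAt E8 x) (chartAt E8 x x) a (Γ x v b)) :
    AffineConnection.PreservesMetric (chartConnection Γ) g := by
  intro x Y Z hY hZ v
  have hx := mem_chart_source E8 x
  have he := chart_mem_atlas E8 x
  set e := chartAt E8 x
  have key : ∀ w a b A B : E8, fderiv ℝ (metricInChart g e) (e x) w a b +
      metricInChart g e (e x) A b + metricInChart g e (e x) a B =
      metricInChart g e (e x) (A + Γ x w a) b + metricInChart g e (e x) a (B + Γ x w b) := by
    intro w a b A B
    rw [h x w a b]
    simp only [map_add, ContinuousLinearMap.add_apply]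
    ring
  rw [mvfderiv_metric_apply g he hx hY hZ, ← metricInChart_apply_mfderiv g he hx,
    ← metricInChart_apply_mfderiv g he hx, mfderiv_chartConnection, mfderiv_chartConnection,
    ← fieldInChart_apply hx, ← fieldInChart_apply hx]
  exact key _ _ _ _ _

variable {k : ℕ} {F : Type*} [NormedAddCommGroup F] [NormedSpace ℝ F]

theorem chartConnection_preservesForm {Γ : M → E8 →L[ℝ] E8 →L[ℝ] E8} {α : DiffForm M k F}
    (hα : α.IsSmooth) (h : ∀ x : M, fderiv ℝ (α.inChart (chartAt E8 x)) (chartAt E8 x x) =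
      (α.inChart (chartAt E8 x) (chartAt E8 x x)).derivationAction ∘L Γ x) :
    AffineConnection.PreservesForm (chartConnection Γ) α := by
  intro x Y hY v
  have hx := mem_chart_source E8 x
  have he := chart_mem_atlas E8 x
  rw [DiffForm.mvfderiv_apply hα he hx hY, h x]
  refine (congrArg (· + _) (ContinuousAlternatingMap.derivationAction_apply _ _ _)).trans ?_
  rw [← Finset.sum_add_distrib]
  refine Finset.sum_congr rfl fun i _ => ?_
  rw [← ContinuousAlternatingMap.map_update_add, ← α.inChart_apply_mfderiv he hx]
  refine congrArg _ (funext fun j => ?_)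
  rcases eq_or_ne j i with rfl | hj
  · simp only [Function.update_self]
    exact (add_comm _ _).trans (mfderiv_chartConnection Γ (Y j) x v).symm
  · simp only [Function.update_of_ne hj]
    exact fieldInChart_apply hx _

/-- At each x the Koszul symbols of g in the preferred chart at x are used, and closedness is
applied in that chart at that point only. -/
theorem SU4Structure.isTorsionFree_of_isClosed {τ : ℝ} (hτ : τ ≠ 0) {Φ : DiffForm M 4 ℂ}
    (hΦ : Φ.IsSmooth) {S : SU4Structure M} (hS : S.IsDefinedBy τ Φ) (h : Φ.IsClosed) :
    S.IsTorsionFree := by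
  have hex : ∀ x : M, ∃ Γ : E8 →L[ℝ] E8 →L[ℝ] E8, (∀ v w, Γ v w = Γ w v) ∧ ∀ v a b,
      fderiv ℝ (metricInChart S.metric (chartAt E8 x)) (chartAt E8 x x) v a b =
        metricInChart S.metric (chartAt E8 x) (chartAt E8 x x) (Γ v a) b +
          metricInChart S.metric (chartAt E8 x) (chartAt E8 x x) a (Γ v b) := fun x =>
    exists_symmetric_of_metric_derivative
      (metricInChart_isInvertible _ (chart_mem_atlas E8 x) (mem_chart_target E8 x))
      (metricInChart_symm _ _) _
      (fderiv_metricInChart_symm _ (chart_mem_atlas E8 x) (mem_chart_target E8 x))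
  choose Γ hΓ hD using hex
  have hpar := fun x : M => parallel_of_closed_local (C := Real.cosh (2 * τ))
    (S := Real.sinh (2 * τ)) (Real.cosh_pos _).ne'
    (fun h0 => hτ (by simpa using Real.sinh_eq_zero.1 h0))
    (metricInChart_differentiableAt S.metric (chart_mem_atlas E8 x) (mem_chart_target E8 x))
    (DiffForm.inChart_differentiableAt S.kahler_smooth (chart_mem_atlas E8 x)
      (mem_chart_target E8 x))
    (DiffForm.inChart_differentiableAt S.omega_smooth (chart_mem_atlas E8 x)
      (mem_chart_target E8 x))
    (DiffForm.inChart_differentiableAt hΦ (chart_mem_atlas E8 x) (mem_chart_target E8 x))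
    (Filter.eventually_of_mem ((chartAt E8 x).open_target.mem_nhds (mem_chart_target E8 x))
      fun z hz => S.exists_isAdaptedFrame (chart_mem_atlas E8 x) hz)
    (Filter.Eventually.of_forall fun z => hS.inChart (chartAt E8 x) z)
    (h _ (chart_mem_atlas E8 x) _ (mem_chart_target E8 x)) (hΓ x) (hD x)
  exact ⟨chartConnection Γ, chartConnection_torsion hΓ, chartConnection_preservesMetric _ hD,
    chartConnection_preservesForm S.kahler_smooth fun x => (hpar x).2,
    chartConnection_preservesForm S.omega_smooth fun x => (hpar x).1⟩

end LeviCivita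

/-! ### Conclusion. -/

theorem mainTheorem1 {M : Type*} [TopologicalSpace M] [T2Space M] [ChartedSpace E8 M]
    [IsManifold 𝓘(ℝ, E8) ∞ M] (τ : ℝ) (hτ : τ ≠ 0) (Φ : DiffForm M 4 ℂ)
    (hΦ : IsComplexCayleyForm τ Φ) :
    (∃! S : SU4Structure M, S.IsDefinedBy τ Φ) ∧
      ∀ S : SU4Structure M, S.IsDefinedBy τ Φ → (S.IsTorsionFree ↔ Φ.IsClosed) := by
  refine ⟨?_, fun S hS => ⟨?_, ?_⟩⟩
  · obtain ⟨S, hS⟩ := SU4Structure.exists_isDefinedBy hτ hΦ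
    exact ⟨S, hS, fun S' hS' => SU4Structure.eq_of_isDefinedBy hτ hS' hS⟩
  · exact SU4Structure.isClosed_of_isTorsionFree hΦ.1 hS
  · exact SU4Structure.isTorsionFree_of_isClosed hτ hΦ.1 hS
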